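/- **Setting.** Let $v\in L^1(\mathbb R^3)$ be real, with Fourier transform $\hat v(\mathbf p)=\int v(\mathbf x)e^{-i\mathbf p\mathbf x}\,d\mathbf x$, and let $V\in\,]0,\infty[$. Assume: (i) $\hat v\in L^2(\mathbb R^3)$, $v(-\mathbf x)=v(\mathbf x)$, $v$ is rotationally invariant (as elements of $L^1$), so that $\hat v$ is real and is a function $\hat v(k)$ of $k=|\mathbf k|$; (ii) $\hat v(0)>0$ and $\hat v(\mathbf k)>-\hat v(0)\frac{|\mathbf k|^2}{4\nu}$ for all $\mathbf k$ and all $\nu\in\,]0,V]$; (iii) $\hat v$ is $C^1$ on $\mathbb R^3$ and $C^5$ in a neighbourhood of $0$, and $\frac{\nu}{\hat v(0)}\frac{d^2\hat v}{dk^2}(0)>-\frac12$ for all $\nu\in\,]0,V]$; (iv) for all $\nu\in\,]0,V]$ the function $\frac{k^2}{2\nu}+\frac{\hat v(k)}{\hat v(0)}+\frac{k}{2\hat v(0)}\frac{d\hat v(k)}{dk}$ has only finitely many zeros in $k\ge0$, and its lower limit as $k\to+\infty$ is positive. For $\nu\in\,]0,V]$ put $\omega_{bg}(\mathbf k)=\sqrt{\frac14|\mathbf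 k|^4+\frac{\nu\hat v(\mathbf k)}{\hat v(0)}|\mathbf k|^2}$ and $$s_{\mathbf k}=\frac{\sqrt{\sqrt{\omega_{bg}(\mathbf k)^2+\nu^2\hat v(\mathbf k)^2/\hat v(0)^2}-\omega_{bg}(\mathbf k)}}{\sqrt{2\omega_{bg}(\mathbf k)}},\qquad c_{\mathbf k}=\frac{\sqrt{\sqrt{\omega_{bg}(\mathbf k)^2+\nu^2\hat v(\mathbf k)^2/\hat v(0)^2}+\omega_{bg}(\mathbf k)}}{\sqrt{2\omega_{bg}(\mathbf k)}},$$ $$j(\mathbf k;\mathbf p,\mathbf q)=\sqrt{\tfrac{\nu}{\hat v(0)}}\Big[\hat v(\mathbf k)(s_{\mathbf k}-c_{\mathbf k})(c_{\mathbf p}s_{\mathbf q}+c_{\mathbf q}s_{\mathbf p})+\hat v(\mathbf p)(c_{\mathbf p}-s_{\mathbf p})(c_{\mathbf k}c_{\mathbf q}+s_{\mathbf k}s_{\mathbf q})+\hat v(\mathbf q)(c_{\mathbf q}-s_{\mathbf q})(c_{\mathbf p}c_{\mathbf k}+s_{\mathbf p}s_{\mathbf k})\Big].$$ For $\beta>0$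 and $\mathbf k\ne0$ the Landau damping rate is $$\gamma_L(\mathbf k;\beta,\nu)=\pi\int\frac{d\mathbf p}{(2\pi)^3}\,j(\mathbf p-\mathbf k;\mathbf k,\mathbf p)^2\,\delta\big(\omega_{bg}(\mathbf k-\mathbf p)-\omega_{bg}(\mathbf p)-\omega_{bg}(\mathbf k)\big)\frac{\big(e^{\frac\beta2(\omega_{bg}(\mathbf k)+\omega_{bg}(\mathbf k-\mathbf p))}-e^{\frac\beta2\omega_{bg}(\mathbf p)}\big)^2}{(e^{\beta\omega_{bg}(\mathbf k)}-1)(e^{\beta\omega_{bg}(\mathbf p)}-1)(e^{\beta\omega_{bg}(\mathbf k-\mathbf p)}-1)},$$ where the integral with the Dirac delta is the limit as $\epsilon\searrow0$ of the integrals with $\delta(x)$ replaced by $\frac1\pi\frac{\epsilon}{x^2+\epsilon^2}$. For integers $n\ge2$ and $\theta\ge0$ let $$\mathcal G_n(\theta)=\int_0^\infty\frac{\sinh(\frac\theta2)\,t^n}{\sinh(\frac{t+\theta}2)\sinh(\frac t2)}\,dt .$$ **Theorem.** The integral defining $\mathcal G_n$ converges, $\mathcal G_n$ is continuous on $[0,\infty[$,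 and $\mathcal G_n(\theta)=2\Gamma(n+1)\big(\zeta(n+1)-\mathrm{Li}_{n+1}(e^{-\theta})\big)$, where $\mathrm{Li}_m(z)=\sum_{j\ge1}z^j/j^m$. Moreover $\mathcal G_n(\theta)=2\Gamma(n+1)\zeta(n+1)+O(e^{-\theta})$ as $\theta\to+\infty$, and, as $\theta\searrow0$, $\mathcal G_n(\theta)=2\Gamma(n+1)\zeta(n)\theta+O(\theta^2)$ if $n\ge3$, and $\mathcal G_2(\theta)=2\Gamma(3)\zeta(2)\theta+O(\theta^2|\log\theta|)$. In the following, "as $x,y,\dots\to0$" means: there are constants $C,\eta>0$ depending only on $v$ and $V$ such that for all $\nu\in\,]0,V]$, $\beta>0$, $\mathbf k\neq0$ for which the listed quantities are smaller than $\eta$, the $O(\cdot)$ is bounded in absolute value by $C$ times its argument. (a) For $\frac{|\mathbf k|}{\sqrt\nu}$ and $\frac1{\beta\nu}$ sufficiently small, the integrals with the approximate delta converge absolutely for every $\epsilon>0$ and have a finite limit $\gamma_L(\mathbf k;\beta,\nu)$ as $\epsilon\searrow0$, and $$\gamma_L=\frac{9\hat v(0)\nu^{3/2}}{64\pi(\beta\nu)^5}\Big[\mathcal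 G_4+2\beta\sqrt\nu|\mathbf k|\,\mathcal G_3+(\beta\sqrt\nu|\mathbf k|)^2\mathcal G_2\Big](\beta\omega_{bg}(\mathbf k))\Big(1+O\Big(\frac1{(\beta\nu)^2}+\frac{|\mathbf k|^2}{\nu}\Big)\Big)\quad\text{as }\frac{|\mathbf k|}{\sqrt\nu},\frac1{\beta\nu}\to0.$$ (b) $$\gamma_L=\frac{3\pi^3\hat v(0)\nu^{3/2}}{40}\,\frac{|\mathbf k|}{\sqrt\nu}\,\frac1{(\beta\nu)^4}\Big(1+O\Big(\beta\sqrt\nu|\mathbf k|+\frac1{(\beta\nu)^2}\Big)\Big)\quad\text{as }\frac{|\mathbf k|}{\sqrt\nu},\frac1{\beta\nu},\beta\sqrt\nu|\mathbf k|\to0.$$ (c) $$\gamma_L=\frac{9\zeta(3)\hat v(0)\nu^{3/2}}{16\pi}\,\frac1{(\beta\nu)^3}\,\frac{|\mathbf k|^2}{\nu}\Big(1+O\Big(\frac1{\beta\sqrt\nu|\mathbf k|}+\frac{|\mathbf k|^2}{\nu}\Big)\Big)\quad\text{as }\frac{|\mathbf k|}{\sqrt\nu},\frac1{\beta\nu},\frac1{\beta\sqrt\nu|\mathbf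 k|}\to0.$$ -/

import Mathlib

namespace BoseGas

noncomputable section

/-- Position and momentum space in dimension three. -/
abbrev Space : Type := EuclideanSpace ℝ (Fin 3)

/-- The Fourier transform `∫ v(x) e^{-i p·x} dx` of a potential, as a complex number. -/
def fourierTransform (v : Space → ℝ) (p : Space) : ℂ :=
  ∫ x : Space, (v x : ℂ) * Complex.exp (-Complex.I * ((inner ℝ p x : ℝ) : ℂ))

/-- The Fourier transform `v̂` of a (real, even) potential, as a real function of the momentum. -/
def vHat (v : Space → ℝ) (p : Space) : ℝ := (fourierTransform v p).re

/-- For a real even potential the Fourier transform is real, so nothing is lost in `vHat`. -/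
theorem vHat_eq_fourierTransform (v : Space → ℝ)
    (hv : (fun x => v (-x)) =ᵐ[MeasureTheory.volume] v) (p : Space) :
    ((vHat v p : ℝ) : ℂ) = fourierTransform v p := by
  have h : (starRingEnd ℂ) (fourierTransform v p) = fourierTransform v p := by
    unfold fourierTransform
    rw [← integral_conj, ← MeasureTheory.integral_neg_eq_self]
    apply MeasureTheory.integral_congr_ae
    filter_upwards [hv] with x hx
    rw [hx, map_mul, ← Complex.exp_conj]
    simp
  exact Complex.conj_eq_iff_re.mp h

/-- The Fourier transform of a rotation invariant potential as a function of `k = |k|`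
(evaluated along the first coordinate axis). -/
def vHatRadial (v : Space → ℝ) (r : ℝ) : ℝ := vHat v (r • EuclideanSpace.single 0 1)

/-- The function `k²/(2ν) + v̂(k)/v̂(0) + (k/(2 v̂(0))) dv̂(k)/dk`, whose zeros on `k > 0` are the
stationary points of the Bogoliubov dispersion relation. -/
def stationarity (v : Space → ℝ) (ν r : ℝ) : ℝ :=
  r ^ 2 / (2 * ν) + vHatRadial v r / vHat v 0
    + r / (2 * vHat v 0) * deriv (vHatRadial v) r

/-- The standing assumptions on the two-body potential, for all effective chemical potentials
`ν ∈ ]0, V]`. -/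
structure PotentialAssumptions (v : Space → ℝ) (V : ℝ) : Prop where
  integrable : MeasureTheory.Integrable v
  memLp_two : MeasureTheory.MemLp (vHat v) 2
  vHat_zero_pos : 0 < vHat v 0
  positivity : ∀ ν : ℝ, 0 < ν → ν ≤ V → ∀ k : Space,
    -vHat v 0 * (‖k‖ ^ 2 / (4 * ν)) < vHat v k
  even : (fun x => v (-x)) =ᵐ[MeasureTheory.volume] v
  rotationInvariant : ∀ R : Space ≃ₗᵢ[ℝ] Space,
    (fun x => v (R x)) =ᵐ[MeasureTheory.volume] v
  contDiffAt_zero : ContDiffAt ℝ 5 (vHat v) 0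
  convexity : ∀ ν : ℝ, 0 < ν → ν ≤ V →
    -(1 / 2) < ν / vHat v 0 * deriv (deriv (vHatRadial v)) 0
  contDiff_one : ContDiff ℝ 1 (vHat v)
  finite_stationary : ∀ ν : ℝ, 0 < ν → ν ≤ V →
    {r : ℝ | 0 ≤ r ∧ stationarity v ν r = 0}.Finite
  -- The lower limit is taken in the extended reals, since it may be `+∞`.
  liminf_stationarity : ∀ ν : ℝ, 0 < ν → ν ≤ V →
    0 < Filter.liminf (fun r : ℝ => ((stationarity v ν r : ℝ) : EReal)) Filter.atTop

/-- The Bogoliubov dispersion relation `ω_bg`. -/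
def omega (v : Space → ℝ) (ν : ℝ) (k : Space) : ℝ :=
  Real.sqrt (‖k‖ ^ 4 / 4 + ν * vHat v k / vHat v 0 * ‖k‖ ^ 2)

/-- The Bogoliubov coefficient `s_k`. -/
def sCoeff (v : Space → ℝ) (ν : ℝ) (k : Space) : ℝ :=
  Real.sqrt (Real.sqrt (omega v ν k ^ 2 + ν ^ 2 * (vHat v k ^ 2 / vHat v 0 ^ 2)) - omega v ν k)
    / Real.sqrt (2 * omega v ν k)

/-- The Bogoliubov coefficient `c_k`. -/
def cCoeff (v : Space → ℝ) (ν : ℝ) (k : Space) : ℝ :=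
  Real.sqrt (Real.sqrt (omega v ν k ^ 2 + ν ^ 2 * (vHat v k ^ 2 / vHat v 0 ^ 2)) + omega v ν k)
    / Real.sqrt (2 * omega v ν k)

/-- The amplitude `j(k; p, q)` of the three-quasiparticle vertex. -/
def vertex (v : Space → ℝ) (ν : ℝ) (k p q : Space) : ℝ :=
  Real.sqrt (ν / vHat v 0) *
    (vHat v k * (sCoeff v ν k - cCoeff v ν k)
        * (cCoeff v ν p * sCoeff v ν q + cCoeff v ν q * sCoeff v ν p)
      + vHat v p * (cCoeff v ν p - sCoeff v ν p)
        * (cCoeff v ν k * cCoeff v ν q + sCoeff v ν k * sCoeff v ν q)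
      + vHat v q * (cCoeff v ν q - sCoeff v ν q)
        * (cCoeff v ν p * cCoeff v ν k + sCoeff v ν p * sCoeff v ν k))

/-- The thermal factor in the Landau damping integral. -/
def thermalFactor (v : Space → ℝ) (ν β : ℝ) (k p : Space) : ℝ :=
  (Real.exp (β / 2 * (omega v ν k + omega v ν (k - p))) - Real.exp (β / 2 * omega v ν p)) ^ 2 /
    ((Real.exp (β * omega v ν k) - 1) * (Real.exp (β * omega v ν p) - 1)
      * (Real.exp (β * omega v ν (k - p)) - 1))

/-- The approximate Dirac delta `(1/π) ε/(x² + ε²)`. -/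
def approxDelta (ε x : ℝ) : ℝ := 1 / Real.pi * (ε / (x ^ 2 + ε ^ 2))

/-- The integrand of the Landau damping rate, with the Dirac delta of the energy balance
`ω(k - p) - ω(p) - ω(k)` replaced by its approximation of width `ε`. -/
def landauIntegrand (v : Space → ℝ) (ν β : ℝ) (k : Space) (ε : ℝ) (p : Space) : ℝ :=
  1 / (2 * Real.pi) ^ 3 * vertex v ν (p - k) k p ^ 2
    * approxDelta ε (omega v ν (k - p) - omega v ν p - omega v ν k)
    * thermalFactor v ν β k p

/-- The Landau damping integral with a Dirac delta of width `ε`. -/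
def landauIntegral (v : Space → ℝ) (ν β : ℝ) (k : Space) (ε : ℝ) : ℝ :=
  Real.pi * ∫ p : Space, landauIntegrand v ν β k ε p

/-- The Landau damping rate `γ_L(k; β, ν)`: the integral with the Dirac delta, that is, the limit
`ε ↘ 0`. -/
def landauDamping (v : Space → ℝ) (ν β : ℝ) (k : Space) : ℝ :=
  Filter.limUnder (nhdsWithin (0 : ℝ) (Set.Ioi 0)) (landauIntegral v ν β k)

/-- The integrand of the special function `𝒢_n`. -/
def GIntegrand (n : ℕ) (θ t : ℝ) : ℝ :=
  Real.sinh (θ / 2) * t ^ n / (Real.sinh ((t + θ) / 2) * Real.sinh (t / 2))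

/-- The special function `𝒢_n(θ) = ∫₀^∞ sinh(θ/2) tⁿ / (sinh((t+θ)/2) sinh(t/2)) dt`. -/
def G (n : ℕ) (θ : ℝ) : ℝ := ∫ t in Set.Ioi (0 : ℝ), GIntegrand n θ t

/-- The value `ζ(n)` of the Riemann zeta function at an integer, as a real number. -/
def zetaReal (n : ℕ) : ℝ := (riemannZeta (n : ℂ)).re

/-- The polylogarithm `Li_n(z) = ∑_{m ≥ 1} z^m / m^n`, for `n ≥ 2` and `|z| ≤ 1`. -/
def polylog (n : ℕ) (z : ℝ) : ℝ := ∑' m : ℕ, z ^ (m + 1) / ((m : ℝ) + 1) ^ n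

/-- The leading term of the Landau damping rate at small momentum and temperature. -/
def landauLeading (v : Space → ℝ) (ν β : ℝ) (k : Space) : ℝ :=
  9 * vHat v 0 * ν ^ (3 / 2 : ℝ) / (64 * Real.pi) * (1 / (β * ν) ^ 5) *
    (G 4 (β * omega v ν k)
      + 2 * (β * Real.sqrt ν * ‖k‖) * G 3 (β * omega v ν k)
      + (β * Real.sqrt ν * ‖k‖) ^ 2 * G 2 (β * omega v ν k))

/-- The leading term of the Landau damping rate for a small momentum/temperature ratio. -/
def landauLeadingSmallRatio (v : Space → ℝ) (ν β : ℝ) (k : Space) : ℝ :=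
  3 * Real.pi ^ 3 * vHat v 0 * ν ^ (3 / 2 : ℝ) / 40 * (‖k‖ / Real.sqrt ν) * (1 / (β * ν) ^ 4)

/-- The leading term of the Landau damping rate for a large momentum/temperature ratio. -/
def landauLeadingLargeRatio (v : Space → ℝ) (ν β : ℝ) (k : Space) : ℝ :=
  9 * zetaReal 3 * vHat v 0 * ν ^ (3 / 2 : ℝ) / (16 * Real.pi) * (1 / (β * ν) ^ 3)
    * (‖k‖ ^ 2 / ν)

end

end BoseGas

/-!
The damping rate is computed in units in which the chemical potential is one: momenta are `√ν κ`,
energies `ν w`, the inverse temperature is `b = β ν`, and the potential enters only through the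
profile `f(r) = v̂(√ν r) / v̂(0)`. The hypotheses on `v` make these profiles satisfy quantitative
bounds with constants independent of `ν ≤ V` (`IsProfile`, `exists_isProfile`). All estimates are
uniform over such profiles, hence over `ν`.

The integrand depends on `p` only through `r = |p|` and `u = |k - p|`. In these bipolar coordinates
(`lintegral_bipolar`) the measure is `2π r u / |k| dr du`, and the energy balance
`w(u) = w(r) + w(κ)` can be solved for `u` at fixed `r`. As the width of the delta tends to zero, the
integral over `u` concentrates on the solution, with the Jacobian `1 / |w'(u)|`
(`tendsto_integral_approxDelta`, `exists_limit_approxDelta`), and the integral over `r` converges by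
dominated convergence (`exists_core_estimate`).

For small `r` and `κ` the dispersion relation is strictly convex, hence superadditive, and there is
exactly one solution, which differs from `r + κ` by a term of third order (`exists_onShell`,
`onShell_near`). At the solution the leading parts of the vertex, which are linear in the energies,
cancel by the energy balance. What remains is a difference of cubes `u³ - r³ - κ³`, almost `3 κ r u`,
and makes the squared vertex almost `(9/8) κ r u` (`cubic_difference_onShell`, `vertexSq_onShell`).
The thermal factor equals half the weight `sinh(θ/2) / (sinh((t+θ)/2) sinh(t/2))` at `t = b w(r)`,
`θ = b w(κ)` (`thermalRadial_onShell`). In terms of the energy `y = w(r)` the leading term is therefore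
the integral of `(9/16) κ y² (y + κ)²` against this weight, that is, a combination of `𝒢_4`, `𝒢_3` and
`𝒢_2` (`moment_energyDensity`, `model_estimate`). The relative error `(r + κ)²` costs a factor `1/b²`
or `κ²`, since the sixth moment of the weight is bounded by the fourth one, uniformly in `θ`
(`G_le_G`).

Away from the origin only upper bounds are needed. Either the dispersion relation varies too little
on `[r - κ, r + κ]` for the energy balance to hold, or it has no critical point there
(`exists_dichotomy`). In the second case the energy balance forces the contributions of the two large
momenta to the vertex to cancel up to an error of order `κ`, and the integrand is bounded by `κ` times
a high moment of the weight (`exists_onShell_bound`). At low temperature this is of higher order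
(`tail_estimate`).

The properties of `𝒢_n` follow from the series `𝒢_n(θ) = 2 n! ∑ (1 - e^{-jθ}) / j^{n+1}`, obtained by
expanding the weight into geometric series (`integrableOn_and_hasSum_G`). The expansions for small and
large ratios of momentum and temperature insert the asymptotics of `𝒢_n` at zero and at infinity into
the leading term (`exists_energyMass_small_ratio`, `exists_energyMass_large_ratio`).
-/

namespace BoseGas

open Filter Topology MeasureTheory Asymptotics
open scoped ENNReal

/-! ### The special functions `𝒢_n` -/

/-- The thermal weight `sinh(θ/2) / (sinh((t+θ)/2) sinh(t/2))`, so that `𝒢_n(θ)` is the `n`-th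
moment of `t ↦ thermalWeight θ t` on the half line. On the energy shell the thermal factor of the
Landau damping integral is half of it. -/
noncomputable def thermalWeight (θ t : ℝ) : ℝ :=
  Real.sinh (θ / 2) / (Real.sinh ((t + θ) / 2) * Real.sinh (t / 2))

theorem GIntegrand_eq (n : ℕ) (θ t : ℝ) : GIntegrand n θ t = t ^ n * thermalWeight θ t := by
  unfold GIntegrand thermalWeight
  ring

theorem thermalWeight_nonneg {θ t : ℝ} (hθ : 0 ≤ θ) (ht : 0 < t) : 0 ≤ thermalWeight θ t := by
  unfold thermalWeight
  have h1 : 0 ≤ Real.sinh (θ / 2) := Real.sinh_nonneg_iff.2 (by linarith)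
  have h2 : 0 ≤ Real.sinh ((t + θ) / 2) := Real.sinh_nonneg_iff.2 (by linarith)
  have h3 : 0 ≤ Real.sinh (t / 2) := Real.sinh_nonneg_iff.2 (by linarith)
  positivity

theorem thermalWeight_antitone {θ s t : ℝ} (hθ : 0 ≤ θ) (hs : 0 < s) (hst : s ≤ t) :
    thermalWeight θ t ≤ thermalWeight θ s := by
  unfold thermalWeight
  have h1 : 0 ≤ Real.sinh (θ / 2) := Real.sinh_nonneg_iff.2 (by linarith)
  have h2 : 0 < Real.sinh ((s + θ) / 2) := Real.sinh_pos_iff.2 (by linarith)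
  have h3 : 0 < Real.sinh (s / 2) := Real.sinh_pos_iff.2 (by linarith)
  have h4 : Real.sinh ((s + θ) / 2) ≤ Real.sinh ((t + θ) / 2) :=
    Real.sinh_le_sinh.2 (by linarith)
  have h5 : Real.sinh (s / 2) ≤ Real.sinh (t / 2) := Real.sinh_le_sinh.2 (by linarith)
  have h6 : 0 < Real.sinh ((t + θ) / 2) := h2.trans_le h4
  gcongr

/-- A family with the same terms has the same sum; this saves unfolding the terms under `HasSum`. -/
theorem hasSum_of_eq {f g : ℕ → ℝ} {s : ℝ} (h : ∀ j, f j = g j) (hg : HasSum g s) :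
    HasSum f s := by
  rwa [funext h]

/-- The expansion of the weight as a difference of two geometric series. -/
theorem hasSum_thermalWeight {θ t : ℝ} (hθ : 0 ≤ θ) (ht : 0 < t) :
    HasSum (fun j : ℕ => 2 * Real.exp (-((j + 1 : ℝ) * t)) * (1 - Real.exp (-((j + 1 : ℝ) * θ))))
      (thermalWeight θ t) := by
  have key : ∀ x : ℝ, 0 < x →
      HasSum (fun j : ℕ => Real.exp (-((j + 1 : ℝ) * x))) (Real.exp (-x) * (1 - Real.exp (-x))⁻¹) := by
    intro x hx
    have h := (hasSum_geometric_of_lt_one (Real.exp_pos (-x)).le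
      (Real.exp_lt_one_iff.2 (by linarith))).mul_left (Real.exp (-x))
    refine hasSum_of_eq (fun j => ?_) h
    rw [← Real.exp_nat_mul, ← Real.exp_add]
    ring_nf
  have h := ((key t ht).sub (key (t + θ) (by linarith))).mul_left 2
  have e : 2 * (Real.exp (-t) * (1 - Real.exp (-t))⁻¹
      - Real.exp (-(t + θ)) * (1 - Real.exp (-(t + θ)))⁻¹) = thermalWeight θ t := by
    unfold thermalWeight
    have e1 : Real.exp (-t) < 1 := Real.exp_lt_one_iff.2 (by linarith)
    have e2 : Real.exp (-(t + θ)) < 1 := Real.exp_lt_one_iff.2 (by linarith)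
    have s1 : 0 < Real.sinh ((t + θ) / 2) := Real.sinh_pos_iff.2 (by linarith)
    have s2 : 0 < Real.sinh (t / 2) := Real.sinh_pos_iff.2 (by linarith)
    have hp := Real.exp_pos (t / 2)
    have hq := Real.exp_pos (θ / 2)
    have a1 : Real.exp (-t) = (Real.exp (t / 2))⁻¹ ^ 2 := by
      rw [← Real.exp_neg, ← Real.exp_nat_mul]; congr 1; push_cast; ring
    have a2 : Real.exp (-(t + θ)) = (Real.exp (t / 2))⁻¹ ^ 2 * (Real.exp (θ / 2))⁻¹ ^ 2 := by
      rw [← Real.exp_neg, ← Real.exp_neg, ← Real.exp_nat_mul, ← Real.exp_nat_mul, ← Real.exp_add]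
      congr 1; push_cast; ring
    have b1 : Real.sinh (t / 2) = (Real.exp (t / 2) - (Real.exp (t / 2))⁻¹) / 2 := by
      rw [Real.sinh_eq, Real.exp_neg]
    have b2 : Real.sinh (θ / 2) = (Real.exp (θ / 2) - (Real.exp (θ / 2))⁻¹) / 2 := by
      rw [Real.sinh_eq, Real.exp_neg]
    have b3 : Real.sinh ((t + θ) / 2) = (Real.exp (t / 2) * Real.exp (θ / 2)
        - (Real.exp (t / 2))⁻¹ * (Real.exp (θ / 2))⁻¹) / 2 := by
      rw [Real.sinh_eq, add_div, neg_add, Real.exp_add, Real.exp_add, Real.exp_neg, Real.exp_neg]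
    rw [b1] at s2
    rw [b3] at s1
    rw [a1] at e1
    rw [a2] at e2
    rw [a1, a2, b1, b2, b3]
    generalize Real.exp (t / 2) = p at *
    generalize Real.exp (θ / 2) = q at *
    have n1 : 1 - p⁻¹ ^ 2 ≠ 0 := by linarith
    have n2 : 1 - p⁻¹ ^ 2 * q⁻¹ ^ 2 ≠ 0 := by linarith
    have n3 : p - p⁻¹ ≠ 0 := by linarith
    have n4 : p * q - p⁻¹ * q⁻¹ ≠ 0 := by linarith
    have f1 : 1 - p⁻¹ ^ 2 = (p - p⁻¹) * p⁻¹ := by field_simp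
    have f2 : 1 - p⁻¹ ^ 2 * q⁻¹ ^ 2 = (p * q - p⁻¹ * q⁻¹) * (p⁻¹ * q⁻¹) := by field_simp
    rw [f1, f2]
    have hp' := hp.ne'
    have hq' := hq.ne'
    have n5 : p ^ 2 - 1 ≠ 0 := by
      intro h0
      apply n3
      field_simp
      linarith
    have n6 : p ^ 2 * q ^ 2 - 1 ≠ 0 := by
      intro h0
      apply n4
      field_simp
      linarith
    have g1 : p - p⁻¹ = (p ^ 2 - 1) / p := by field_simp
    have g2 : p * q - p⁻¹ * q⁻¹ = (p ^ 2 * q ^ 2 - 1) / (p * q) := by field_simp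
    rw [g1, g2]
    field_simp
    ring
  rw [e] at h
  refine hasSum_of_eq (fun j => ?_) h
  rw [mul_assoc, mul_sub, mul_one, ← Real.exp_add]
  ring_nf

/-- The integral of one term of the expanded weight, by Euler's integral for the factorial. -/
theorem integral_pow_mul_exp (n j : ℕ) :
    IntegrableOn (fun t : ℝ => t ^ n * Real.exp (-((j + 1 : ℝ) * t))) (Set.Ioi 0) ∧
    ∫ t in Set.Ioi (0 : ℝ), t ^ n * Real.exp (-((j + 1 : ℝ) * t))
      = n.factorial / (j + 1 : ℝ) ^ (n + 1) := by
  have hj : (0 : ℝ) < (j : ℝ) + 1 := by positivity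
  have h := Real.integral_rpow_mul_exp_neg_mul_Ioi (a := (n : ℝ) + 1) (r := (j : ℝ) + 1)
    (by positivity) hj
  have e : ∫ t in Set.Ioi (0 : ℝ), t ^ n * Real.exp (-((j + 1 : ℝ) * t))
      = n.factorial / (j + 1 : ℝ) ^ (n + 1) := by
    rw [Real.Gamma_nat_eq_factorial] at h
    simp only [add_sub_cancel_right, Real.rpow_natCast] at h
    rw [h, show (n : ℝ) + 1 = ((n + 1 : ℕ) : ℝ) by push_cast; rfl, Real.rpow_natCast]
    rw [one_div, inv_pow]
    field_simp
  refine ⟨?_, e⟩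
  apply MeasureTheory.Integrable.of_integral_ne_zero
  rw [e]
  positivity

theorem summable_inv_succ_pow {m : ℕ} (hm : 2 ≤ m) :
    Summable (fun j : ℕ => 1 / ((j : ℝ) + 1) ^ m) := by
  have h := (Real.summable_one_div_nat_pow (p := m)).2 (by omega)
  have := (summable_nat_add_iff 1).2 h
  simpa using this

/-- The integral defining `𝒢_n` converges, and equals a sum of elementary terms. -/
theorem integrableOn_and_hasSum_G {n : ℕ} (hn : 1 ≤ n) {θ : ℝ} (hθ : 0 ≤ θ) :
    IntegrableOn (GIntegrand n θ) (Set.Ioi 0) ∧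
    HasSum (fun j : ℕ => 2 * (n.factorial : ℝ) *
      ((1 - Real.exp (-((j + 1 : ℝ) * θ))) / ((j : ℝ) + 1) ^ (n + 1))) (G n θ) := by
  rcases hθ.eq_or_lt with rfl | hθ'
  · have h0 : GIntegrand n 0 = fun _ => 0 := by
      ext t; simp [GIntegrand]
    refine ⟨by rw [h0]; exact integrableOn_zero, ?_⟩
    have : G n 0 = 0 := by simp [G, h0]
    rw [this]
    simp
  set F : ℕ → ℝ → ℝ := fun j t => 2 * (1 - Real.exp (-((j + 1 : ℝ) * θ))) *
    (t ^ n * Real.exp (-((j + 1 : ℝ) * t))) with hF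
  have hpos : ∀ j : ℕ, 0 ≤ 1 - Real.exp (-((j + 1 : ℝ) * θ)) := by
    intro j
    have : Real.exp (-((j + 1 : ℝ) * θ)) ≤ 1 := Real.exp_le_one_iff.2 (by
      have : (0:ℝ) ≤ ((j:ℝ) + 1) * θ := by positivity
      linarith)
    linarith
  have hint : ∀ j, Integrable (F j) (volume.restrict (Set.Ioi 0)) := fun j =>
    (integral_pow_mul_exp n j).1.const_mul _
  have hval : ∀ j, ∫ t in Set.Ioi (0 : ℝ), F j t = 2 * (n.factorial : ℝ) *
      ((1 - Real.exp (-((j + 1 : ℝ) * θ))) / ((j : ℝ) + 1) ^ (n + 1)) := by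
    intro j
    simp only [hF]
    rw [integral_const_mul, (integral_pow_mul_exp n j).2]
    ring
  have hnorm : ∀ j, ∫ t in Set.Ioi (0 : ℝ), ‖F j t‖ = ∫ t in Set.Ioi (0 : ℝ), F j t := by
    intro j
    apply setIntegral_congr_fun measurableSet_Ioi
    intro t ht
    have ht' : (0 : ℝ) < t := ht
    have := hpos j
    simp only [hF]
    rw [Real.norm_of_nonneg (by positivity)]
  have hsumm : Summable fun j => ∫ t in Set.Ioi (0 : ℝ), ‖F j t‖ := by
    simp_rw [hnorm, hval]
    apply Summable.mul_left
    refine Summable.of_nonneg_of_le (fun j => div_nonneg (hpos j) (by positivity)) (fun j => ?_)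
      (summable_inv_succ_pow (m := n + 1) (by omega))
    gcongr
    have := Real.exp_pos (-((j + 1 : ℝ) * θ))
    linarith
  have hS := hasSum_integral_of_summable_integral_norm hint hsumm
  have hts : ∫ t in Set.Ioi (0 : ℝ), ∑' j, F j t = G n θ := by
    unfold G
    apply setIntegral_congr_fun measurableSet_Ioi
    intro t ht
    have h := (hasSum_thermalWeight hθ ht).mul_left (t ^ n)
    simp only
    rw [GIntegrand_eq, ← h.tsum_eq]
    apply tsum_congr
    intro j
    simp only [hF]
    ring
  rw [hts] at hS
  simp_rw [hval] at hS
  refine ⟨?_, hS⟩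
  apply MeasureTheory.Integrable.of_integral_ne_zero
  have hlt : 0 < G n θ := by
    rw [← hS.tsum_eq]
    refine hS.summable.tsum_pos (fun j => ?_) 0 ?_
    · have := hpos j
      positivity
    · have : Real.exp (-((((0:ℕ):ℝ) + 1) * θ)) < 1 := Real.exp_lt_one_iff.2 (by
        push_cast; linarith)
      have h2 : 0 < 1 - Real.exp (-((((0:ℕ):ℝ) + 1) * θ)) := by linarith
      positivity
  exact hlt.ne'

theorem G_nonneg {n : ℕ} {θ : ℝ} (hθ : 0 ≤ θ) : 0 ≤ G n θ := by
  unfold G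
  apply setIntegral_nonneg measurableSet_Ioi
  intro t ht
  have ht' : (0 : ℝ) < t := ht
  rw [GIntegrand_eq]
  have := thermalWeight_nonneg hθ ht'
  positivity

theorem hasSum_G {n : ℕ} (hn : 1 ≤ n) {θ : ℝ} (hθ : 0 ≤ θ) :
    HasSum (fun j : ℕ => 2 * (n.factorial : ℝ) *
      ((1 - Real.exp (-((j + 1 : ℝ) * θ))) / ((j : ℝ) + 1) ^ (n + 1))) (G n θ) :=
  (integrableOn_and_hasSum_G hn hθ).2

theorem one_sub_exp_nonneg {θ : ℝ} (hθ : 0 ≤ θ) (j : ℕ) :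
    0 ≤ 1 - Real.exp (-((j + 1 : ℝ) * θ)) := by
  have : Real.exp (-((j + 1 : ℝ) * θ)) ≤ 1 := Real.exp_le_one_iff.2 (by
    have : (0:ℝ) ≤ ((j:ℝ) + 1) * θ := by positivity
    linarith)
  linarith

/-- Higher moments of the thermal weight are bounded by lower ones, uniformly in `θ`. -/
theorem G_le_G {m n : ℕ} (hn : 1 ≤ n) (hmn : n ≤ m) {θ : ℝ} (hθ : 0 ≤ θ) :
    G m θ ≤ m.factorial * G n θ := by
  refine hasSum_le (fun j => ?_) (hasSum_G (hn.trans hmn) hθ)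
    ((hasSum_G hn hθ).mul_left (m.factorial : ℝ))
  have h1 := one_sub_exp_nonneg hθ j
  have h2 : (1 : ℝ) ≤ n.factorial := by exact_mod_cast Nat.one_le_iff_ne_zero.2 n.factorial_ne_zero
  have h3 : ((j : ℝ) + 1) ^ (n + 1) ≤ ((j : ℝ) + 1) ^ (m + 1) :=
    pow_le_pow_right₀ (by linarith [(Nat.cast_nonneg j : (0:ℝ) ≤ j)]) (by omega)
  have h4 : (1 - Real.exp (-((j + 1 : ℝ) * θ))) / ((j : ℝ) + 1) ^ (m + 1)
      ≤ (1 - Real.exp (-((j + 1 : ℝ) * θ))) / ((j : ℝ) + 1) ^ (n + 1) := by gcongr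
  have h5 : 0 ≤ (1 - Real.exp (-((j + 1 : ℝ) * θ))) / ((j : ℝ) + 1) ^ (n + 1) := by positivity
  calc 2 * (m.factorial : ℝ) * ((1 - Real.exp (-((j + 1 : ℝ) * θ))) / ((j : ℝ) + 1) ^ (m + 1))
      ≤ 2 * (m.factorial : ℝ) * ((1 - Real.exp (-((j + 1 : ℝ) * θ))) / ((j : ℝ) + 1) ^ (n + 1)) := by
        gcongr
    _ = (m.factorial : ℝ) * (2 * 1 *
        ((1 - Real.exp (-((j + 1 : ℝ) * θ))) / ((j : ℝ) + 1) ^ (n + 1))) := by ring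
    _ ≤ _ := by gcongr

theorem hasSum_zetaReal {m : ℕ} (hm : 2 ≤ m) :
    HasSum (fun j : ℕ => 1 / ((j : ℝ) + 1) ^ m) (zetaReal m) := by
  have h := zeta_nat_eq_tsum_of_gt_one (k := m) (by omega)
  have h2 : zetaReal m = ∑' j : ℕ, 1 / ((j : ℝ) + 1) ^ m := by
    unfold zetaReal
    rw [h]
    have : (∑' n : ℕ, 1 / (n : ℂ) ^ m) = ((∑' n : ℕ, 1 / (n : ℝ) ^ m : ℝ) : ℂ) := by
      push_cast; rfl
    rw [this, Complex.ofReal_re]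
    have hs : Summable (fun n : ℕ => 1 / (n : ℝ) ^ m) :=
      (Real.summable_one_div_nat_pow (p := m)).2 (by omega)
    rw [hs.tsum_eq_zero_add]
    have hm0 : m ≠ 0 := by omega
    simp [hm0]
  rw [h2]
  exact (summable_inv_succ_pow hm).hasSum

theorem zetaReal_pos {m : ℕ} (hm : 2 ≤ m) : 0 < zetaReal m := by
  rw [← (hasSum_zetaReal hm).tsum_eq]
  exact (summable_inv_succ_pow hm).tsum_pos (fun j => by positivity) 0 (by positivity)

theorem hasSum_polylog {m : ℕ} (hm : 2 ≤ m) {z : ℝ} (h0 : 0 ≤ z) (h1 : z ≤ 1) :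
    HasSum (fun j : ℕ => z ^ (j + 1) / ((j : ℝ) + 1) ^ m) (polylog m z) := by
  refine Summable.hasSum (Summable.of_nonneg_of_le (fun j => by positivity) (fun j => ?_)
    (summable_inv_succ_pow hm))
  gcongr
  exact pow_le_one₀ h0 h1

theorem G_eq_zeta_sub_polylog {n : ℕ} (hn : 1 ≤ n) {θ : ℝ} (hθ : 0 ≤ θ) :
    G n θ = 2 * Real.Gamma (n + 1) *
      (zetaReal (n + 1) - polylog (n + 1) (Real.exp (-θ))) := by
  have h := ((hasSum_zetaReal (m := n + 1) (by omega)).sub (hasSum_polylog (m := n + 1) (by omega)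
    (Real.exp_pos (-θ)).le (Real.exp_le_one_iff.2 (by linarith)))).mul_left
      (2 * (n.factorial : ℝ))
  rw [Real.Gamma_nat_eq_factorial]
  refine (hasSum_G hn hθ).unique ?_
  refine hasSum_of_eq (fun j => ?_) h
  rw [← Real.exp_nat_mul, ← sub_div]
  push_cast
  ring_nf

theorem continuousOn_G {n : ℕ} (hn : 1 ≤ n) : ContinuousOn (G n) (Set.Ici 0) := by
  have h : ContinuousOn (fun θ : ℝ => ∑' j : ℕ, 2 * (n.factorial : ℝ) *
      ((1 - Real.exp (-((j + 1 : ℝ) * θ))) / ((j : ℝ) + 1) ^ (n + 1))) (Set.Ici 0) := by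
    refine continuousOn_tsum (fun j => by fun_prop)
      ((summable_inv_succ_pow (m := n + 1) (by omega)).mul_left (2 * (n.factorial : ℝ))) ?_
    intro j θ hθ
    have h1 := one_sub_exp_nonneg hθ j
    rw [Real.norm_of_nonneg (by positivity)]
    gcongr
    have := Real.exp_pos (-((j + 1 : ℝ) * θ))
    linarith
  exact h.congr fun θ hθ => (hasSum_G hn hθ).tsum_eq.symm

/-- For large `θ` the function `𝒢_n` tends exponentially fast to its limit. -/
theorem abs_G_sub_limit_le {n : ℕ} (hn : 1 ≤ n) {θ : ℝ} (hθ : 0 ≤ θ) :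
    |G n θ - 2 * Real.Gamma (n + 1) * zetaReal (n + 1)|
      ≤ 2 * n.factorial * zetaReal (n + 1) * Real.exp (-θ) := by
  have he := (Real.exp_pos (-θ)).le
  have he1 : Real.exp (-θ) ≤ 1 := Real.exp_le_one_iff.2 (by linarith)
  have h := hasSum_polylog (m := n + 1) (by omega) he he1
  have h0 : 0 ≤ polylog (n + 1) (Real.exp (-θ)) := h.nonneg fun j => by positivity
  have h1 : polylog (n + 1) (Real.exp (-θ)) ≤ Real.exp (-θ) * zetaReal (n + 1) := by
    refine hasSum_le (fun j => ?_) h ((hasSum_zetaReal (m := n + 1) (by omega)).mul_left _)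
    rw [mul_one_div]
    gcongr
    exact pow_le_of_le_one he he1 (by omega)
  rw [G_eq_zeta_sub_polylog hn hθ, Real.Gamma_nat_eq_factorial]
  have e : 2 * (n.factorial : ℝ) * (zetaReal (n + 1) - polylog (n + 1) (Real.exp (-θ)))
      - 2 * n.factorial * zetaReal (n + 1)
      = -(2 * n.factorial * polylog (n + 1) (Real.exp (-θ))) := by ring
  rw [e, abs_neg, abs_of_nonneg (by positivity)]
  calc 2 * (n.factorial : ℝ) * polylog (n + 1) (Real.exp (-θ))
      ≤ 2 * n.factorial * (Real.exp (-θ) * zetaReal (n + 1)) := by gcongr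
    _ = _ := by ring

/-- The upper bound is quadratic for small `y` but only linear for large `y`, so that the remainder
of `𝒢_2` is summable with just a logarithmic loss. -/
theorem exp_neg_sub_bounds {y : ℝ} (hy : 0 ≤ y) :
    0 ≤ Real.exp (-y) - 1 + y ∧ Real.exp (-y) - 1 + y ≤ y ^ 2 / (1 + y) := by
  constructor
  · have := Real.add_one_le_exp (-y)
    linarith
  · have h := Real.add_one_le_exp y
    have h1 : Real.exp (-y) ≤ 1 / (1 + y) := by
      rw [Real.exp_neg, ← one_div]
      apply one_div_le_one_div_of_le (by linarith) (by linarith)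
    have h2 : 1 / (1 + y) - 1 + y = y ^ 2 / (1 + y) := by
      field_simp; ring
    linarith

/-- The remainder of the linear approximation of `𝒢_n` at `θ = 0`, as a series. -/
theorem abs_G_sub_linear_le {n : ℕ} (hn : 2 ≤ n) {θ B : ℝ} (hθ : 0 ≤ θ) {u : ℕ → ℝ}
    (hu : ∀ j : ℕ, ((j + 1 : ℝ) * θ) ^ 2 / (1 + (j + 1 : ℝ) * θ) / ((j : ℝ) + 1) ^ (n + 1) ≤ u j)
    (hs : HasSum u B) :
    |G n θ - 2 * Real.Gamma (n + 1) * zetaReal n * θ| ≤ 2 * n.factorial * B := by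
  have h := (((hasSum_zetaReal hn).mul_left (2 * (n.factorial : ℝ) * θ))).sub
    (hasSum_G (n := n) (by omega) hθ)
  have h2 := hs.mul_left (2 * (n.factorial : ℝ))
  have hterm : ∀ j : ℕ, 2 * (n.factorial : ℝ) * θ * (1 / ((j : ℝ) + 1) ^ n) - 2 * n.factorial *
      ((1 - Real.exp (-((j + 1 : ℝ) * θ))) / ((j : ℝ) + 1) ^ (n + 1))
      = 2 * n.factorial * ((Real.exp (-((j + 1 : ℝ) * θ)) - 1 + (j + 1 : ℝ) * θ)
        / ((j : ℝ) + 1) ^ (n + 1)) := by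
    intro j
    have : (j : ℝ) + 1 ≠ 0 := by positivity
    field_simp
    ring
  simp_rw [hterm] at h
  have hb : ∀ j : ℕ, 0 ≤ (j + 1 : ℝ) * θ := fun j => by positivity
  rw [abs_sub_comm, Real.Gamma_nat_eq_factorial,
    show 2 * (n.factorial : ℝ) * zetaReal n * θ = 2 * (n.factorial : ℝ) * θ * zetaReal n by ring,
    abs_of_nonneg]
  · refine hasSum_le (fun j => ?_) h h2
    refine mul_le_mul_of_nonneg_left (le_trans ?_ (hu j)) (by positivity)
    have := (exp_neg_sub_bounds (hb j)).2
    gcongr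
  · refine h.nonneg fun j => ?_
    have := (exp_neg_sub_bounds (hb j)).1
    positivity

/-- For `n ≥ 3` the function `𝒢_n` is linear up to a quadratic error at `θ = 0`. -/
theorem abs_G_sub_linear_le_sq {n : ℕ} (hn : 3 ≤ n) {θ : ℝ} (hθ : 0 ≤ θ) :
    |G n θ - 2 * Real.Gamma (n + 1) * zetaReal n * θ|
      ≤ 2 * n.factorial * (θ ^ 2 * zetaReal (n - 1)) := by
  refine abs_G_sub_linear_le (by omega) hθ (fun j => ?_)
    ((hasSum_zetaReal (m := n - 1) (by omega)).mul_left (θ ^ 2))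
  obtain ⟨m, rfl⟩ : ∃ m, n = m + 1 := ⟨n - 1, by omega⟩
  have hy : 0 ≤ (j + 1 : ℝ) * θ := by positivity
  calc ((j + 1 : ℝ) * θ) ^ 2 / (1 + (j + 1 : ℝ) * θ) / ((j : ℝ) + 1) ^ (m + 1 + 1)
      ≤ ((j + 1 : ℝ) * θ) ^ 2 / 1 / ((j : ℝ) + 1) ^ (m + 1 + 1) := by
        gcongr
        linarith
    _ = θ ^ 2 * (1 / ((j : ℝ) + 1) ^ (m + 1 - 1)) := by
        have : (j : ℝ) + 1 ≠ 0 := by positivity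
        simp only [Nat.add_sub_cancel]
        field_simp
        ring

/-- The function `𝒢_n` is at most linear. -/
theorem G_le_linear {n : ℕ} (hn : 2 ≤ n) {θ : ℝ} (hθ : 0 ≤ θ) :
    G n θ ≤ 2 * n.factorial * zetaReal n * θ := by
  have h := ((hasSum_zetaReal hn).mul_left (2 * (n.factorial : ℝ) * θ))
  rw [show 2 * (n.factorial : ℝ) * zetaReal n * θ = 2 * (n.factorial : ℝ) * θ * zetaReal n by ring]
  refine hasSum_le (fun j => ?_) (hasSum_G (n := n) (by omega) hθ) h
  have h1 := Real.add_one_le_exp (-((j + 1 : ℝ) * θ))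
  have hj : (0 : ℝ) < (j : ℝ) + 1 := by positivity
  calc 2 * (n.factorial : ℝ) *
        ((1 - Real.exp (-((j + 1 : ℝ) * θ))) / ((j : ℝ) + 1) ^ (n + 1))
      ≤ 2 * n.factorial * ((j + 1 : ℝ) * θ / ((j : ℝ) + 1) ^ (n + 1)) := by
        gcongr
        linarith
    _ = _ := by
        field_simp
        ring

/-- A telescoping majorant for the remainder of `𝒢_2`. -/
theorem inv_le_log_sub_log {θ x : ℝ} (hθ : 0 < θ) (hx : 0 < x) :
    1 / ((x + 1) * (1 + (x + 1) * θ))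
      ≤ Real.log ((1 + x * θ) / x) - Real.log ((1 + (x + 1) * θ) / (x + 1)) := by
  have h0 : 0 < (1 + (x + 1) * θ) / (x + 1) / ((1 + x * θ) / x) := by positivity
  have h := Real.log_le_sub_one_of_pos h0
  rw [Real.log_div (by positivity) (by positivity)] at h
  have e : 1 - (1 + (x + 1) * θ) / (x + 1) / ((1 + x * θ) / x) = 1 / ((x + 1) * (1 + x * θ)) := by
    field_simp
    ring
  have h2 : 1 / ((x + 1) * (1 + (x + 1) * θ)) ≤ 1 / ((x + 1) * (1 + x * θ)) := by
    gcongr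
    linarith
  linarith

/-- The function `𝒢_2` is linear up to an error `O(θ² |log θ|)` at `θ = 0`. -/
theorem abs_G_two_sub_linear_le {θ : ℝ} (hθ : 0 < θ) :
    |G 2 θ - 2 * Real.Gamma ((2 : ℕ) + 1) * zetaReal 2 * θ|
      ≤ 4 * (θ ^ 2 * (1 + Real.log (1 + θ) - Real.log θ)) := by
  -- The antiderivative whose differences bound the terms. Its formula for `j ≥ 1` is singular at
  -- `j = 0`, so the value there is chosen to bound the first term, which is at most one.
  set χ : ℕ → ℝ := fun j => if j = 0 then Real.log (1 + θ) + 1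
    else Real.log ((1 + j * θ) / j) with hχ
  have hlim : Tendsto χ atTop (𝓝 (Real.log θ)) := by
    have h1 : Tendsto (fun j : ℕ => Real.log ((j : ℝ)⁻¹ + θ)) atTop (𝓝 (Real.log θ)) := by
      have h2 : Tendsto (fun j : ℕ => (j : ℝ)⁻¹ + θ) atTop (𝓝 (0 + θ)) :=
        tendsto_natCast_atTop_atTop.inv_tendsto_atTop.add_const θ
      rw [zero_add] at h2
      exact h2.log hθ.ne'
    refine h1.congr' ?_
    filter_upwards [eventually_ge_atTop 1] with j hj
    have hj' : (j : ℝ) ≠ 0 := by exact_mod_cast (by omega : j ≠ 0)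
    simp only [hχ, if_neg (by omega : j ≠ 0)]
    congr 1
    field_simp
  have hterm : ∀ j : ℕ, ((j + 1 : ℝ) * θ) ^ 2 / (1 + (j + 1 : ℝ) * θ) / ((j : ℝ) + 1) ^ (2 + 1)
      ≤ θ ^ 2 * (χ j - χ (j + 1)) := by
    intro j
    have hj : (0 : ℝ) < (j : ℝ) + 1 := by positivity
    have e : ((j + 1 : ℝ) * θ) ^ 2 / (1 + (j + 1 : ℝ) * θ) / ((j : ℝ) + 1) ^ (2 + 1)
        = θ ^ 2 * (1 / ((j + 1 : ℝ) * (1 + (j + 1 : ℝ) * θ))) := by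
      field_simp
    rw [e]
    refine mul_le_mul_of_nonneg_left ?_ (by positivity)
    rcases Nat.eq_zero_or_pos j with rfl | hj0
    · have : 1 / (1 + θ) ≤ 1 := by
        rw [div_le_one (by positivity)]; linarith
      simpa [hχ] using this
    · have h := inv_le_log_sub_log hθ (x := j) (by exact_mod_cast hj0)
      simpa [hχ, hj0.ne'] using h
  have hsum : HasSum (fun j => θ ^ 2 * (χ j - χ (j + 1)))
      (θ ^ 2 * (1 + Real.log (1 + θ) - Real.log θ)) := by
    rw [hasSum_iff_tendsto_nat_of_nonneg]
    · simp_rw [← Finset.mul_sum, Finset.sum_range_sub']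
      have e : χ 0 = 1 + Real.log (1 + θ) := by simp [hχ]; ring
      rw [e]
      exact (hlim.const_sub _).const_mul _
    · intro j
      exact le_trans (by positivity) (hterm j)
  have h := abs_G_sub_linear_le (n := 2) le_rfl hθ.le hterm hsum
  norm_num [Nat.factorial] at h ⊢
  exact h

theorem isBigO_G_two :
    (fun θ : ℝ => G 2 θ - 2 * Real.Gamma ((2 : ℕ) + 1) * zetaReal 2 * θ)
      =O[𝓝[>] (0 : ℝ)] (fun θ : ℝ => θ ^ 2 * Real.log θ) := by
  refine IsBigO.of_bound 12 ?_
  have hmem : Set.Ioo (0 : ℝ) (Real.exp (-1)) ∈ 𝓝[>] (0 : ℝ) :=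
    Ioo_mem_nhdsGT (Real.exp_pos _)
  filter_upwards [hmem] with θ hθ
  have h1 : Real.log θ < -1 := by
    rw [← Real.log_exp (-1)]
    exact Real.log_lt_log hθ.1 hθ.2
  have h2 : θ < 1 := hθ.2.trans (Real.exp_lt_one_iff.2 (by norm_num))
  have h3 : Real.log (1 + θ) ≤ 1 := by
    have := Real.log_le_sub_one_of_pos (by linarith [hθ.1] : 0 < 1 + θ)
    linarith
  rw [Real.norm_eq_abs, norm_mul, Real.norm_of_nonneg (sq_nonneg θ), Real.norm_eq_abs,
    abs_of_neg (by linarith : Real.log θ < 0)]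
  refine (abs_G_two_sub_linear_le hθ.1).trans ?_
  have : 0 ≤ θ ^ 2 := sq_nonneg θ
  nlinarith

theorem isBigO_G_sq {n : ℕ} (hn : 3 ≤ n) :
    (fun θ : ℝ => G n θ - 2 * Real.Gamma (n + 1) * zetaReal n * θ)
      =O[𝓝[>] (0 : ℝ)] (fun θ : ℝ => θ ^ 2) := by
  refine IsBigO.of_bound (2 * n.factorial * zetaReal (n - 1)) ?_
  filter_upwards [self_mem_nhdsWithin] with θ hθ
  rw [Real.norm_eq_abs, Real.norm_of_nonneg (sq_nonneg θ)]
  refine (abs_G_sub_linear_le_sq hn (le_of_lt hθ)).trans (le_of_eq (by ring))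

theorem isBigO_G_atTop {n : ℕ} (hn : 1 ≤ n) :
    (fun θ : ℝ => G n θ - 2 * Real.Gamma (n + 1) * zetaReal (n + 1))
      =O[atTop] (fun θ : ℝ => Real.exp (-θ)) := by
  refine IsBigO.of_bound (2 * n.factorial * zetaReal (n + 1)) ?_
  filter_upwards [eventually_ge_atTop 0] with θ hθ
  rw [Real.norm_eq_abs, Real.norm_of_nonneg (Real.exp_pos _).le]
  exact abs_G_sub_limit_le hn hθ

/-! ### Bipolar coordinates -/

theorem lintegral_Ioi_comp_sq (h : ℝ → ℝ≥0∞) :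
    ∫⁻ s in Set.Ioi (0 : ℝ), h s = ∫⁻ r in Set.Ioi (0 : ℝ), ENNReal.ofReal (2 * r) * h (r ^ 2) := by
  have himg : (fun r : ℝ => r ^ 2) '' Set.Ioi 0 = Set.Ioi 0 := by
    ext s
    constructor
    · rintro ⟨r, hr, rfl⟩
      exact pow_pos (Set.mem_Ioi.1 hr) 2
    · intro hs
      exact ⟨Real.sqrt s, Real.sqrt_pos.2 hs, Real.sq_sqrt (le_of_lt hs)⟩
  have hinj : Set.InjOn (fun r : ℝ => r ^ 2) (Set.Ioi 0) := by
    intro x hx y hy hxy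
    exact (pow_left_inj₀ (le_of_lt hx) (le_of_lt hy) two_ne_zero).1 hxy
  have hd : ∀ x ∈ Set.Ioi (0 : ℝ), HasDerivWithinAt (fun r : ℝ => r ^ 2) (2 * x) (Set.Ioi 0) x := by
    intro x _
    simpa using (hasDerivAt_pow 2 x).hasDerivWithinAt
  conv_lhs => rw [← himg]
  rw [lintegral_image_eq_lintegral_abs_deriv_mul measurableSet_Ioi hd hinj]
  refine setLIntegral_congr_fun measurableSet_Ioi fun r hr => ?_
  have : (0 : ℝ) < r := hr
  simp only [abs_of_pos (by linarith : 0 < 2 * r)]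

/-- Polar coordinates in the plane, with the square `s` of the radius as variable. -/
theorem lintegral_prod_radial {h : ℝ → ℝ≥0∞} (hh : Measurable h) :
    ∫⁻ q : ℝ × ℝ, h (q.1 ^ 2 + q.2 ^ 2) = ENNReal.ofReal Real.pi * ∫⁻ s in Set.Ioi (0 : ℝ), h s := by
  rw [← lintegral_comp_polarCoord_symm, lintegral_Ioi_comp_sq]
  have e : ∀ p : ℝ × ℝ, ENNReal.ofReal p.1 •
      h ((polarCoord.symm p).1 ^ 2 + (polarCoord.symm p).2 ^ 2)
      = ENNReal.ofReal p.1 * h (p.1 ^ 2) := by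
    intro p
    rw [polarCoord_symm_apply, smul_eq_mul]
    congr 2
    have := Real.cos_sq_add_sin_sq p.2
    simp only
    calc (p.1 * Real.cos p.2) ^ 2 + (p.1 * Real.sin p.2) ^ 2
        = p.1 ^ 2 * (Real.cos p.2 ^ 2 + Real.sin p.2 ^ 2) := by ring
      _ = p.1 ^ 2 := by rw [this, mul_one]
  simp_rw [e]
  rw [polarCoord_target, Measure.volume_eq_prod, ← Measure.prod_restrict,
    lintegral_prod _ (by fun_prop)]
  have hpi : ENNReal.ofReal (Real.pi - -Real.pi) = ENNReal.ofReal Real.pi * 2 := by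
    rw [show Real.pi - -Real.pi = Real.pi * 2 by ring, ENNReal.ofReal_mul Real.pi_pos.le]
    simp
  simp only [lintegral_const, Measure.restrict_apply MeasurableSet.univ, Set.univ_inter,
    Real.volume_Ioo, hpi]
  rw [← lintegral_const_mul _ (by fun_prop)]
  refine lintegral_congr fun r => ?_
  rw [ENNReal.ofReal_mul (by norm_num : (0 : ℝ) ≤ 2)]
  simp only [ENNReal.ofReal_ofNat]
  ring

/-- Cylindrical coordinates along the first axis. -/
theorem lintegral_space_cylindrical {H : ℝ → ℝ → ℝ≥0∞} (hH : Measurable (Function.uncurry H)) :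
    ∫⁻ p : Space, H (p 0) (p 1 ^ 2 + p 2 ^ 2)
      = ENNReal.ofReal Real.pi * ∫⁻ z : ℝ, ∫⁻ s in Set.Ioi (0 : ℝ), H z s := by
  have h1 := (EuclideanSpace.volume_preserving_symm_measurableEquiv_toLp (Fin 3)).lintegral_comp_emb
    (MeasurableEquiv.measurableEmbedding _) (fun p : Fin 3 → ℝ => H (p 0) (p 1 ^ 2 + p 2 ^ 2))
  have h2 := (volume_preserving_piFinSuccAbove (fun _ : Fin 3 => ℝ) 0).lintegral_comp_emb
    (MeasurableEquiv.measurableEmbedding _)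
    (fun q : ℝ × (Fin 2 → ℝ) => H q.1 (q.2 0 ^ 2 + q.2 1 ^ 2))
  have h1' : ∫⁻ p : Space, H (p 0) (p 1 ^ 2 + p 2 ^ 2)
      = ∫⁻ p : Fin 3 → ℝ, H (p 0) (p 1 ^ 2 + p 2 ^ 2) := h1
  have h2' : ∫⁻ p : Fin 3 → ℝ, H (p 0) (p 1 ^ 2 + p 2 ^ 2)
      = ∫⁻ q : ℝ × (Fin 2 → ℝ), H q.1 (q.2 0 ^ 2 + q.2 1 ^ 2) := h2
  rw [h1', h2', Measure.volume_eq_prod, lintegral_prod]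
  · rw [← lintegral_const_mul]
    · refine lintegral_congr fun z => ?_
      have h3 := (volume_preserving_piFinTwo (fun _ : Fin 2 => ℝ)).lintegral_comp_emb
        (MeasurableEquiv.measurableEmbedding _) (fun q : ℝ × ℝ => H z (q.1 ^ 2 + q.2 ^ 2))
      have h3' : ∫⁻ q : Fin 2 → ℝ, H z (q 0 ^ 2 + q 1 ^ 2)
        = ∫⁻ q : ℝ × ℝ, H z (q.1 ^ 2 + q.2 ^ 2) := h3
      rw [h3', lintegral_prod_radial (h := H z) (hH.comp (by fun_prop : Measurable fun s : ℝ => (z, s)))]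
    · exact Measurable.lintegral_prod_right hH
  · apply Measurable.aemeasurable
    exact hH.comp (by fun_prop :
      Measurable fun q : ℝ × (Fin 2 → ℝ) => (q.1, q.2 0 ^ 2 + q.2 1 ^ 2))

/-- The change of variables from `z`, the component of the momentum along `k`, to the length of
`k - p`, at fixed length `r` of `p`. -/
theorem lintegral_Ioo_bipolar {κ r : ℝ} (hκ : 0 < κ) (hr : 0 < r) (h : ℝ → ℝ≥0∞) :
    ∫⁻ z in Set.Ioo (-r) r, h (Real.sqrt (r ^ 2 + κ ^ 2 - 2 * κ * z))
      = ∫⁻ u in Set.Ioo |r - κ| (r + κ), ENNReal.ofReal (u / κ) * h u := by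
  set T : ℝ → ℝ := fun u => (r ^ 2 + κ ^ 2 - u ^ 2) / (2 * κ) with hT
  have hpos : ∀ u ∈ Set.Ioo |r - κ| (r + κ), 0 < u := fun u hu => (abs_nonneg _).trans_lt hu.1
  have himg : T '' Set.Ioo |r - κ| (r + κ) = Set.Ioo (-r) r := by
    ext z
    constructor
    · rintro ⟨u, hu, rfl⟩
      have h0 := hpos u hu
      have h1 : (r - κ) ^ 2 < u ^ 2 := by
        rw [← sq_abs (r - κ)]
        exact pow_lt_pow_left₀ hu.1 (abs_nonneg _) two_ne_zero
      have h2 : u ^ 2 < (r + κ) ^ 2 := pow_lt_pow_left₀ hu.2 h0.le two_ne_zero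
      constructor
      · rw [hT, lt_div_iff₀ (by positivity)]; nlinarith
      · rw [hT, div_lt_iff₀ (by positivity)]; nlinarith
    · rintro ⟨hz1, hz2⟩
      have h1 : (r - κ) ^ 2 < r ^ 2 + κ ^ 2 - 2 * κ * z := by nlinarith
      have h2 : r ^ 2 + κ ^ 2 - 2 * κ * z < (r + κ) ^ 2 := by nlinarith
      have h0 : 0 ≤ r ^ 2 + κ ^ 2 - 2 * κ * z := (sq_nonneg _).trans h1.le
      refine ⟨Real.sqrt (r ^ 2 + κ ^ 2 - 2 * κ * z), ⟨?_, ?_⟩, ?_⟩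
      · rw [← Real.sqrt_sq_eq_abs]
        exact Real.sqrt_lt_sqrt (sq_nonneg _) h1
      · rw [← Real.sqrt_sq (by positivity : 0 ≤ r + κ)]
        exact Real.sqrt_lt_sqrt h0 h2
      · simp only [hT]
        rw [Real.sq_sqrt h0]
        field_simp
        ring
  have hinj : Set.InjOn T (Set.Ioo |r - κ| (r + κ)) := by
    intro x hx y hy hxy
    have : x ^ 2 = y ^ 2 := by
      simp only [hT] at hxy
      rw [div_left_inj' (by positivity)] at hxy
      linarith
    exact (pow_left_inj₀ (hpos x hx).le (hpos y hy).le two_ne_zero).1 this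
  have hd : ∀ x ∈ Set.Ioo |r - κ| (r + κ),
      HasDerivWithinAt T (-(x / κ)) (Set.Ioo |r - κ| (r + κ)) x := by
    intro x _
    have := (((hasDerivAt_pow 2 x).const_sub (r ^ 2 + κ ^ 2)).div_const (2 * κ)).hasDerivWithinAt
      (s := Set.Ioo |r - κ| (r + κ))
    refine this.congr_deriv ?_
    rw [Nat.cast_ofNat, pow_one, neg_div, mul_div_mul_left _ _ two_ne_zero]
  rw [← himg, lintegral_image_eq_lintegral_abs_deriv_mul measurableSet_Ioo hd hinj]
  refine setLIntegral_congr_fun measurableSet_Ioo fun u hu => ?_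
  have h0 := hpos u hu
  simp only [abs_neg, abs_of_pos (div_pos h0 hκ)]
  congr 2
  rw [show r ^ 2 + κ ^ 2 - 2 * κ * T u = u ^ 2 by simp only [hT]; field_simp; ring,
    Real.sqrt_sq h0.le]

/-- Bipolar coordinates for `k` on the first axis: in cylindrical coordinates, `z` is eliminated in
favour of `|k - p|` at fixed `|p|`. -/
theorem lintegral_bipolar_axis {κ : ℝ} (hκ : 0 < κ) {F : ℝ → ℝ → ℝ≥0∞}
    (hF : Measurable (Function.uncurry F)) :
    ∫⁻ p : Space, F ‖p‖ ‖κ • EuclideanSpace.single 0 1 - p‖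
      = ∫⁻ r in Set.Ioi (0 : ℝ), ∫⁻ u in Set.Ioo |r - κ| (r + κ),
          ENNReal.ofReal (2 * Real.pi * (r * u) / κ) * F r u := by
  set H : ℝ → ℝ → ℝ≥0∞ := fun z s => F (Real.sqrt (z ^ 2 + s)) (Real.sqrt ((κ - z) ^ 2 + s)) with hHdef
  have hH : Measurable (Function.uncurry H) :=
    hF.comp (by fun_prop : Measurable fun q : ℝ × ℝ =>
      (Real.sqrt (q.1 ^ 2 + q.2), Real.sqrt ((κ - q.1) ^ 2 + q.2)))
  have e1 : ∀ p : Space, F ‖p‖ ‖κ • EuclideanSpace.single 0 1 - p‖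
      = H (p 0) (p 1 ^ 2 + p 2 ^ 2) := by
    intro p
    simp only [hHdef]
    rw [EuclideanSpace.norm_eq, EuclideanSpace.norm_eq]
    simp [Fin.sum_univ_three, add_assoc]
  simp_rw [e1]
  rw [lintegral_space_cylindrical hH]
  -- The substitution `R = z² + s` turns the inner integral into one over `R > z²`.
  have e2 : ∀ z : ℝ, ∫⁻ s in Set.Ioi (0 : ℝ), H z s = ∫⁻ R : ℝ,
      (Set.Ioi (z ^ 2)).indicator
        (fun R => F (Real.sqrt R) (Real.sqrt (R + κ ^ 2 - 2 * κ * z))) R := by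
    intro z
    rw [← lintegral_indicator measurableSet_Ioi, ← lintegral_add_right_eq_self _ (-z ^ 2)]
    refine lintegral_congr fun R => ?_
    simp only [Set.indicator, Set.mem_Ioi, hHdef]
    by_cases hR : z ^ 2 < R
    · rw [if_pos (by linarith), if_pos hR]
      ring_nf
    · rw [if_neg (by linarith), if_neg hR]
  simp_rw [e2]
  have hmeas : Measurable (Function.uncurry fun z R : ℝ => (Set.Ioi (z ^ 2)).indicator
        (fun R => F (Real.sqrt R) (Real.sqrt (R + κ ^ 2 - 2 * κ * z))) R) := by
    have : (Function.uncurry fun z R : ℝ => (Set.Ioi (z ^ 2)).indicator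
        (fun R => F (Real.sqrt R) (Real.sqrt (R + κ ^ 2 - 2 * κ * z))) R)
        = {q : ℝ × ℝ | q.1 ^ 2 < q.2}.indicator
          (fun q => Function.uncurry F
            (Real.sqrt q.2, Real.sqrt (q.2 + κ ^ 2 - 2 * κ * q.1))) := by
      ext q
      simp [Function.uncurry, Set.indicator]
    rw [this]
    refine Measurable.indicator (hF.comp (by fun_prop)) ?_
    exact measurableSet_lt (by fun_prop) (by fun_prop)
  rw [lintegral_lintegral_swap hmeas.aemeasurable]
  have e3 : ∀ R : ℝ, ∫⁻ z : ℝ, (Set.Ioi (z ^ 2)).indicator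
        (fun R => F (Real.sqrt R) (Real.sqrt (R + κ ^ 2 - 2 * κ * z))) R
      = (Set.Ioi (0 : ℝ)).indicator (fun R => ∫⁻ z in Set.Ioo (-Real.sqrt R) (Real.sqrt R),
          F (Real.sqrt R) (Real.sqrt (R + κ ^ 2 - 2 * κ * z))) R := by
    intro R
    by_cases hR : 0 < R
    · rw [Set.indicator_of_mem (Set.mem_Ioi.2 hR), ← lintegral_indicator measurableSet_Ioo]
      refine lintegral_congr fun z => ?_
      simp only [Set.indicator, Set.mem_Ioi, Set.mem_Ioo]
      have : z ^ 2 < R ↔ -Real.sqrt R < z ∧ z < Real.sqrt R := Real.sq_lt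
      simp only [this]
    · rw [Set.indicator_of_notMem (by simpa using hR)]
      have : ∀ z : ℝ, (Set.Ioi (z ^ 2)).indicator
        (fun R => F (Real.sqrt R) (Real.sqrt (R + κ ^ 2 - 2 * κ * z))) R = 0 := by
        intro z
        apply Set.indicator_of_notMem
        simp only [Set.mem_Ioi, not_lt]
        nlinarith [sq_nonneg z]
      simp [this]
  simp_rw [e3]
  rw [lintegral_indicator measurableSet_Ioi, lintegral_Ioi_comp_sq,
    ← lintegral_const_mul' _ _ ENNReal.ofReal_ne_top]
  refine setLIntegral_congr_fun measurableSet_Ioi fun r hr => ?_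
  have hr' : (0 : ℝ) < r := hr
  simp only [Real.sqrt_sq hr'.le]
  rw [lintegral_Ioo_bipolar hκ hr', ← mul_assoc, ← lintegral_const_mul' _ _
    (ENNReal.mul_ne_top ENNReal.ofReal_ne_top ENNReal.ofReal_ne_top)]
  refine setLIntegral_congr_fun measurableSet_Ioo fun u hu => ?_
  have hu0 : 0 < u := (abs_nonneg _).trans_lt hu.1
  rw [← mul_assoc, ← ENNReal.ofReal_mul Real.pi_pos.le, ← ENNReal.ofReal_mul (by positivity)]
  congr 2
  ring

/-- A reflection maps the first axis to the direction of `k`. -/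
theorem exists_isometry_axis (k : Space) :
    ∃ R : Space ≃ₗᵢ[ℝ] Space, R (‖k‖ • EuclideanSpace.single 0 1) = k := by
  refine ⟨_, Submodule.reflection_sub (v := ‖k‖ • EuclideanSpace.single 0 1) (w := k) ?_⟩
  rw [norm_smul]
  simp

/-- Integration in bipolar coordinates `r = |p|`, `u = |k - p|`. -/
theorem lintegral_bipolar {k : Space} (hk : k ≠ 0) {F : ℝ → ℝ → ℝ≥0∞}
    (hF : Measurable (Function.uncurry F)) :
    ∫⁻ p : Space, F ‖p‖ ‖k - p‖
      = ∫⁻ r in Set.Ioi (0 : ℝ), ∫⁻ u in Set.Ioo |r - ‖k‖| (r + ‖k‖),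
          ENNReal.ofReal (2 * Real.pi * (r * u) / ‖k‖) * F r u := by
  rw [← lintegral_bipolar_axis (norm_pos_iff.2 hk) hF]
  obtain ⟨R, hR⟩ := exists_isometry_axis k
  rw [← R.measurePreserving.lintegral_comp_emb R.toHomeomorph.measurableEmbedding]
  refine lintegral_congr fun p => ?_
  rw [R.norm_map]
  conv_lhs => rw [← hR, ← map_sub, R.norm_map]

/-! ### Approximate Dirac deltas composed with a function -/

theorem approxDelta_nonneg {ε : ℝ} (hε : 0 < ε) (x : ℝ) : 0 ≤ approxDelta ε x := by
  unfold approxDelta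
  have := Real.pi_pos
  positivity

/-- A bound uniform in the width of the approximate delta. -/
theorem approxDelta_le_inv {ε d x : ℝ} (hε : 0 < ε) (hd : 0 < d) (hx : d ≤ |x|) :
    approxDelta ε x ≤ 1 / Real.pi * (1 / (2 * d)) := by
  unfold approxDelta
  have := Real.pi_pos
  refine mul_le_mul_of_nonneg_left ?_ (by positivity)
  rw [div_le_div_iff₀ (by positivity) (by positivity), ← sq_abs x]
  nlinarith [sq_nonneg (|x| - ε)]

/-- A bound which vanishes with the width of the approximate delta. -/
theorem approxDelta_le_mul {ε d x : ℝ} (hε : 0 < ε) (hd : 0 < d) (hx : d ≤ |x|) :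
    approxDelta ε x ≤ ε * (1 / Real.pi * (1 / d ^ 2)) := by
  unfold approxDelta
  have := Real.pi_pos
  rw [← mul_assoc, mul_comm ε, mul_assoc]
  refine mul_le_mul_of_nonneg_left ?_ (by positivity)
  rw [mul_one_div]
  refine div_le_div_of_nonneg_left hε.le (by positivity) ?_
  rw [← sq_abs x]
  have : d ^ 2 ≤ |x| ^ 2 := pow_le_pow_left₀ hd.le hx 2
  nlinarith [sq_nonneg ε]

theorem measurable_approxDelta (ε : ℝ) : Measurable (approxDelta ε) := by
  unfold approxDelta
  fun_prop

/-- The approximate delta of a linear function becomes this Lorentz profile on the scale of its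
width. -/
theorem integrable_lorentz {d : ℝ} (hd : d ≠ 0) :
    Integrable (fun y : ℝ => 1 / Real.pi * (1 / ((d * y) ^ 2 + 1))) := by
  have h := (integrable_inv_one_add_sq.comp_mul_left' hd).const_mul (1 / Real.pi)
  refine h.congr (Eventually.of_forall fun y => ?_)
  simp only [one_div, add_comm]

/-- The mass of the Lorentz profile, which is the Jacobian factor `δ(w(u) - e) = δ(u - x₀) /
|w'(x₀)|`. -/
theorem integral_lorentz {d : ℝ} (hd : d ≠ 0) :
    ∫ y : ℝ, 1 / Real.pi * (1 / ((d * y) ^ 2 + 1)) = 1 / |d| := by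
  have h := Measure.integral_comp_mul_left (fun y : ℝ => (1 + y ^ 2)⁻¹) d
  rw [integral_univ_inv_one_add_sq] at h
  have e : ∀ y : ℝ, 1 / Real.pi * (1 / ((d * y) ^ 2 + 1)) = 1 / Real.pi * (1 + (d * y) ^ 2)⁻¹ := by
    intro y
    simp only [one_div, add_comm]
  simp_rw [e]
  have := Real.pi_pos
  rw [integral_const_mul, h, smul_eq_mul, abs_inv]
  field_simp

/-- Concentration of `approxDelta ε (w u - w x₀)` at `x₀`. The function `χ` records which part of
the infinitesimal neighbourhood of `x₀` belongs to the domain of integration. -/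
theorem tendsto_integral_approxDelta {I : Set ℝ} (hI : MeasurableSet I) {w Φ χ : ℝ → ℝ}
    {x₀ m K d : ℝ} (hm : 0 < m) (hK0 : 0 ≤ K)
    (hw : ∀ u ∈ I, m * |u - x₀| ≤ |w u - w x₀|)
    (hd : HasDerivAt w d x₀) (hwm : Measurable w) (hΦm : Measurable Φ)
    (hK : ∀ u ∈ I, |Φ u| ≤ K) (hΦ : ContinuousAt Φ x₀)
    (hχ : ∀ y : ℝ, y ≠ 0 → ∀ᶠ ε in 𝓝[>] (0 : ℝ), I.indicator 1 (x₀ + ε * y) = χ y) :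
    Tendsto (fun ε => ∫ u in I, Φ u * approxDelta ε (w u - w x₀)) (𝓝[>] 0)
      (𝓝 (∫ y, χ y * (Φ x₀ * (1 / Real.pi * (1 / ((d * y) ^ 2 + 1)))))) := by
  set Ψ : ℝ → ℝ → ℝ := fun ε y => I.indicator 1 (x₀ + ε * y) * (Φ (x₀ + ε * y) *
    (1 / Real.pi * (1 / ((ε⁻¹ * (w (x₀ + ε * y) - w x₀)) ^ 2 + 1)))) with hΨ
  have hpi := Real.pi_pos
  have hrew : ∀ ε : ℝ, 0 < ε →
      ∫ u in I, Φ u * approxDelta ε (w u - w x₀) = ∫ y, Ψ ε y := by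
    intro ε hε
    set g : ℝ → ℝ := I.indicator fun u => Φ u * approxDelta ε (w u - w x₀) with hg
    have h1 := Measure.integral_comp_mul_left (fun y => g (x₀ + y)) ε
    rw [integral_add_left_eq_self, smul_eq_mul, abs_of_pos (inv_pos.2 hε), hg,
      integral_indicator hI] at h1
    have h2 : ∫ u in I, Φ u * approxDelta ε (w u - w x₀) = ε * ∫ y, g (x₀ + ε * y) := by
      rw [hg, h1]; field_simp
    rw [h2, ← integral_const_mul]
    congr 1
    ext y
    simp only [hg, hΨ, Set.indicator, Pi.one_apply]
    split_ifs
    · unfold approxDelta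
      have : (w (x₀ + ε * y) - w x₀) ^ 2 + ε ^ 2 ≠ 0 := by positivity
      have h3 : (ε⁻¹ * (w (x₀ + ε * y) - w x₀)) ^ 2 + 1
        = ((w (x₀ + ε * y) - w x₀) ^ 2 + ε ^ 2) / ε ^ 2 := by field_simp
      rw [h3]
      field_simp
    · simp
  have hlim : Tendsto (fun ε => ∫ y, Ψ ε y) (𝓝[>] 0)
      (𝓝 (∫ y, χ y * (Φ x₀ * (1 / Real.pi * (1 / ((d * y) ^ 2 + 1)))))) := by
    refine tendsto_integral_filter_of_dominated_convergence
      (fun y => K * (1 / Real.pi * (1 / ((m * y) ^ 2 + 1)))) ?_ ?_ ?_ ?_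
    · refine Eventually.of_forall fun ε => Measurable.aestronglyMeasurable ?_
      refine Measurable.mul ?_ (Measurable.mul ?_ ?_)
      · exact (measurable_one.indicator hI).comp (by fun_prop)
      · exact hΦm.comp (by fun_prop)
      · have : Measurable fun y => w (x₀ + ε * y) := hwm.comp (by fun_prop)
        fun_prop
    · filter_upwards [self_mem_nhdsWithin] with ε hε
      refine Eventually.of_forall fun y => ?_
      have hε' : (0 : ℝ) < ε := hε
      simp only [hΨ, Set.indicator, Pi.one_apply]
      split_ifs with hy
      · have h1 := hw _ hy
        have h2 := hK _ hy
        rw [add_sub_cancel_left, abs_mul, abs_of_pos hε'] at h1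
        have h3 : (m * y) ^ 2 ≤ (ε⁻¹ * (w (x₀ + ε * y) - w x₀)) ^ 2 := by
          rw [← sq_abs (m * y), ← sq_abs (ε⁻¹ * _), abs_mul, abs_mul, abs_of_pos hm,
            abs_of_pos (inv_pos.2 hε')]
          refine pow_le_pow_left₀ (by positivity) ?_ 2
          rw [← div_eq_inv_mul, le_div_iff₀ hε']
          calc m * |y| * ε = m * (ε * |y|) := by ring
            _ ≤ _ := h1
        rw [one_mul, norm_mul, Real.norm_eq_abs, Real.norm_of_nonneg (by positivity)]
        gcongr
      · simp only [zero_mul, norm_zero]; positivity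
    · exact (integrable_lorentz hm.ne').const_mul K
    · have : ∀ᵐ y : ℝ, y ≠ 0 := by simp [ae_iff]
      filter_upwards [this] with y hy
      have h0 : Tendsto (fun ε : ℝ => ε * y) (𝓝[>] 0) (𝓝 0) := by
        have : Tendsto (fun ε : ℝ => ε * y) (𝓝 0) (𝓝 (0 * y)) := by
          exact (continuous_mul_const y).tendsto 0
        rw [zero_mul] at this
        exact this.mono_left nhdsWithin_le_nhds
      have h1 : Tendsto (fun ε : ℝ => x₀ + ε * y) (𝓝[>] 0) (𝓝 x₀) := by
        simpa using h0.const_add x₀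
      have h2 : HasDerivAt (fun ε : ℝ => w (x₀ + ε * y)) (d * y) 0 := by
        have hd' : HasDerivAt w d (x₀ + 0 * y) := by simpa using hd
        exact hd'.comp 0 (((hasDerivAt_id (0 : ℝ)).mul_const y).const_add x₀ |>.congr_deriv (by simp))
      have h3 := h2.tendsto_slope_zero_right
      simp only [zero_add, zero_mul, add_zero, smul_eq_mul] at h3
      refine Tendsto.mul ?_ (Tendsto.mul (hΦ.tendsto.comp h1) (Tendsto.const_mul _ ?_))
      · exact tendsto_const_nhds.congr' ((hχ y hy).mono fun ε h => h.symm)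
      · exact Tendsto.div tendsto_const_nhds ((h3.pow 2).add_const 1) (by positivity)
  refine hlim.congr' ?_
  filter_upwards [self_mem_nhdsWithin] with ε hε
  exact (hrew ε hε).symm

/-- The mass of the approximate delta is bounded, uniformly in its width. -/
theorem integral_approxDelta_le {I : Set ℝ} (hI : MeasurableSet I) {w Φ : ℝ → ℝ}
    {x₀ e m K ε : ℝ} (hε : 0 < ε) (hm : 0 < m) (hK0 : 0 ≤ K)
    (hw : ∀ u ∈ I, m * |u - x₀| ≤ |w u - e|)
    (hΦ : ∀ u ∈ I, 0 ≤ Φ u) (hK : ∀ u ∈ I, Φ u ≤ K) :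
    ∫ u in I, Φ u * approxDelta ε (w u - e) ≤ K / m := by
  have hpi := Real.pi_pos
  set g : ℝ → ℝ := fun y => 1 / Real.pi * (1 / ((m * y) ^ 2 + 1)) with hg
  have hgi : Integrable g := integrable_lorentz hm.ne'
  have hgi' : Integrable (fun u => K * (ε⁻¹ * g (ε⁻¹ * (u - x₀)))) :=
    (((hgi.comp_mul_left' (inv_ne_zero hε.ne')).comp_sub_right x₀).const_mul ε⁻¹).const_mul K
  have hval : ∫ u, K * (ε⁻¹ * g (ε⁻¹ * (u - x₀))) = K / m := by
    rw [integral_const_mul, integral_const_mul,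
      integral_sub_right_eq_self (fun u => g (ε⁻¹ * u)) x₀, Measure.integral_comp_mul_left,
      integral_lorentz hm.ne', abs_of_pos hm, inv_inv, abs_of_pos hε, smul_eq_mul]
    field_simp
  have hg0 : ∀ y, 0 ≤ g y := fun y => by simp only [hg]; positivity
  rw [← hval]
  refine le_trans (integral_mono_of_nonneg ?_ hgi'.integrableOn ?_)
    (setIntegral_le_integral hgi' (Eventually.of_forall fun u =>
      mul_nonneg hK0 (mul_nonneg (inv_pos.2 hε).le (hg0 _))))
  · filter_upwards [ae_restrict_mem hI] with u hu
    exact mul_nonneg (hΦ u hu) (approxDelta_nonneg hε _)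
  · filter_upwards [ae_restrict_mem hI] with u hu
    refine mul_le_mul (hK u hu) ?_ (approxDelta_nonneg hε _) hK0
    have h1 := hw u hu
    have h2 : (m * |u - x₀|) ^ 2 ≤ (w u - e) ^ 2 := by
      rw [← sq_abs (w u - e)]
      exact pow_le_pow_left₀ (by positivity) h1 2
    rw [mul_pow, sq_abs, ← mul_pow] at h2
    have h3 : ε⁻¹ * g (ε⁻¹ * (u - x₀)) = 1 / Real.pi * (ε / ((m * (u - x₀)) ^ 2 + ε ^ 2)) := by
      simp only [hg]
      have : (m * (u - x₀)) ^ 2 + ε ^ 2 ≠ 0 := by positivity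
      have h4 : (m * (ε⁻¹ * (u - x₀))) ^ 2 + 1 = ((m * (u - x₀)) ^ 2 + ε ^ 2) / ε ^ 2 := by
        field_simp
      rw [h4]
      field_simp
    rw [h3]
    unfold approxDelta
    gcongr

/-- If the energy balance has no solution in a compact interval, the limit is zero. -/
theorem tendsto_integral_approxDelta_zero {α β K e : ℝ} {w Φ : ℝ → ℝ}
    (hw : ContinuousOn w (Set.Icc α β)) (he : ∀ u ∈ Set.Icc α β, w u ≠ e)
    (hK : ∀ u ∈ Set.Icc α β, |Φ u| ≤ K) :
    Tendsto (fun ε => ∫ u in Set.Ioo α β, Φ u * approxDelta ε (w u - e)) (𝓝[>] 0) (𝓝 0) := by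
  have hpi := Real.pi_pos
  obtain ⟨d, hd, hd'⟩ : ∃ d > 0, ∀ u ∈ Set.Icc α β, d ≤ |w u - e| := by
    rcases (Set.Icc α β).eq_empty_or_nonempty with h | h
    · exact ⟨1, one_pos, by simp [h]⟩
    · obtain ⟨u₀, hu₀, hmin⟩ := isCompact_Icc.exists_isMinOn h
        ((hw.sub continuousOn_const).abs : ContinuousOn (fun u => |w u - e|) (Set.Icc α β))
      exact ⟨|w u₀ - e|, abs_pos.2 (sub_ne_zero.2 (he u₀ hu₀)), fun u hu => hmin hu⟩
  have hlim : Tendsto (fun ε : ℝ => K * (ε * (1 / Real.pi * (1 / d ^ 2))) *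
      (volume : Measure ℝ).real (Set.Ioo α β)) (𝓝[>] 0) (𝓝 0) := by
    have : Tendsto (fun ε : ℝ => K * (ε * (1 / Real.pi * (1 / d ^ 2))) *
      (volume : Measure ℝ).real (Set.Ioo α β)) (𝓝 0) (𝓝 (K * (0 * (1 / Real.pi * (1 / d ^ 2))) *
      (volume : Measure ℝ).real (Set.Ioo α β))) := by
      apply Continuous.tendsto (f := fun ε : ℝ => K * (ε * (1 / Real.pi * (1 / d ^ 2))) *
        (volume : Measure ℝ).real (Set.Ioo α β))
      fun_prop
    simp only [zero_mul, mul_zero] at this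
    exact this.mono_left nhdsWithin_le_nhds
  refine squeeze_zero_norm' ?_ hlim
  filter_upwards [self_mem_nhdsWithin] with ε hε
  have hε' : (0 : ℝ) < ε := hε
  refine norm_setIntegral_le_of_norm_le_const (by simp) fun u hu => ?_
  have hu' := Set.Ioo_subset_Icc_self hu
  rw [norm_mul, Real.norm_eq_abs, Real.norm_of_nonneg (approxDelta_nonneg hε' _)]
  exact mul_le_mul (hK u hu') (approxDelta_le_mul hε' hd (hd' u hu'))
    (approxDelta_nonneg hε' _) ((abs_nonneg _).trans (hK u hu'))

/-- The case of an increasing function in `exists_nearest_solution`. -/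
theorem exists_nearest_solution_of_le {α β m : ℝ} (hαβ : α ≤ β) (hm : 0 < m) {w w' : ℝ → ℝ}
    (hw : ∀ u ∈ Set.Icc α β, HasDerivAt w (w' u) u) (hsgn : ∀ u ∈ Set.Icc α β, m ≤ w' u) (e : ℝ) :
    ∃ x₀ ∈ Set.Icc α β, (∀ u ∈ Set.Icc α β, m * |u - x₀| ≤ |w u - e|) ∧
      (w x₀ = e ∨ ∀ u ∈ Set.Icc α β, w u ≠ e) := by
  have hc : ContinuousOn w (Set.Icc α β) := fun u hu => (hw u hu).continuousAt.continuousWithinAt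
  have hmono : ∀ u ∈ Set.Icc α β, ∀ v ∈ Set.Icc α β, u ≤ v → m * (v - u) ≤ w v - w u := by
    refine (convex_Icc α β).mul_sub_le_image_sub_of_le_deriv hc ?_ ?_
    · intro u hu
      exact (hw u (interior_subset hu)).differentiableAt.differentiableWithinAt
    · intro u hu
      rw [(hw u (interior_subset hu)).deriv]
      exact hsgn u (interior_subset hu)
  have hα : α ∈ Set.Icc α β := Set.left_mem_Icc.2 hαβ
  have hβ : β ∈ Set.Icc α β := Set.right_mem_Icc.2 hαβ
  rcases lt_trichotomy e (w α) with h | h | h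
  · refine ⟨α, hα, fun u hu => ?_, Or.inr fun u hu hue => ?_⟩
    · have h1 := hmono α hα u hu hu.1
      rw [abs_of_nonneg (by linarith [hu.1]), abs_of_nonneg] <;> nlinarith [hu.1]
    · have h1 := hmono α hα u hu hu.1
      nlinarith [hu.1]
  · refine ⟨α, hα, fun u hu => ?_, Or.inl h.symm⟩
    have h1 := hmono α hα u hu hu.1
    rw [abs_of_nonneg (by linarith [hu.1]), abs_of_nonneg] <;> nlinarith [hu.1]
  · rcases lt_or_ge (w β) e with h' | h'
    · refine ⟨β, hβ, fun u hu => ?_, Or.inr fun u hu hue => ?_⟩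
      · have h1 := hmono u hu β hβ hu.2
        rw [abs_of_nonpos (by linarith [hu.2]), abs_of_nonpos] <;> nlinarith [hu.2]
      · have h1 := hmono u hu β hβ hu.2
        nlinarith [hu.2]
    · obtain ⟨x₀, hx₀, rfl⟩ := intermediate_value_Icc hαβ hc ⟨h.le, h'⟩
      refine ⟨x₀, hx₀, fun u hu => ?_, Or.inl rfl⟩
      rcases le_total x₀ u with hxu | hxu
      · have h1 := hmono x₀ hx₀ u hu hxu
        rw [abs_of_nonneg (by linarith), abs_of_nonneg] <;> nlinarith
      · have h1 := hmono u hu x₀ hx₀ hxu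
        rw [abs_of_nonpos (by linarith), abs_of_nonpos] <;> nlinarith

/-- For a function with slope at least `m` in absolute value, the equation `w u = e` has a solution
or a boundary point substituting for it, from which `w - e` grows at least linearly. -/
theorem exists_nearest_solution {α β m : ℝ} (hαβ : α ≤ β) (hm : 0 < m) {w w' : ℝ → ℝ}
    (hw : ∀ u ∈ Set.Icc α β, HasDerivAt w (w' u) u)
    (hsgn : (∀ u ∈ Set.Icc α β, m ≤ w' u) ∨ ∀ u ∈ Set.Icc α β, w' u ≤ -m) (e : ℝ) :
    ∃ x₀ ∈ Set.Icc α β, (∀ u ∈ Set.Icc α β, m * |u - x₀| ≤ |w u - e|) ∧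
      (w x₀ = e ∨ ∀ u ∈ Set.Icc α β, w u ≠ e) := by
  rcases hsgn with h | h
  · exact exists_nearest_solution_of_le hαβ hm hw h e
  · obtain ⟨x₀, hx₀, h1, h2⟩ := exists_nearest_solution_of_le (w := fun u => -w u)
      (w' := fun u => -w' u) hαβ hm (fun u hu => (hw u hu).neg)
      (fun u hu => by linarith [h u hu]) (-e)
    refine ⟨x₀, hx₀, fun u hu => ?_, ?_⟩
    · have := h1 u hu
      rwa [show -w u - -e = -(w u - e) by ring, abs_neg] at this
    · rcases h2 with h2 | h2
      · exact Or.inl (neg_injective h2)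
      · exact Or.inr fun u hu hue => h2 u hu (by rw [hue])

/-- The limit at a solution in the interior of the interval. -/
theorem tendsto_integral_approxDelta_interior {α β : ℝ} {w Φ : ℝ → ℝ}
    {x₀ m K d e : ℝ} (hm : 0 < m) (hx₀ : x₀ ∈ Set.Ioo α β) (he : w x₀ = e)
    (hw : ∀ u ∈ Set.Ioo α β, m * |u - x₀| ≤ |w u - e|)
    (hd : HasDerivAt w d x₀) (hd0 : d ≠ 0) (hwm : Measurable w) (hΦm : Measurable Φ)
    (hK : ∀ u ∈ Set.Ioo α β, |Φ u| ≤ K) (hΦ : ContinuousAt Φ x₀) :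
    Tendsto (fun ε => ∫ u in Set.Ioo α β, Φ u * approxDelta ε (w u - e)) (𝓝[>] 0)
      (𝓝 (Φ x₀ / |d|)) := by
  subst he
  have h := tendsto_integral_approxDelta measurableSet_Ioo (χ := fun _ => 1) hm
    ((abs_nonneg _).trans (hK x₀ hx₀)) hw hd hwm hΦm
    hK hΦ ?_
  · simp only [one_mul] at h
    rw [integral_const_mul, integral_lorentz hd0, mul_one_div] at h
    exact h
  · intro y _
    have h1 : Tendsto (fun ε : ℝ => x₀ + ε * y) (𝓝[>] 0) (𝓝 x₀) := by
      have : Tendsto (fun ε : ℝ => x₀ + ε * y) (𝓝 0) (𝓝 (x₀ + 0 * y)) :=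
        Continuous.tendsto (by fun_prop) 0
      rw [zero_mul, add_zero] at this
      exact this.mono_left nhdsWithin_le_nhds
    filter_upwards [h1.eventually (isOpen_Ioo.mem_nhds hx₀)] with ε hε
    exact Set.indicator_of_mem (s := Set.Ioo α β) hε 1

/-- Existence of the limit on an interval on which `w` has no critical point, and a bound for it.
A solution of `w u = e` at an end point contributes half of what it does in the interior. -/
theorem exists_limit_approxDelta {α β m K e : ℝ} (hαβ : α < β) (hm : 0 < m) {w w' Φ : ℝ → ℝ}
    (hw : ∀ u ∈ Set.Icc α β, HasDerivAt w (w' u) u)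
    (hsgn : (∀ u ∈ Set.Icc α β, m ≤ w' u) ∨ ∀ u ∈ Set.Icc α β, w' u ≤ -m)
    (hwm : Measurable w) (hΦm : Measurable Φ)
    (hΦ0 : ∀ u ∈ Set.Icc α β, 0 ≤ Φ u) (hK : ∀ u ∈ Set.Icc α β, Φ u ≤ K)
    (hΦ : ∀ u ∈ Set.Icc α β, ContinuousAt Φ u) :
    ∃ L, Tendsto (fun ε => ∫ u in Set.Ioo α β, Φ u * approxDelta ε (w u - e)) (𝓝[>] 0) (𝓝 L) ∧
      0 ≤ L ∧ ∀ B, 0 ≤ B → (∀ u ∈ Set.Icc α β, w u = e → Φ u / |w' u| ≤ B) → L ≤ B := by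
  have hKa : ∀ u ∈ Set.Icc α β, |Φ u| ≤ K := fun u hu => by
    rw [abs_of_nonneg (hΦ0 u hu)]; exact hK u hu
  obtain ⟨x₀, hx₀, h1, h2⟩ := exists_nearest_solution hαβ.le hm hw hsgn e
  rcases h2 with h2 | h2
  swap
  · exact ⟨0, tendsto_integral_approxDelta_zero
      (fun u hu => (hw u hu).continuousAt.continuousWithinAt) h2 hKa, le_rfl, fun B hB _ => hB⟩
  have hd0 : w' x₀ ≠ 0 := by
    rcases hsgn with h | h
    · have := h x₀ hx₀; linarith
    · have := h x₀ hx₀; linarith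
  have hpi := Real.pi_pos
  -- The three positions of the solution only differ in the cut-off `χ`.
  suffices H : ∃ χ : ℝ → ℝ, (∀ y, 0 ≤ χ y ∧ χ y ≤ 1) ∧
      ∀ y : ℝ, y ≠ 0 → ∀ᶠ ε in 𝓝[>] (0 : ℝ), (Set.Ioo α β).indicator 1 (x₀ + ε * y) = χ y by
    obtain ⟨χ, hχ, hχ'⟩ := H
    have hb := h1
    subst h2
    have h := tendsto_integral_approxDelta measurableSet_Ioo hm
      ((abs_nonneg _).trans (hKa x₀ hx₀)) (fun u hu => hb u (Set.Ioo_subset_Icc_self hu)) (hw x₀ hx₀) hwm hΦm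
      (fun u hu => hKa u (Set.Ioo_subset_Icc_self hu)) (hΦ x₀ hx₀) hχ'
    have h0 := hΦ0 x₀ hx₀
    refine ⟨_, h, integral_nonneg fun y => ?_, fun B hB hBb => ?_⟩
    · have := (hχ y).1
      simp only [Pi.zero_apply]
      positivity
    · refine le_trans ?_ (hBb x₀ hx₀ rfl)
      have e1 : Φ x₀ / |w' x₀| = ∫ y, Φ x₀ * (1 / Real.pi * (1 / ((w' x₀ * y) ^ 2 + 1))) := by
        rw [integral_const_mul, integral_lorentz hd0, mul_one_div]
      rw [e1]
      refine integral_mono_of_nonneg (Eventually.of_forall fun y => ?_)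
        ((integrable_lorentz hd0).const_mul _) (Eventually.of_forall fun y => ?_)
      · have := (hχ y).1
        change 0 ≤ χ y * (Φ x₀ * (1 / Real.pi * (1 / ((w' x₀ * y) ^ 2 + 1))))
        positivity
      · have h3 := (hχ y).2
        have h4 : 0 ≤ Φ x₀ * (1 / Real.pi * (1 / ((w' x₀ * y) ^ 2 + 1))) := by positivity
        exact mul_le_of_le_one_left h4 h3
  have hlim : ∀ y : ℝ, Tendsto (fun ε : ℝ => x₀ + ε * y) (𝓝[>] 0) (𝓝 x₀) := by
    intro y
    have : Tendsto (fun ε : ℝ => x₀ + ε * y) (𝓝 0) (𝓝 (x₀ + 0 * y)) :=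
      Continuous.tendsto (by fun_prop) 0
    rw [zero_mul, add_zero] at this
    exact this.mono_left nhdsWithin_le_nhds
  rcases hx₀.1.eq_or_lt with ha | ha
  · subst ha
    refine ⟨fun y => if 0 < y then 1 else 0, fun y => by dsimp only; split_ifs <;> norm_num, fun y hy => ?_⟩
    filter_upwards [(hlim y).eventually (gt_mem_nhds hαβ), self_mem_nhdsWithin] with ε h3 hε
    have hε' : (0 : ℝ) < ε := hε
    simp only [Set.indicator, Set.mem_Ioo, h3, and_true, Pi.one_apply]
    congr 1
    simp [hε']
  · rcases hx₀.2.eq_or_lt with hb | hb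
    · subst hb
      refine ⟨fun y => if y < 0 then 1 else 0, fun y => by dsimp only; split_ifs <;> norm_num, fun y hy => ?_⟩
      filter_upwards [(hlim y).eventually (lt_mem_nhds hαβ), self_mem_nhdsWithin] with ε h3 hε
      have hε' : (0 : ℝ) < ε := hε
      simp only [Set.indicator, Set.mem_Ioo, h3, true_and, Pi.one_apply]
      congr 1
      rw [eq_iff_iff]
      constructor
      · intro h; by_contra h'; push Not at h'; nlinarith
      · intro h; nlinarith
    · refine ⟨fun _ => 1, fun y => ⟨zero_le_one, le_rfl⟩, fun y hy => ?_⟩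
      filter_upwards [(hlim y).eventually (isOpen_Ioo.mem_nhds ⟨ha, hb⟩)] with ε hε
      exact Set.indicator_of_mem (s := Set.Ioo α β) hε 1

/-! ### The rescaled problem -/

/-- The phase velocity `√(f(r) + r²/4)`, where `f` is the normalized interaction profile in units
in which `ν = 1`. -/
noncomputable def velocity (f : ℝ → ℝ) (r : ℝ) : ℝ := Real.sqrt (f r + r ^ 2 / 4)

/-- The dispersion relation in units in which `ν = 1`. -/
noncomputable def disp (f : ℝ → ℝ) (r : ℝ) : ℝ := r * velocity f r

/-- The derivative of the phase velocity, `f₁` being the derivative of `f`. -/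
noncomputable def velocityDeriv (f f₁ : ℝ → ℝ) (r : ℝ) : ℝ :=
  (f₁ r + r / 2) / (2 * velocity f r)

/-- The second derivative of the phase velocity, `f₁` and `f₂` being the derivatives of `f`. -/
noncomputable def velocityDeriv2 (f f₁ f₂ : ℝ → ℝ) (r : ℝ) : ℝ :=
  (f₂ r + 1 / 2) / (2 * velocity f r) - (f₁ r + r / 2) ^ 2 / (4 * velocity f r ^ 3)

/-- The derivative of the dispersion relation, `f₁` being the derivative of `f`. -/
noncomputable def dispDeriv (f f₁ : ℝ → ℝ) (r : ℝ) : ℝ :=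
  (r ^ 2 / 2 + f r + r * f₁ r / 2) / velocity f r

/-- The coherence factor: the square of the difference `c - s` of the Bogoliubov coefficients. Here
`r²/2 + f(r)` is the value of `√(ω² + f²)`. -/
noncomputable def coherence (f : ℝ → ℝ) (r : ℝ) : ℝ := (r ^ 2 / 2 + f r - |f r|) / disp f r

/-- The signed sum whose square, divided by four times the product of the coherence factors, is the
squared vertex. The term of `u` has the opposite sign of the others, as in the energy balance. -/
noncomputable def vertexSum (f : ℝ → ℝ) (u κ r : ℝ) : ℝ :=
  f κ * coherence f κ + f r * coherence f r - f u * coherence f u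
    + coherence f u * coherence f κ * coherence f r * (f u + f κ + f r)

/-- The square of the vertex `j(k; p, q)` for momenta of lengths `u`, `κ`, `r`, up to the factor
`ν v̂(0)`. -/
noncomputable def vertexSq (f : ℝ → ℝ) (u κ r : ℝ) : ℝ :=
  vertexSum f u κ r ^ 2 / (4 * (coherence f u * coherence f κ * coherence f r))

/-- The thermal factor, for inverse temperature `b` and momenta of lengths `κ`, `r`, `u`. -/
noncomputable def thermalRadial (f : ℝ → ℝ) (b κ r u : ℝ) : ℝ :=
  (Real.exp (b / 2 * (disp f κ + disp f u)) - Real.exp (b / 2 * disp f r)) ^ 2 /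
    ((Real.exp (b * disp f κ) - 1) * (Real.exp (b * disp f r) - 1) * (Real.exp (b * disp f u) - 1))

theorem hasDerivAt_velocity_of_pos {f f₁ : ℝ → ℝ} {r : ℝ} (hf : HasDerivAt f (f₁ r) r)
    (hr : 0 < f r + r ^ 2 / 4) :
    HasDerivAt (velocity f) ((f₁ r + r / 2) / (2 * velocity f r)) r := by
  have h1 : HasDerivAt (fun r => f r + r ^ 2 / 4) (f₁ r + r / 2) r :=
    (hf.add ((hasDerivAt_pow 2 r).div_const 4)).congr_deriv (by norm_num; ring)
  exact h1.sqrt hr.ne'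

theorem dispDeriv_eq_of_pos {f f₁ : ℝ → ℝ} {r : ℝ} (hr : 0 < f r + r ^ 2 / 4) :
    dispDeriv f f₁ r = velocity f r + r * ((f₁ r + r / 2) / (2 * velocity f r)) := by
  have h1 : 0 < velocity f r := Real.sqrt_pos.2 hr
  have h2 : velocity f r ^ 2 = f r + r ^ 2 / 4 := Real.sq_sqrt hr.le
  unfold dispDeriv
  rw [div_eq_iff h1.ne']
  field_simp
  linear_combination (-4 : ℝ) * h2

theorem hasDerivAt_disp_of_pos {f f₁ : ℝ → ℝ} {r : ℝ} (hf : HasDerivAt f (f₁ r) r)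
    (hr : 0 < f r + r ^ 2 / 4) : HasDerivAt (disp f) (dispDeriv f f₁ r) r := by
  rw [dispDeriv_eq_of_pos hr]
  exact ((hasDerivAt_id r).mul (hasDerivAt_velocity_of_pos hf hr)).congr_deriv (by simp)

/-- Quantitative hypotheses on a normalized interaction profile `f` with derivatives `f₁`, `f₂`.
All estimates are uniform over the profiles with given constants, which is what makes them uniform
in the chemical potential. The last field says that, away from the origin, either the dispersion
relation varies too little to satisfy the energy balance, or it has no critical point. -/
structure IsProfile (a c M δ η : ℝ) (f f₁ f₂ : ℝ → ℝ) : Prop where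
  a_pos : 0 < a
  a_le : a ≤ 1
  c_pos : 0 < c
  one_le_M : 1 ≤ M
  δ_pos : 0 < δ
  η_le : η ≤ δ / 2
  small : (M + 2) ^ 2 * (2 * δ) ^ 2 ≤ a / 4
  hasDerivAt : ∀ r, HasDerivAt f (f₁ r) r
  continuous_deriv : Continuous f₁
  hasDerivAt_deriv : ∀ r, 0 ≤ r → r ≤ 2 * δ → HasDerivAt f₁ (f₂ r) r
  zero : f 0 = 1
  deriv_zero : f₁ 0 = 0
  bound : ∀ r, |f r| ≤ M
  lower : ∀ r, c ^ 2 ≤ f r + r ^ 2 / 4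
  deriv2_lower : ∀ r, 0 ≤ r → r ≤ 2 * δ → -(1 / 2) + a ≤ f₂ r
  deriv2_bound : ∀ r, 0 ≤ r → r ≤ 2 * δ → |f₂ r| ≤ M
  dichotomy : ∀ r κ, δ ≤ r → 0 < κ → κ ≤ η →
    (∀ u ∈ Set.Icc (r - κ) (r + κ), |disp f u - disp f r| ≤ κ / 2) ∨
    (∀ u ∈ Set.Icc (r - κ) (r + κ), c / (1 + u) ≤ dispDeriv f f₁ u) ∨
    (∀ u ∈ Set.Icc (r - κ) (r + κ), dispDeriv f f₁ u ≤ -(c / (1 + u)))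

/-- The second difference of a function is a second derivative, by the mean value theorem for
`x ↦ H (x + q) - H x` and then for `H₁`. -/
theorem exists_second_difference {H H₁ H₂ : ℝ → ℝ} {p q : ℝ} (hp : 0 < p) (hq : 0 < q)
    (h1 : ∀ x ∈ Set.Icc 0 (p + q), HasDerivAt H (H₁ x) x)
    (h2 : ∀ x ∈ Set.Icc 0 (p + q), HasDerivAt H₁ (H₂ x) x) (h0 : H 0 = 0) :
    ∃ ξ ∈ Set.Ioo 0 (p + q), H (p + q) - H p - H q = p * q * H₂ ξ := by
  have hG : ∀ x ∈ Set.Icc 0 p, HasDerivAt (fun x => H (x + q) - H x) (H₁ (x + q) - H₁ x) x := by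
    intro x hx
    have e1 : HasDerivAt H (H₁ (x + q)) (x + q) := h1 _ ⟨by linarith [hx.1], by linarith [hx.2]⟩
    exact (e1.comp_add_const x q).sub (h1 x ⟨hx.1, by linarith [hx.2]⟩)
  obtain ⟨x, hx, hxe⟩ := exists_hasDerivAt_eq_slope (fun x => H (x + q) - H x)
    (fun x => H₁ (x + q) - H₁ x) hp (fun x hx => (hG x hx).continuousAt.continuousWithinAt)
    (fun x hx => hG x (Set.Ioo_subset_Icc_self hx))
  obtain ⟨ξ, hξ, hξe⟩ := exists_hasDerivAt_eq_slope H₁ H₂ (by linarith : x < x + q)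
    (fun y hy => (h2 y ⟨by linarith [hx.1, hy.1], by linarith [hx.2, hy.2]⟩).continuousAt.continuousWithinAt)
    (fun y hy => h2 y ⟨by linarith [hx.1, hy.1], by linarith [hx.2, hy.2]⟩)
  refine ⟨ξ, ⟨by linarith [hx.1, hξ.1], by linarith [hx.2, hξ.2]⟩, ?_⟩
  simp only [zero_add, h0, sub_zero, add_sub_cancel_left] at hxe hξe
  have hp' := hp.ne'
  have hq' := hq.ne'
  rw [hξe, hxe]
  field_simp

namespace IsProfile

variable {a c M δ η : ℝ} {f f₁ f₂ : ℝ → ℝ}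

theorem continuous (h : IsProfile a c M δ η f f₁ f₂) : Continuous f :=
  continuous_iff_continuousAt.2 fun r => (h.hasDerivAt r).continuousAt

theorem arg_pos (h : IsProfile a c M δ η f f₁ f₂) (r : ℝ) : 0 < f r + r ^ 2 / 4 :=
  (pow_pos h.c_pos 2).trans_le (h.lower r)

theorem c_le_velocity (h : IsProfile a c M δ η f f₁ f₂) (r : ℝ) : c ≤ velocity f r :=
  Real.le_sqrt_of_sq_le (h.lower r)

theorem velocity_pos (h : IsProfile a c M δ η f f₁ f₂) (r : ℝ) : 0 < velocity f r :=
  h.c_pos.trans_le (h.c_le_velocity r)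

theorem velocity_sq (h : IsProfile a c M δ η f f₁ f₂) (r : ℝ) :
    velocity f r ^ 2 = f r + r ^ 2 / 4 := Real.sq_sqrt (h.arg_pos r).le

theorem continuous_velocity (h : IsProfile a c M δ η f f₁ f₂) : Continuous (velocity f) := by
  have := h.continuous
  unfold velocity
  fun_prop

theorem continuous_disp (h : IsProfile a c M δ η f f₁ f₂) : Continuous (disp f) :=
  continuous_id.mul h.continuous_velocity

theorem disp_pos (h : IsProfile a c M δ η f f₁ f₂) {r : ℝ} (hr : 0 < r) : 0 < disp f r :=
  mul_pos hr (h.velocity_pos r)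

theorem le_disp (h : IsProfile a c M δ η f f₁ f₂) {r : ℝ} (hr : 0 ≤ r) : c * r ≤ disp f r := by
  rw [mul_comm]
  exact mul_le_mul_of_nonneg_left (h.c_le_velocity r) hr

theorem hasDerivAt_velocity (h : IsProfile a c M δ η f f₁ f₂) (r : ℝ) :
    HasDerivAt (velocity f) ((f₁ r + r / 2) / (2 * velocity f r)) r :=
  hasDerivAt_velocity_of_pos (h.hasDerivAt r) (h.arg_pos r)

theorem dispDeriv_eq (h : IsProfile a c M δ η f f₁ f₂) (r : ℝ) :
    dispDeriv f f₁ r = velocity f r + r * ((f₁ r + r / 2) / (2 * velocity f r)) :=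
  dispDeriv_eq_of_pos (h.arg_pos r)

theorem hasDerivAt_disp (h : IsProfile a c M δ η f f₁ f₂) (r : ℝ) :
    HasDerivAt (disp f) (dispDeriv f f₁ r) r :=
  hasDerivAt_disp_of_pos (h.hasDerivAt r) (h.arg_pos r)

/-! ### Estimates near the origin -/

theorem δ_le (h : IsProfile a c M δ η f f₁ f₂) : δ ≤ 1 / 12 := by
  have h1 := h.small
  have h2 := h.a_le
  have h3 := h.one_le_M
  have h4 := h.δ_pos
  by_contra h5
  push Not at h5
  have : (3 : ℝ) ^ 2 * (2 * (1 / 12)) ^ 2 < (M + 2) ^ 2 * (2 * δ) ^ 2 := by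
    apply mul_lt_mul' (by nlinarith) (by nlinarith) (by positivity) (by positivity)
  linarith

/-- On `[0, 2δ]` the quadratic corrections are small, both absolutely and compared with the
convexity margin `a`. -/
theorem mul_sq_le (h : IsProfile a c M δ η f f₁ f₂) {r : ℝ} (hr : 0 ≤ r) (hr2 : r ≤ 2 * δ) :
    (M + 1) ^ 2 * r ^ 2 ≤ a / 4 ∧ (M + 1) * r ^ 2 ≤ 1 / 48 * 4 := by
  have h1 := h.small
  have h2 := h.a_le
  have h3 := h.one_le_M
  have h4 : r ^ 2 ≤ (2 * δ) ^ 2 := pow_le_pow_left₀ hr hr2 2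
  have h5 : 0 ≤ r ^ 2 := sq_nonneg r
  constructor
  · calc (M + 1) ^ 2 * r ^ 2 ≤ (M + 2) ^ 2 * (2 * δ) ^ 2 := by gcongr; linarith
      _ ≤ _ := h1
  · have : (M + 1) * r ^ 2 * 3 ≤ (M + 2) ^ 2 * (2 * δ) ^ 2 := by
      calc (M + 1) * r ^ 2 * 3 = ((M + 1) * 3) * r ^ 2 := by ring
        _ ≤ (M + 2) ^ 2 * (2 * δ) ^ 2 := by
          gcongr
          nlinarith
    linarith

/-- The first derivative vanishes at the origin, so the bounds of the second one integrate. -/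
theorem deriv_bounds (h : IsProfile a c M δ η f f₁ f₂) {r : ℝ} (hr : 0 ≤ r) (hr2 : r ≤ 2 * δ) :
    (a - 1 / 2) * r ≤ f₁ r ∧ |f₁ r| ≤ M * r := by
  rcases hr.eq_or_lt with rfl | hr'
  · simp [h.deriv_zero]
  obtain ⟨ξ, hξ, he⟩ := exists_hasDerivAt_eq_slope f₁ f₂ hr' h.continuous_deriv.continuousOn
    (fun x hx => h.hasDerivAt_deriv x hx.1.le (hx.2.le.trans hr2))
  rw [h.deriv_zero, sub_zero, sub_zero, eq_div_iff hr'.ne'] at he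
  have h1 := h.deriv2_lower ξ hξ.1.le (hξ.2.le.trans hr2)
  have h2 := h.deriv2_bound ξ hξ.1.le (hξ.2.le.trans hr2)
  rw [← he, abs_mul, abs_of_pos hr']
  constructor
  · nlinarith
  · gcongr

theorem abs_sub_one_le (h : IsProfile a c M δ η f f₁ f₂) {r : ℝ} (hr : 0 ≤ r) (hr2 : r ≤ 2 * δ) :
    |f r - 1| ≤ M * r ^ 2 := by
  rcases hr.eq_or_lt with rfl | hr'
  · simp [h.zero]
  obtain ⟨ξ, hξ, he⟩ := exists_hasDerivAt_eq_slope f f₁ hr' h.continuous.continuousOn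
    (fun x hx => h.hasDerivAt x)
  rw [h.zero, sub_zero, eq_div_iff hr'.ne'] at he
  have h2 := (h.deriv_bounds hξ.1.le (hξ.2.le.trans hr2)).2
  have h3 := h.one_le_M
  rw [← he, abs_mul, abs_of_pos hr']
  calc |f₁ ξ| * r ≤ M * ξ * r := by gcongr
    _ ≤ M * r * r := by gcongr; exact hξ.2.le
    _ = _ := by ring

theorem f_bounds (h : IsProfile a c M δ η f f₁ f₂) {r : ℝ} (hr : 0 ≤ r) (hr2 : r ≤ 2 * δ) :
    1 / 2 ≤ f r ∧ f r ≤ 2 := by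
  have h1 := abs_le.1 (h.abs_sub_one_le hr hr2)
  have h2 := (h.mul_sq_le hr hr2).2
  have h3 : 0 ≤ r ^ 2 := sq_nonneg r
  constructor <;> nlinarith

/-- Near the origin the phase velocity is one up to a quadratic error. -/
theorem velocity_near (h : IsProfile a c M δ η f f₁ f₂) {r : ℝ} (hr : 0 ≤ r) (hr2 : r ≤ 2 * δ) :
    |velocity f r - 1| ≤ (M + 1) * r ^ 2 ∧ 3 / 4 ≤ velocity f r ∧ velocity f r ≤ 5 / 4 := by
  have h1 := h.abs_sub_one_le hr hr2
  have h2 := h.velocity_sq r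
  have h3 := h.velocity_pos r
  have h4 := (h.mul_sq_le hr hr2).2
  have h5 : |velocity f r - 1| ≤ |velocity f r ^ 2 - 1| := by
    rw [show velocity f r ^ 2 - 1 = (velocity f r - 1) * (velocity f r + 1) by ring, abs_mul,
      abs_of_pos (by linarith : 0 < velocity f r + 1)]
    nlinarith [abs_nonneg (velocity f r - 1)]
  have h6 : |velocity f r ^ 2 - 1| ≤ (M + 1) * r ^ 2 := by
    rw [h2, show f r + r ^ 2 / 4 - 1 = (f r - 1) + r ^ 2 / 4 by ring]
    refine (abs_add_le _ _).trans ?_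
    rw [abs_of_nonneg (by positivity : 0 ≤ r ^ 2 / 4)]
    nlinarith [sq_nonneg r]
  have h7 := h5.trans h6
  have h8 := abs_le.1 h7
  exact ⟨h7, by linarith, by linarith⟩

theorem hasDerivAt_velocityDeriv (h : IsProfile a c M δ η f f₁ f₂) {r : ℝ} (hr : 0 ≤ r)
    (hr2 : r ≤ 2 * δ) :
    HasDerivAt (velocityDeriv f f₁) (velocityDeriv2 f f₁ f₂ r) r := by
  have h1 : HasDerivAt (fun r => f₁ r + r / 2) (f₂ r + 1 / 2) r :=
    (h.hasDerivAt_deriv r hr hr2).add ((hasDerivAt_id r).div_const 2)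
  have h3 := (h.velocity_pos r).ne'
  refine (h1.div ((h.hasDerivAt_velocity r).const_mul 2) (by positivity)).congr_deriv ?_
  unfold velocityDeriv2
  field_simp
  ring

/-- Bounds for the derivatives of the phase velocity. The last one says that the dispersion relation
has a positive second derivative; it comes from the convexity margin in `deriv2_lower`. -/
theorem velocityDeriv_bounds (h : IsProfile a c M δ η f f₁ f₂) {r : ℝ} (hr : 0 ≤ r)
    (hr2 : r ≤ 2 * δ) :
    0 ≤ velocityDeriv f f₁ r ∧ velocityDeriv f f₁ r ≤ (M + 1) * r ∧
      |velocityDeriv2 f f₁ f₂ r| ≤ 2 * (M + 1) ∧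
      (0 < r → 0 < 2 * velocityDeriv f f₁ r + r * velocityDeriv2 f f₁ f₂ r) := by
  obtain ⟨-, g1, g2⟩ := h.velocity_near hr hr2
  obtain ⟨d1, d2⟩ := h.deriv_bounds hr hr2
  have d2' := abs_le.1 d2
  have e1 := h.deriv2_lower r hr hr2
  have e2 := abs_le.1 (h.deriv2_bound r hr hr2)
  have hM := h.one_le_M
  have ha := h.a_pos
  have ha1 := h.a_le
  obtain ⟨hs, -⟩ := h.mul_sq_le hr hr2
  have har : 0 ≤ a * r := by positivity
  have n0 : 0 ≤ f₁ r + r / 2 := by nlinarith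
  have n1 : f₁ r + r / 2 ≤ (M + 1) * r := by nlinarith
  have g0 : 0 < velocity f r := by linarith
  have hsq : (f₁ r + r / 2) ^ 2 ≤ a / 4 := by
    calc (f₁ r + r / 2) ^ 2 ≤ ((M + 1) * r) ^ 2 := pow_le_pow_left₀ n0 n1 2
      _ = (M + 1) ^ 2 * r ^ 2 := by ring
      _ ≤ _ := hs
  have hcube : (3 / 4 : ℝ) ^ 3 ≤ velocity f r ^ 3 := pow_le_pow_left₀ (by norm_num) g1 3
  have t0 : 0 ≤ (f₁ r + r / 2) ^ 2 / (4 * velocity f r ^ 3) := by positivity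
  have t1 : (f₁ r + r / 2) ^ 2 / (4 * velocity f r ^ 3) ≤ a / 4 := by
    rw [div_le_iff₀ (by positivity)]
    nlinarith
  have s0 : a / (5 / 2) ≤ (f₂ r + 1 / 2) / (2 * velocity f r) := by
    apply div_le_div₀ <;> nlinarith
  have s1 : (f₂ r + 1 / 2) / (2 * velocity f r) ≤ M + 1 := by
    rw [div_le_iff₀ (by positivity)]
    nlinarith
  refine ⟨div_nonneg n0 (by positivity), ?_, ?_, fun hr0 => ?_⟩
  · unfold velocityDeriv
    rw [div_le_iff₀ (by positivity)]
    have : 0 ≤ (M + 1) * r := by positivity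
    nlinarith
  · unfold velocityDeriv2
    rw [abs_le]
    constructor <;> linarith
  · have : 0 ≤ velocityDeriv f f₁ r := div_nonneg n0 (by positivity)
    have : 0 < velocityDeriv2 f f₁ f₂ r := by
      unfold velocityDeriv2
      linarith
    positivity

/-- Near the origin the group velocity is one up to a quadratic error. -/
theorem dispDeriv_near (h : IsProfile a c M δ η f f₁ f₂) {r : ℝ} (hr : 0 ≤ r) (hr2 : r ≤ 2 * δ) :
    |dispDeriv f f₁ r - 1| ≤ 2 * (M + 1) * r ^ 2 ∧ 1 / 2 ≤ dispDeriv f f₁ r ∧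
      dispDeriv f f₁ r ≤ 2 := by
  obtain ⟨g0, g1, g2⟩ := h.velocity_near hr hr2
  obtain ⟨v0, v1, -, -⟩ := h.velocityDeriv_bounds hr hr2
  have h4 := (h.mul_sq_le hr hr2).2
  have e : dispDeriv f f₁ r = velocity f r + r * velocityDeriv f f₁ r := h.dispDeriv_eq r
  have g0' := abs_le.1 g0
  have m0 : 0 ≤ r * velocityDeriv f f₁ r := mul_nonneg hr v0
  have m1 : r * velocityDeriv f f₁ r ≤ (M + 1) * r ^ 2 := by nlinarith
  rw [e]
  refine ⟨?_, by linarith, by linarith⟩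
  rw [abs_le]
  constructor <;> nlinarith [sq_nonneg r]

theorem hasDerivAt_dispDeriv (h : IsProfile a c M δ η f f₁ f₂) {r : ℝ} (hr : 0 ≤ r)
    (hr2 : r ≤ 2 * δ) :
    HasDerivAt (dispDeriv f f₁) (2 * velocityDeriv f f₁ r + r * velocityDeriv2 f f₁ f₂ r) r := by
  have e : dispDeriv f f₁ = fun r => velocity f r + r * velocityDeriv f f₁ r :=
    funext h.dispDeriv_eq
  rw [e]
  refine ((h.hasDerivAt_velocity r).add
    ((hasDerivAt_id r).mul (h.hasDerivAt_velocityDeriv hr hr2))).congr_deriv ?_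
  simp only [id, one_mul]
  unfold velocityDeriv
  ring

/-- Near the origin the dispersion relation is bi-Lipschitz. -/
theorem disp_sub_bounds (h : IsProfile a c M δ η f f₁ f₂) {x y : ℝ} (hx : 0 ≤ x) (hxy : x ≤ y)
    (hy : y ≤ 2 * δ) :
    1 / 2 * (y - x) ≤ disp f y - disp f x ∧ disp f y - disp f x ≤ 2 * (y - x) := by
  rcases hxy.eq_or_lt with rfl | hxy'
  · simp
  obtain ⟨ξ, hξ, he⟩ := exists_hasDerivAt_eq_slope (disp f) (dispDeriv f f₁) hxy'
    h.continuous_disp.continuousOn (fun x _ => h.hasDerivAt_disp x)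
  rw [eq_div_iff (by linarith)] at he
  obtain ⟨-, h1, h2⟩ := h.dispDeriv_near (by linarith [hξ.1] : 0 ≤ ξ) (by linarith [hξ.2])
  rw [← he]
  constructor <;> gcongr

theorem disp_abs_sub_bounds (h : IsProfile a c M δ η f f₁ f₂) {x y : ℝ} (hx : 0 ≤ x)
    (hx2 : x ≤ 2 * δ) (hy0 : 0 ≤ y) (hy : y ≤ 2 * δ) :
    1 / 2 * |y - x| ≤ |disp f y - disp f x| ∧ |disp f y - disp f x| ≤ 2 * |y - x| := by
  rcases le_total x y with hxy | hxy
  · obtain ⟨h1, h2⟩ := h.disp_sub_bounds hx hxy hy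
    rw [abs_of_nonneg (by linarith), abs_of_nonneg (by linarith)]
    exact ⟨h1, h2⟩
  · obtain ⟨h1, h2⟩ := h.disp_sub_bounds hy0 hxy hx2
    rw [abs_of_nonpos (by linarith), abs_of_nonpos (by linarith)]
    exact ⟨by linarith, by linarith⟩

theorem disp_zero : disp f 0 = 0 := by simp [disp]

theorem disp_bounds (h : IsProfile a c M δ η f f₁ f₂) {x : ℝ} (hx : 0 ≤ x) (hx2 : x ≤ 2 * δ) :
    3 / 4 * x ≤ disp f x ∧ disp f x ≤ 5 / 4 * x := by
  obtain ⟨-, g1, g2⟩ := h.velocity_near hx hx2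
  unfold disp
  constructor <;> nlinarith

/-- The dispersion relation is strictly superadditive near the origin, as it is convex there. -/
theorem disp_superadditive (h : IsProfile a c M δ η f f₁ f₂) {κ r : ℝ} (hκ : 0 < κ) (hr : 0 < r)
    (hs : r + κ ≤ 2 * δ) :
    0 < disp f (r + κ) - disp f r - disp f κ ∧
      disp f (r + κ) - disp f r - disp f κ ≤ 4 * (M + 1) * (r * κ * (r + κ)) := by
  obtain ⟨ξ, hξ, he⟩ := exists_second_difference hr hκ (H := disp f)
    (fun x _ => h.hasDerivAt_disp x)
    (fun x hx => h.hasDerivAt_dispDeriv hx.1 (hx.2.trans hs)) disp_zero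
  obtain ⟨v0, v1, v2, v3⟩ := h.velocityDeriv_bounds hξ.1.le (hξ.2.le.trans hs)
  have hM := h.one_le_M
  have hb : 2 * velocityDeriv f f₁ ξ + ξ * velocityDeriv2 f f₁ f₂ ξ ≤ 4 * (M + 1) * (r + κ) := by
    have h1 := (abs_le.1 v2).2
    have h2 : ξ * velocityDeriv2 f f₁ f₂ ξ ≤ ξ * (2 * (M + 1)) :=
      mul_le_mul_of_nonneg_left h1 hξ.1.le
    have h3 : (M + 1) * ξ ≤ (M + 1) * (r + κ) := by gcongr; exact hξ.2.le
    linarith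
  rw [he]
  have hrk : 0 < r * κ := by positivity
  refine ⟨mul_pos hrk (v3 hξ.1), ?_⟩
  calc r * κ * (2 * velocityDeriv f f₁ ξ + ξ * velocityDeriv2 f f₁ f₂ ξ)
      ≤ r * κ * (4 * (M + 1) * (r + κ)) := by gcongr
    _ = _ := by ring

/-- For small momenta there is a solution of the energy balance in the interior of the range of
`|k - p|`. -/
theorem exists_onShell (h : IsProfile a c M δ η f f₁ f₂) {κ r : ℝ} (hκ : 0 < κ) (hr : 0 < r)
    (hs : r + κ ≤ 2 * δ) :
    ∃ u ∈ Set.Ioo |r - κ| (r + κ), disp f u = disp f r + disp f κ := by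
  have h1 := (h.disp_superadditive hκ hr hs).1
  have h2 := h.disp_pos hκ
  have h3 := h.disp_pos hr
  have hle : |r - κ| ≤ r + κ := by rw [abs_le]; constructor <;> linarith
  have hlow : disp f |r - κ| < disp f r + disp f κ := by
    rcases le_total r κ with hrk | hrk
    · rw [abs_of_nonpos (by linarith)]
      have := (h.disp_sub_bounds (x := -(r - κ)) (y := κ) (by linarith) (by linarith)
        (by linarith)).1
      linarith
    · rw [abs_of_nonneg (by linarith)]
      have := (h.disp_sub_bounds (x := r - κ) (y := r) (by linarith) (by linarith)
        (by linarith)).1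
      linarith
  obtain ⟨u, hu, he⟩ := intermediate_value_Ioo hle h.continuous_disp.continuousOn
    (show disp f r + disp f κ ∈ Set.Ioo (disp f |r - κ|) (disp f (r + κ)) from
      ⟨hlow, by linarith⟩)
  exact ⟨u, hu, he⟩

/-- On the energy shell `u` is close to its maximum `r + κ`, that is, the momenta are nearly
collinear: since the dispersion relation is linear up to a cubic error, the defect `r + κ - u` is of
third order. -/
theorem onShell_near (h : IsProfile a c M δ η f f₁ f₂) {κ r u : ℝ} (hκ : 0 < κ) (hr : 0 < r)
    (hs : r + κ ≤ 2 * δ) (hu : u ∈ Set.Ioo |r - κ| (r + κ))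
    (he : disp f u = disp f r + disp f κ) :
    r + κ - u ≤ 8 * (M + 1) * (r * κ * (r + κ)) ∧ r + κ ≤ 2 * u := by
  have hu0 : 0 < u := (abs_nonneg _).trans_lt hu.1
  have hM := h.one_le_M
  have h1 := (h.disp_superadditive hκ hr hs).2
  have h2 := (h.disp_sub_bounds hu0.le hu.2.le hs).1
  have h3 : r + κ - u ≤ 8 * (M + 1) * (r * κ * (r + κ)) := by linarith
  refine ⟨h3, ?_⟩
  have h4 := (h.mul_sq_le (r := r + κ) (by positivity) hs).2
  have h5 : r * κ ≤ (r + κ) ^ 2 / 4 := by nlinarith [sq_nonneg (r - κ)]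
  have h6 : 8 * (M + 1) * (r * κ * (r + κ)) ≤ 8 * (M + 1) * ((r + κ) ^ 2 / 4 * (r + κ)) := by
    gcongr
  nlinarith

end IsProfile

/-- Relative errors proportional to a small parameter `t` multiply to such an error. -/
theorem near_mul {x y A B t : ℝ} (hA : 0 ≤ A) (hB : 0 ≤ B) (ht0 : 0 ≤ t) (ht : t ≤ 1)
    (hx : |x - 1| ≤ A * t) (hy : |y - 1| ≤ B * t) : |x * y - 1| ≤ (A + B + A * B) * t := by
  have e : x * y - 1 = (x - 1) + (y - 1) + (x - 1) * (y - 1) := by ring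
  rw [e]
  have h1 := abs_add_le ((x - 1) + (y - 1)) ((x - 1) * (y - 1))
  have h2 := abs_add_le (x - 1) (y - 1)
  rw [abs_mul] at h1
  have h3 : |x - 1| * |y - 1| ≤ (A * t) * (B * t) :=
    mul_le_mul hx hy (abs_nonneg _) (by positivity)
  have h4 : A * t * (B * t) ≤ A * B * t := by
    have : 0 ≤ A * B * t := by positivity
    nlinarith
  linarith

/-- Relative errors proportional to a small parameter `t` are stable under inversion. -/
theorem near_inv {x A t : ℝ} (hx1 : 1 / 2 ≤ x) (hx : |x - 1| ≤ A * t) :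
    |x⁻¹ - 1| ≤ (2 * A) * t := by
  have hx0 : 0 < x := by linarith
  have e : x⁻¹ - 1 = (1 - x) * x⁻¹ := by field_simp
  rw [e, abs_mul, abs_sub_comm, abs_of_pos (inv_pos.2 hx0)]
  have h2 : x⁻¹ ≤ 2 := by
    rw [inv_le_comm₀ hx0 two_pos]; linarith
  have := abs_nonneg (x - 1)
  nlinarith

/-- The remainder of the cubic `r³ / √(f(r) + r²/4)` after its leading term `r³`. -/
noncomputable def cubicRem (f : ℝ → ℝ) (r : ℝ) : ℝ := r ^ 3 * ((velocity f r)⁻¹ - 1)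

namespace IsProfile

variable {a c M δ η : ℝ} {f f₁ f₂ : ℝ → ℝ}

/-- The inverse of the phase velocity, minus one, and its first two derivatives. -/
theorem invVelocity_bounds (h : IsProfile a c M δ η f f₁ f₂) {r : ℝ} (hr : 0 ≤ r)
    (hr2 : r ≤ 2 * δ) :
    |(velocity f r)⁻¹ - 1| ≤ 2 * (M + 1) * r ^ 2 ∧
    |-velocityDeriv f f₁ r / velocity f r ^ 2| ≤ 2 * (M + 1) * r ∧
    |-velocityDeriv2 f f₁ f₂ r / velocity f r ^ 2
      + 2 * velocityDeriv f f₁ r ^ 2 / velocity f r ^ 3| ≤ 5 * (M + 1) := by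
  obtain ⟨g0, g1, g2⟩ := h.velocity_near hr hr2
  obtain ⟨v0, v1, v2, -⟩ := h.velocityDeriv_bounds hr hr2
  have hM := h.one_le_M
  have hs := (h.mul_sq_le hr hr2).1
  have ha := h.a_le
  have gp : 0 < velocity f r := by linarith
  have gsq : (9 / 16 : ℝ) ≤ velocity f r ^ 2 := by nlinarith
  have gcb : (27 / 64 : ℝ) ≤ velocity f r ^ 3 := by nlinarith
  have hMr : 0 ≤ (M + 1) * r := by positivity
  refine ⟨near_inv (by linarith) g0, ?_, ?_⟩
  · rw [abs_div, abs_neg, abs_of_nonneg v0, abs_of_pos (by positivity : 0 < velocity f r ^ 2),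
      div_le_iff₀ (by positivity)]
    nlinarith
  · refine (abs_add_le _ _).trans ?_
    have t1 : |-velocityDeriv2 f f₁ f₂ r / velocity f r ^ 2| ≤ 4 * (M + 1) := by
      rw [abs_div, abs_neg, abs_of_pos (by positivity : 0 < velocity f r ^ 2),
        div_le_iff₀ (by positivity)]
      nlinarith
    have t2 : |2 * velocityDeriv f f₁ r ^ 2 / velocity f r ^ 3| ≤ M + 1 := by
      rw [abs_of_nonneg (by positivity), div_le_iff₀ (by positivity)]
      have : velocityDeriv f f₁ r ^ 2 ≤ (M + 1) ^ 2 * r ^ 2 := by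
        rw [← mul_pow]; exact pow_le_pow_left₀ v0 v1 2
      nlinarith
    linarith

theorem hasDerivAt_invVelocity (h : IsProfile a c M δ η f f₁ f₂) (r : ℝ) :
    HasDerivAt (fun r => (velocity f r)⁻¹ - 1) (-velocityDeriv f f₁ r / velocity f r ^ 2) r :=
  ((h.hasDerivAt_velocity r).inv (h.velocity_pos r).ne').sub_const 1

theorem hasDerivAt_invVelocityDeriv (h : IsProfile a c M δ η f f₁ f₂) {r : ℝ} (hr : 0 ≤ r)
    (hr2 : r ≤ 2 * δ) :
    HasDerivAt (fun r => -velocityDeriv f f₁ r / velocity f r ^ 2)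
      (-velocityDeriv2 f f₁ f₂ r / velocity f r ^ 2
      + 2 * velocityDeriv f f₁ r ^ 2 / velocity f r ^ 3) r := by
  have h3 := (h.velocity_pos r).ne'
  refine ((h.hasDerivAt_velocityDeriv hr hr2).neg.div ((h.hasDerivAt_velocity r).pow 2)
    (pow_ne_zero 2 h3)).congr_deriv ?_
  change (-velocityDeriv2 f f₁ f₂ r * velocity f r ^ 2 - -velocityDeriv f f₁ r *
    ((2 : ℕ) * velocity f r ^ (2 - 1) * velocityDeriv f f₁ r)) / (velocity f r ^ 2) ^ 2 = _
  field_simp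
  push_cast
  ring

theorem cubicRem_deriv (h : IsProfile a c M δ η f f₁ f₂) (r : ℝ) :
    HasDerivAt (cubicRem f) (3 * r ^ 2 * ((velocity f r)⁻¹ - 1)
      + r ^ 3 * (-velocityDeriv f f₁ r / velocity f r ^ 2)) r := by
  refine ((hasDerivAt_pow 3 r).mul (h.hasDerivAt_invVelocity r)).congr_deriv ?_
  push_cast
  ring

theorem cubicRem_deriv_bound (h : IsProfile a c M δ η f f₁ f₂) {r : ℝ} (hr : 0 ≤ r)
    (hr2 : r ≤ 2 * δ) :
    |3 * r ^ 2 * ((velocity f r)⁻¹ - 1) + r ^ 3 * (-velocityDeriv f f₁ r / velocity f r ^ 2)|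
      ≤ 8 * (M + 1) * r ^ 4 := by
  obtain ⟨k0, k1, -⟩ := h.invVelocity_bounds hr hr2
  refine (abs_add_le _ _).trans ?_
  rw [abs_mul (3 * r ^ 2), abs_mul (r ^ 3), abs_of_nonneg (by positivity : 0 ≤ 3 * r ^ 2),
    abs_of_nonneg (by positivity : 0 ≤ r ^ 3)]
  have e1 : 3 * r ^ 2 * |(velocity f r)⁻¹ - 1| ≤ 3 * r ^ 2 * (2 * (M + 1) * r ^ 2) := by gcongr
  have e2 : r ^ 3 * |-velocityDeriv f f₁ r / velocity f r ^ 2| ≤ r ^ 3 * (2 * (M + 1) * r) := by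
    gcongr
  nlinarith

/-- The second difference of the remainder is of fifth order, hence negligible against the second
difference `3 r κ (r + κ)` of the cube. -/
theorem cubicRem_second_difference (h : IsProfile a c M δ η f f₁ f₂) {κ r : ℝ} (hκ : 0 < κ)
    (hr : 0 < r) (hs : r + κ ≤ 2 * δ) :
    |cubicRem f (r + κ) - cubicRem f r - cubicRem f κ|
      ≤ 29 * (M + 1) * (r * κ * (r + κ) ^ 3) := by
  obtain ⟨ξ, hξ, he⟩ := exists_second_difference hr hκ (H := cubicRem f)
    (H₂ := fun r => 6 * r * ((velocity f r)⁻¹ - 1)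
      + 6 * r ^ 2 * (-velocityDeriv f f₁ r / velocity f r ^ 2)
      + r ^ 3 * (-velocityDeriv2 f f₁ f₂ r / velocity f r ^ 2
        + 2 * velocityDeriv f f₁ r ^ 2 / velocity f r ^ 3))
    (fun x _ => h.cubicRem_deriv x)
    (fun x hx => by
      refine (((((hasDerivAt_pow 2 x).const_mul 3).mul (h.hasDerivAt_invVelocity x)).add
        ((hasDerivAt_pow 3 x).mul
          (h.hasDerivAt_invVelocityDeriv hx.1 (hx.2.trans hs)))).congr_deriv ?_)
      push_cast
      ring) (by simp [cubicRem])
  obtain ⟨k0, k1, k2⟩ := h.invVelocity_bounds hξ.1.le (hξ.2.le.trans hs)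
  have hM := h.one_le_M
  rw [he, abs_mul, abs_of_pos (mul_pos hr hκ)]
  have hξ0 := hξ.1
  have hb : |6 * ξ * ((velocity f ξ)⁻¹ - 1)
      + 6 * ξ ^ 2 * (-velocityDeriv f f₁ ξ / velocity f ξ ^ 2)
      + ξ ^ 3 * (-velocityDeriv2 f f₁ f₂ ξ / velocity f ξ ^ 2
        + 2 * velocityDeriv f f₁ ξ ^ 2 / velocity f ξ ^ 3)| ≤ 29 * (M + 1) * ξ ^ 3 := by
    refine (abs_add_three _ _ _).trans ?_
    rw [abs_mul (6 * ξ), abs_mul (6 * ξ ^ 2), abs_mul (ξ ^ 3), abs_of_pos (by positivity : 0 < 6 * ξ),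
      abs_of_pos (by positivity : 0 < 6 * ξ ^ 2), abs_of_pos (by positivity : 0 < ξ ^ 3)]
    calc _ ≤ 6 * ξ * (2 * (M + 1) * ξ ^ 2) + 6 * ξ ^ 2 * (2 * (M + 1) * ξ)
          + ξ ^ 3 * (5 * (M + 1)) := by gcongr
      _ = _ := by ring
  have hb2 : 29 * (M + 1) * ξ ^ 3 ≤ 29 * (M + 1) * (r + κ) ^ 3 := by
    have := pow_le_pow_left₀ hξ0.le hξ.2.le 3
    gcongr
  calc r * κ * _ ≤ r * κ * (29 * (M + 1) * (r + κ) ^ 3) := by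
        gcongr
        exact hb.trans hb2
    _ = _ := by ring

/-- Near the origin `f` is positive, and the absolute value in the coherence factor disappears. -/
theorem coherence_eq (h : IsProfile a c M δ η f f₁ f₂) {r : ℝ} (hr : 0 < r)
    (hr2 : r ≤ 2 * δ) : coherence f r = r / (2 * velocity f r) := by
  have h1 := (h.f_bounds hr.le hr2).1
  have h2 := h.velocity_pos r
  unfold coherence disp
  rw [abs_of_nonneg (by linarith)]
  field_simp
  ring

/-- The term `f q` of the vertex sum is half the energy minus a cubic term. On the energy shell the
energies cancel in the vertex sum, and only the cubic terms remain. -/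
theorem mul_coherence_eq (h : IsProfile a c M δ η f f₁ f₂) {r : ℝ} (hr : 0 < r)
    (hr2 : r ≤ 2 * δ) :
    f r * coherence f r = disp f r / 2 - (r ^ 3 + cubicRem f r) / 8 := by
  have h2 := h.velocity_pos r
  have h3 := h.velocity_sq r
  rw [h.coherence_eq hr hr2]
  unfold disp cubicRem
  field_simp
  linear_combination (-8 : ℝ) * h3

theorem near_sq_le_one (h : IsProfile a c M δ η f f₁ f₂) {κ r : ℝ} (hκ : 0 < κ) (hr : 0 < r)
    (hs : r + κ ≤ 2 * δ) : (r + κ) ^ 2 ≤ 1 := by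
  have h1 := h.δ_le
  nlinarith

/-- On the energy shell, where `u` is almost `r + κ`, the second difference `u³ - r³ - κ³` is almost
`3 κ r u`, also with the remainders of the cubic terms included. -/
theorem cubic_difference_onShell (h : IsProfile a c M δ η f f₁ f₂) {κ r u : ℝ} (hκ : 0 < κ)
    (hr : 0 < r) (hs : r + κ ≤ 2 * δ) (hu : u ∈ Set.Ioo |r - κ| (r + κ))
    (he : disp f u = disp f r + disp f κ) :
    |((u ^ 3 + cubicRem f u) - (r ^ 3 + cubicRem f r) - (κ ^ 3 + cubicRem f κ))
      / (3 * (κ * r * u)) - 1| ≤ 70 * (M + 1) * (r + κ) ^ 2 := by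
  have hu0 : 0 < u := (abs_nonneg _).trans_lt hu.1
  have hM := h.one_le_M
  obtain ⟨h1, h2⟩ := h.onShell_near hκ hr hs hu he
  have h3 := h.cubicRem_second_difference hκ hr hs
  have hus := hu.2
  set s := r + κ with hsdef
  have hs0 : 0 < s := by positivity
  have hs1 : s ^ 2 ≤ 1 := h.near_sq_le_one hκ hr hs
  set E := s - u with hE
  have hE0 : 0 ≤ E := by linarith
  have hcu : |cubicRem f s - cubicRem f u| ≤ 8 * (M + 1) * s ^ 4 * E := by
    obtain ⟨ξ, hξ, hξe⟩ := exists_hasDerivAt_eq_slope (cubicRem f) _ hus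
      (fun x _ => (h.cubicRem_deriv x).continuousAt.continuousWithinAt)
      (fun x _ => h.cubicRem_deriv x)
    rw [eq_div_iff (by linarith)] at hξe
    have hξ0 : 0 ≤ ξ := by linarith [hξ.1]
    have hb := h.cubicRem_deriv_bound hξ0 (hξ.2.le.trans hs)
    have hp : ξ ^ 4 ≤ s ^ 4 := pow_le_pow_left₀ hξ0 hξ.2.le 4
    rw [← hξe, abs_mul, abs_of_nonneg hE0]
    have : 8 * (M + 1) * ξ ^ 4 ≤ 8 * (M + 1) * s ^ 4 := by gcongr
    gcongr
    exact hb.trans this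
  have hkey : (u ^ 3 + cubicRem f u) - (r ^ 3 + cubicRem f r) - (κ ^ 3 + cubicRem f κ)
      - 3 * (κ * r * u) = (cubicRem f s - cubicRem f r - cubicRem f κ)
        - (cubicRem f s - cubicRem f u) + (3 * (κ * r) * E - E * (s ^ 2 + s * u + u ^ 2)) := by
    have : u = s - E := by rw [hE]; ring
    rw [this, hsdef]
    ring
  have hX : |(u ^ 3 + cubicRem f u) - (r ^ 3 + cubicRem f r) - (κ ^ 3 + cubicRem f κ)
      - 3 * (κ * r * u)| ≤ 105 * (M + 1) * (r * κ * s ^ 3) := by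
    rw [hkey]
    have t1 : |3 * (κ * r) * E - E * (s ^ 2 + s * u + u ^ 2)| ≤ 3 * s ^ 2 * E := by
      have a1 : 0 ≤ 3 * (κ * r) * E := by positivity
      have a2 : 0 ≤ E * (s ^ 2 + s * u + u ^ 2) := by positivity
      have a3 : 3 * (κ * r) * E ≤ 3 * s ^ 2 * E := by
        gcongr
        rw [hsdef]; nlinarith
      have a4 : E * (s ^ 2 + s * u + u ^ 2) ≤ 3 * s ^ 2 * E := by
        have : s ^ 2 + s * u + u ^ 2 ≤ 3 * s ^ 2 := by nlinarith
        nlinarith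
      rw [abs_le]
      constructor <;> linarith
    have t2 : 8 * (M + 1) * s ^ 4 * E ≤ 4 * s ^ 2 * E := by
      have := (h.mul_sq_le hs0.le hs).2
      have h4 : 8 * (M + 1) * s ^ 4 = 8 * ((M + 1) * s ^ 2) * s ^ 2 := by ring
      rw [h4]
      gcongr
      linarith
    have t3 : 7 * s ^ 2 * E ≤ 56 * (M + 1) * (r * κ * s ^ 3) := by
      calc 7 * s ^ 2 * E ≤ 7 * s ^ 2 * (8 * (M + 1) * (r * κ * s)) := by gcongr
        _ = _ := by ring
    have t4 := abs_add_le (cubicRem f s - cubicRem f r - cubicRem f κ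
        - (cubicRem f s - cubicRem f u)) (3 * (κ * r) * E - E * (s ^ 2 + s * u + u ^ 2))
    have t5 := abs_sub (cubicRem f s - cubicRem f r - cubicRem f κ) (cubicRem f s - cubicRem f u)
    have t6 : 0 ≤ (M + 1) * (r * κ * s ^ 3) := by positivity
    linarith
  have hpos : 0 < 3 * (κ * r * u) := by positivity
  rw [div_sub_one hpos.ne', abs_div, abs_of_pos hpos, div_le_iff₀ hpos]
  refine hX.trans ?_
  have : r * κ * s ^ 3 ≤ r * κ * (s ^ 2 * (2 * u)) := by
    rw [show s ^ 3 = s ^ 2 * s by ring]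
    gcongr
  have h6 : 0 ≤ M + 1 := by linarith
  calc 105 * (M + 1) * (r * κ * s ^ 3) ≤ 105 * (M + 1) * (r * κ * (s ^ 2 * (2 * u))) := by gcongr
    _ = _ := by ring

/-- The squared vertex on the energy shell, for small momenta. Both the difference of the cubic
terms and the product of the coherence factors contribute `3/8 κ r u` to the vertex sum, so that the
latter is almost `3/4 κ r u`; the coherence factors are almost `u/2`, `κ/2`, `r/2`. -/
theorem vertexSq_onShell (M : ℝ) (hM : 1 ≤ M) : ∃ C, 0 ≤ C ∧ ∀ (a c δ η : ℝ) (f f₁ f₂ : ℝ → ℝ),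
    IsProfile a c M δ η f f₁ f₂ → ∀ κ r u : ℝ, 0 < κ → 0 < r → r + κ ≤ 2 * δ →
    u ∈ Set.Ioo |r - κ| (r + κ) → disp f u = disp f r + disp f κ →
    |vertexSq f u κ r / (9 / 8 * (κ * r * u)) - 1| ≤ C * (r + κ) ^ 2 := by
  have hD : 0 ≤ M + 1 := by linarith
  set G := 2 * (M + 1) with hG
  set G2 := G + G + G * G with hG2
  set G3 := G2 + G + G2 * G with hG3
  set Y := G3 + M + G3 * M with hY
  set Z := 35 * (M + 1) + Y / 2 with hZ
  set Z2 := Z + Z + Z * Z with hZ2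
  set V := M + 1 with hV
  set V2 := V + V + V * V with hV2
  set V3 := V2 + V + V2 * V with hV3
  have hG0 : 0 ≤ G := by positivity
  have hV0 : 0 ≤ V := hD
  have hM0 : 0 ≤ M := by linarith
  refine ⟨Z2 + V3 + Z2 * V3, by positivity, ?_⟩
  intro a c δ η f f₁ f₂ h κ r u hκ hr hs hu he
  have hu0 : 0 < u := (abs_nonneg _).trans_lt hu.1
  have hu2 : u ≤ 2 * δ := hu.2.le.trans hs
  have hr2 : r ≤ 2 * δ := by linarith
  have hκ2 : κ ≤ 2 * δ := by linarith
  set t := (r + κ) ^ 2 with ht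
  have ht0 : 0 ≤ t := sq_nonneg _
  have ht1 : t ≤ 1 := h.near_sq_le_one hκ hr hs
  have sq_le : ∀ x, 0 < x → x ≤ r + κ → x ^ 2 ≤ t := fun x hx hxs => pow_le_pow_left₀ hx.le hxs 2
  have vel : ∀ x, 0 < x → x ≤ r + κ → |velocity f x - 1| ≤ V * t ∧ |(velocity f x)⁻¹ - 1| ≤ G * t
      ∧ |f x - 1| ≤ M * t := by
    intro x hx hxs
    have hx2 : x ≤ 2 * δ := hxs.trans hs
    have hq := sq_le x hx hxs
    refine ⟨(h.velocity_near hx.le hx2).1.trans (by gcongr),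
      (h.invVelocity_bounds hx.le hx2).1.trans (by gcongr),
      (h.abs_sub_one_le hx.le hx2).trans (by gcongr)⟩
  obtain ⟨gu, iu, fu⟩ := vel u hu0 hu.2.le
  obtain ⟨gr, ir, fr⟩ := vel r hr (by linarith)
  obtain ⟨gκ, iκ, fκ⟩ := vel κ hκ (by linarith)
  have hvu := h.velocity_pos u
  have hvr := h.velocity_pos r
  have hvκ := h.velocity_pos κ
  -- The first half of the vertex sum, from the cubic terms.
  have hX := h.cubic_difference_onShell hκ hr hs hu he
  set X := ((u ^ 3 + cubicRem f u) - (r ^ 3 + cubicRem f r) - (κ ^ 3 + cubicRem f κ))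
      / (3 * (κ * r * u)) with hXdef
  -- The second half, from the product of the coherence factors.
  have hf3 : |(f u + f κ + f r) / 3 - 1| ≤ M * t := by
    have e : (f u + f κ + f r) / 3 - 1 = ((f u - 1) + (f κ - 1) + (f r - 1)) / 3 := by ring
    rw [e, abs_div, abs_of_pos (by norm_num : (0 : ℝ) < 3), div_le_iff₀ (by norm_num)]
    have := abs_add_three (f u - 1) (f κ - 1) (f r - 1)
    linarith
  have hprod : |(velocity f u)⁻¹ * (velocity f κ)⁻¹ * (velocity f r)⁻¹ * ((f u + f κ + f r) / 3) - 1|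
      ≤ Y * t :=
    near_mul (by positivity) hM0 ht0 ht1 (near_mul (by positivity) hG0 ht0 ht1
      (near_mul hG0 hG0 ht0 ht1 iu iκ) ir) hf3
  set W := (velocity f u)⁻¹ * (velocity f κ)⁻¹ * (velocity f r)⁻¹ * ((f u + f κ + f r) / 3) with hW
  have hB : vertexSum f u κ r = 3 / 4 * (κ * r * u) * ((X + W) / 2) := by
    unfold vertexSum
    rw [h.mul_coherence_eq hκ hκ2, h.mul_coherence_eq hr hr2, h.mul_coherence_eq hu0 hu2,
      h.coherence_eq hκ hκ2, h.coherence_eq hr hr2, h.coherence_eq hu0 hu2, he, hXdef, hW]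
    field_simp
    ring
  have hXW : |(X + W) / 2 - 1| ≤ Z * t := by
    have e : (X + W) / 2 - 1 = ((X - 1) + (W - 1)) / 2 := by ring
    rw [e, abs_div, abs_of_pos (by norm_num : (0 : ℝ) < 2), div_le_iff₀ (by norm_num)]
    have := abs_add_le (X - 1) (W - 1)
    have e2 : Z * t * 2 = 70 * (M + 1) * t + Y * t := by rw [hZ]; ring
    linarith
  have hA : vertexSq f u κ r / (9 / 8 * (κ * r * u)) = ((X + W) / 2 * ((X + W) / 2))
      * (velocity f u * velocity f κ * velocity f r) := by
    unfold vertexSq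
    rw [hB, h.coherence_eq hκ hκ2, h.coherence_eq hr hr2, h.coherence_eq hu0 hu2]
    field_simp
    ring
  rw [hA]
  exact near_mul (by positivity) (by positivity) ht0 ht1
    (near_mul (by positivity) (by positivity) ht0 ht1 hXW hXW)
    (near_mul (by positivity) hV0 ht0 ht1 (near_mul hV0 hV0 ht0 ht1 gu gκ) gr)

/-- The integrand on the energy shell, with the Jacobian `1 / w'(u)` of the delta, in terms of the
energy `w(r)`: the measure `r u dr` and the vertex `9/8 κ r u` combine to `9/8 κ r² u² dr`, where
`r` is almost `w(r)`, `u` is almost `w(r) + κ`, and `dr` is almost `w'(r) dr`. -/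
theorem jacobian_onShell (M : ℝ) (hM : 1 ≤ M) : ∃ C, 0 ≤ C ∧ ∀ (a c δ η : ℝ) (f f₁ f₂ : ℝ → ℝ),
    IsProfile a c M δ η f f₁ f₂ → ∀ κ r u : ℝ, 0 < κ → 0 < r → r + κ ≤ 2 * δ →
    u ∈ Set.Ioo |r - κ| (r + κ) → disp f u = disp f r + disp f κ →
    |vertexSq f u κ r * (r * u) / (9 / 8 * κ * (disp f r ^ 2 * (disp f r + κ) ^ 2) *
        (dispDeriv f f₁ u * dispDeriv f f₁ r)) - 1| ≤ C * (r + κ) ^ 2 := by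
  obtain ⟨C₀, hC₀, H⟩ := vertexSq_onShell M hM
  have hD : 0 ≤ M + 1 := by linarith
  set G := 2 * (M + 1) with hG
  set G2 := G + G + G * G with hG2
  set P := 2 * (18 * (M + 1)) with hP
  set P2 := P + P + P * P with hP2
  set J := 2 * (2 * (M + 1)) with hJ
  set J2 := J + J + J * J with hJ2
  set A := C₀ + G2 + C₀ * G2 with hA
  set A2 := A + P2 + A * P2 with hA2
  refine ⟨A2 + J2 + A2 * J2, by positivity, ?_⟩
  intro a c δ η f f₁ f₂ h κ r u hκ hr hs hu he
  have h0 := H a c δ η f f₁ f₂ h κ r u hκ hr hs hu he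
  have hu0 : 0 < u := (abs_nonneg _).trans_lt hu.1
  have hu2 : u ≤ 2 * δ := hu.2.le.trans hs
  have hr2 : r ≤ 2 * δ := by linarith
  obtain ⟨o1, o2⟩ := h.onShell_near hκ hr hs hu he
  have hus := hu.2
  set s := r + κ with hsdef
  set t := s ^ 2 with ht
  have hs0 : 0 < s := by positivity
  have ht0 : 0 ≤ t := sq_nonneg _
  have ht1 : t ≤ 1 := h.near_sq_le_one hκ hr hs
  have hrs : r ^ 2 ≤ t := pow_le_pow_left₀ hr.le (by linarith) 2
  have hus2 : u ^ 2 ≤ t := pow_le_pow_left₀ hu0.le hus.le 2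
  have g1 : |(velocity f r)⁻¹ - 1| ≤ G * t :=
    (h.invVelocity_bounds hr.le hr2).1.trans (by gcongr)
  obtain ⟨ju, ju1, -⟩ := h.dispDeriv_near hu0.le hu2
  obtain ⟨jr, jr1, -⟩ := h.dispDeriv_near hr.le hr2
  have ju' : |(dispDeriv f f₁ u)⁻¹ - 1| ≤ J * t :=
    near_inv ju1 (ju.trans (by gcongr))
  have jr' : |(dispDeriv f f₁ r)⁻¹ - 1| ≤ J * t :=
    near_inv jr1 (jr.trans (by gcongr))
  have hq : |(disp f r + κ) / u - 1| ≤ 18 * (M + 1) * t := by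
    rw [div_sub_one hu0.ne', abs_div, abs_of_pos hu0, div_le_iff₀ hu0]
    have e : disp f r + κ - u = r * (velocity f r - 1) + (s - u) := by
      rw [hsdef]; unfold disp; ring
    have e1 : |r * (velocity f r - 1)| ≤ (M + 1) * t * s := by
      rw [abs_mul, abs_of_pos hr, mul_comm]
      have := (h.velocity_near hr.le hr2).1
      have hrs' : r ≤ s := by linarith
      calc |velocity f r - 1| * r ≤ ((M + 1) * r ^ 2) * r := by gcongr
        _ ≤ (M + 1) * t * s := by gcongr
    have e2 : |s - u| ≤ 8 * (M + 1) * t * s := by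
      rw [abs_of_nonneg (by linarith)]
      have : r * κ ≤ t := by rw [ht, hsdef]; nlinarith
      calc s - u ≤ 8 * (M + 1) * (r * κ * s) := o1
        _ ≤ 8 * (M + 1) * (t * s) := by gcongr
        _ = _ := by ring
    rw [e]
    have e3 := abs_add_le (r * (velocity f r - 1)) (s - u)
    have e4 : (M + 1) * t * s ≤ (M + 1) * t * (2 * u) := by gcongr
    linarith
  have hq1 : 1 / 2 ≤ (disp f r + κ) / u := by
    rw [le_div_iff₀ hu0]
    have := (h.disp_bounds hr.le hr2).1
    linarith
  have hq' : |((disp f r + κ) / u)⁻¹ - 1| ≤ P * t := near_inv hq1 hq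
  have hfac : vertexSq f u κ r * (r * u) / (9 / 8 * κ * (disp f r ^ 2 * (disp f r + κ) ^ 2) *
        (dispDeriv f f₁ u * dispDeriv f f₁ r))
      = vertexSq f u κ r / (9 / 8 * (κ * r * u)) * ((velocity f r)⁻¹ * (velocity f r)⁻¹)
        * (((disp f r + κ) / u)⁻¹ * ((disp f r + κ) / u)⁻¹)
        * ((dispDeriv f f₁ u)⁻¹ * (dispDeriv f f₁ r)⁻¹) := by
    have n1 := h.velocity_pos r
    have n2 : 0 < disp f r + κ := by linarith [h.disp_pos hr]
    have n3 : dispDeriv f f₁ u ≠ 0 := by linarith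
    have n4 : dispDeriv f f₁ r ≠ 0 := by linarith
    have n5 : disp f r = r * velocity f r := rfl
    have e1 : disp f r ^ 2 = r ^ 2 * velocity f r ^ 2 := by rw [n5]; ring
    rw [e1]
    field_simp
  rw [hfac]
  exact near_mul (by positivity) (by positivity) ht0 ht1 (near_mul (by positivity) (by positivity)
    ht0 ht1 (near_mul hC₀ (by positivity) ht0 ht1 h0 (near_mul (by positivity) (by positivity)
    ht0 ht1 g1 g1)) (near_mul (by positivity) (by positivity) ht0 ht1 hq' hq'))
    (near_mul (by positivity) (by positivity) ht0 ht1 ju' jr')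

end IsProfile

/-! ### Bounds for the vertex and the thermal factor -/

namespace IsProfile

variable {a c M δ η : ℝ} {f f₁ f₂ : ℝ → ℝ}

/-- The function `r²/2 + f(r)`, whose square is `ω² + f²` in units in which `ν = 1`, dominates `f`.
-/
theorem abs_lt_energy (h : IsProfile a c M δ η f f₁ f₂) {r : ℝ} (hr : 0 < r) :
    |f r| < r ^ 2 / 2 + f r := by
  have h1 := h.arg_pos r
  apply abs_lt_of_sq_lt_sq
  · nlinarith [pow_pos hr 2]
  · nlinarith [pow_pos hr 2]

theorem disp_sq (h : IsProfile a c M δ η f f₁ f₂) (r : ℝ) :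
    disp f r ^ 2 = (r ^ 2 / 2 + f r) ^ 2 - |f r| ^ 2 := by
  unfold disp
  rw [mul_pow, h.velocity_sq, sq_abs]
  ring

theorem coherence_pos (h : IsProfile a c M δ η f f₁ f₂) {r : ℝ} (hr : 0 < r) :
    0 < coherence f r :=
  div_pos (sub_pos.2 (h.abs_lt_energy hr)) (h.disp_pos hr)

theorem coherence_le_one (h : IsProfile a c M δ η f f₁ f₂) {r : ℝ} (hr : 0 < r) :
    coherence f r ≤ 1 := by
  have h1 := h.abs_lt_energy hr
  have h2 := h.disp_sq r
  have h3 := h.disp_pos hr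
  unfold coherence
  rw [div_le_one h3]
  apply le_of_sq_le_sq _ h3.le
  rw [h2]
  nlinarith [abs_nonneg (f r)]

/-- The inverse of the coherence factor, which is the square of `c + s`. -/
theorem inv_coherence (h : IsProfile a c M δ η f f₁ f₂) {r : ℝ} (hr : 0 < r) :
    (coherence f r)⁻¹ = (r ^ 2 / 2 + f r + |f r|) / disp f r := by
  have h1 := h.abs_lt_energy hr
  have h2 := h.disp_sq r
  have h3 := h.disp_pos hr
  have h4 : r ^ 2 / 2 + f r - |f r| ≠ 0 := by linarith
  unfold coherence
  rw [inv_div, div_eq_div_iff h4 h3.ne']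
  linear_combination h2

theorem vertexSq_nonneg (h : IsProfile a c M δ η f f₁ f₂) {u κ r : ℝ} (hu : 0 < u) (hκ : 0 < κ)
    (hr : 0 < r) : 0 ≤ vertexSq f u κ r := by
  have h1 := h.coherence_pos hu
  have h2 := h.coherence_pos hκ
  have h3 := h.coherence_pos hr
  unfold vertexSq
  positivity

theorem thermalRadial_nonneg (h : IsProfile a c M δ η f f₁ f₂) {b u κ r : ℝ} (hb : 0 < b)
    (hu : 0 < u) (hκ : 0 < κ) (hr : 0 < r) : 0 ≤ thermalRadial f b κ r u := by
  have key : ∀ x, 0 < x → 0 ≤ Real.exp (b * disp f x) - 1 := fun x hx => by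
    have := mul_pos hb (h.disp_pos hx)
    have := Real.add_one_le_exp (b * disp f x)
    linarith
  have h1 := key u hu
  have h2 := key κ hκ
  have h3 := key r hr
  unfold thermalRadial
  positivity

/-- On the energy shell the thermal factor is half the thermal weight, whose moments are the
functions `𝒢_n`. -/
theorem thermalRadial_onShell (h : IsProfile a c M δ η f f₁ f₂) {b u κ r : ℝ} (hb : 0 < b)
    (hκ : 0 < κ) (hr : 0 < r) (he : disp f u = disp f r + disp f κ) :
    thermalRadial f b κ r u = 1 / 2 * thermalWeight (b * disp f κ) (b * disp f r) := by
  have hA := mul_pos hb (h.disp_pos hκ)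
  have hX := mul_pos hb (h.disp_pos hr)
  unfold thermalRadial thermalWeight
  rw [he, show b / 2 * (disp f κ + (disp f r + disp f κ))
      = b * disp f κ / 2 + b * disp f κ / 2 + b * disp f r / 2 by ring,
    show b / 2 * disp f r = b * disp f r / 2 by ring,
    show b * (disp f r + disp f κ) = b * disp f r + b * disp f κ by ring]
  generalize b * disp f κ = A at *
  generalize b * disp f r = X at *
  have hp : 1 < Real.exp (A / 2) := Real.one_lt_exp_iff.2 (by linarith)
  have hq : 1 < Real.exp (X / 2) := Real.one_lt_exp_iff.2 (by linarith)
  have eA : Real.exp A = Real.exp (A / 2) ^ 2 := by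
    rw [← Real.exp_nat_mul]; congr 1; push_cast; ring
  have eX : Real.exp X = Real.exp (X / 2) ^ 2 := by
    rw [← Real.exp_nat_mul]; congr 1; push_cast; ring
  rw [Real.sinh_eq, Real.sinh_eq, Real.sinh_eq, add_div, neg_add, Real.exp_add (-(X / 2)),
    Real.exp_neg, Real.exp_neg, Real.exp_add, Real.exp_add, Real.exp_add, Real.exp_add, eA, eX]
  generalize Real.exp (A / 2) = p at *
  generalize Real.exp (X / 2) = q at *
  have hp0 : p ≠ 0 := by linarith
  have hq0 : q ≠ 0 := by linarith
  have n1 : p ^ 2 - 1 ≠ 0 := by nlinarith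
  have n2 : q ^ 2 - 1 ≠ 0 := by nlinarith
  have n3 : q ^ 2 * p ^ 2 - 1 ≠ 0 := by
    have : 1 < q ^ 2 * p ^ 2 := by
      rw [← mul_pow]
      exact one_lt_pow₀ (by nlinarith) two_ne_zero
    linarith
  have f1 : p - p⁻¹ = (p ^ 2 - 1) / p := by field_simp
  have f2 : q - q⁻¹ = (q ^ 2 - 1) / q := by field_simp
  have f3 : q * p - q⁻¹ * p⁻¹ = (q ^ 2 * p ^ 2 - 1) / (q * p) := by field_simp
  rw [f1, f2, f3]
  field_simp

theorem inv_exp_sub_one_le {x : ℝ} (hx : 0 < x) : (Real.exp x - 1)⁻¹ ≤ x⁻¹ := by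
  apply inv_anti₀ hx
  have := Real.add_one_le_exp x
  linarith

theorem abs_exp_sub_exp_le {x y B : ℝ} (hx : x ≤ B) (hy : y ≤ B) :
    |Real.exp x - Real.exp y| ≤ Real.exp B * |x - y| := by
  have key : ∀ x y : ℝ, y ≤ x → x ≤ B → |Real.exp x - Real.exp y| ≤ Real.exp B * |x - y| := by
    intro x y hyx hxB
    have h1 := Real.add_one_le_exp (y - x)
    have h2 : Real.exp y = Real.exp x * Real.exp (y - x) := by
      rw [← Real.exp_add]; ring_nf
    have h3 := Real.exp_le_exp.2 hxB
    have h4 := Real.exp_pos x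
    rw [abs_of_nonneg (sub_nonneg.2 (Real.exp_le_exp.2 hyx)), abs_of_nonneg (by linarith)]
    calc Real.exp x - Real.exp y = Real.exp x * (1 - Real.exp (y - x)) := by rw [h2]; ring
      _ ≤ Real.exp x * (x - y) := mul_le_mul_of_nonneg_left (by linarith) h4.le
      _ ≤ _ := by
        have : 0 ≤ x - y := by linarith
        gcongr
  rcases le_total y x with hxy | hxy
  · exact key x y hxy hx
  · rw [abs_sub_comm, abs_sub_comm x]
    exact key y x hxy hy

/-- Near the origin the vertex sum vanishes linearly in `r`, also off the energy shell, where the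
energies do not cancel. -/
theorem abs_vertexSum_le (h : IsProfile a c M δ η f f₁ f₂) {κ r u : ℝ} (hκ : 0 < κ)
    (hr : 0 < r) (hs : r + κ ≤ 2 * δ) (hu : u ∈ Set.Ioo |r - κ| (r + κ)) :
    |vertexSum f u κ r| ≤ 12 * r := by
  have hu0 : 0 < u := (abs_nonneg _).trans_lt hu.1
  have hu2 : u ≤ 2 * δ := hu.2.le.trans hs
  have hκ2 : κ ≤ 2 * δ := by linarith
  have hr2 : r ≤ 2 * δ := by linarith
  have hδ := h.δ_le
  have hM := h.one_le_M
  have hd : |κ - u| ≤ r := by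
    have h1 := (abs_lt.1 hu.1)
    have h2 := hu.2
    rw [abs_le]; constructor <;> linarith
  -- The product of `f` and the coherence factor is Lipschitz since it is a combination of the
  -- dispersion relation and a cubic term.
  have hdq : |f κ * coherence f κ - f u * coherence f u| ≤ 3 * r := by
    rw [h.mul_coherence_eq hκ hκ2, h.mul_coherence_eq hu0 hu2]
    have e1 := (h.disp_abs_sub_bounds hu0.le hu2 hκ.le hκ2).2
    have e2 : |κ ^ 3 - u ^ 3| ≤ 3 * |κ - u| := by
      rw [show κ ^ 3 - u ^ 3 = (κ ^ 2 + κ * u + u ^ 2) * (κ - u) by ring, abs_mul,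
        abs_of_pos (by positivity)]
      have : κ ^ 2 + κ * u + u ^ 2 ≤ 3 := by nlinarith
      gcongr
    have e3 : |cubicRem f κ - cubicRem f u| ≤ 4 * |κ - u| := by
      have key : ∀ x y, 0 < x → x < y → y ≤ 2 * δ → |cubicRem f y - cubicRem f x| ≤ 4 * |y - x| := by
        intro x y hx hxy hy
        obtain ⟨ξ, hξ, hξe⟩ := exists_hasDerivAt_eq_slope (cubicRem f) _ hxy
          (fun x _ => (h.cubicRem_deriv x).continuousAt.continuousWithinAt)
          (fun x _ => h.cubicRem_deriv x)
        rw [eq_div_iff (by linarith)] at hξe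
        have hξ0 : 0 ≤ ξ := by linarith [hξ.1]
        have hξ2 : ξ ≤ 2 * δ := hξ.2.le.trans hy
        have hb := h.cubicRem_deriv_bound hξ0 hξ2
        have hms := (h.mul_sq_le hξ0 hξ2).2
        have hξ1 : ξ ^ 2 ≤ 1 := by nlinarith
        have hb2 : 8 * (M + 1) * ξ ^ 4 ≤ 4 := by
          have : 8 * (M + 1) * ξ ^ 4 = 8 * ((M + 1) * ξ ^ 2) * ξ ^ 2 := by ring
          rw [this]
          nlinarith [sq_nonneg ξ]
        rw [← hξe, abs_mul]
        have := hb.trans hb2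
        gcongr
      rcases lt_trichotomy κ u with hlt | heq | hlt
      · rw [abs_sub_comm, abs_sub_comm κ]
        exact key κ u hκ hlt hu2
      · simp [heq]
      · exact key u κ hu0 hlt hκ2
    have e4 : disp f κ / 2 - (κ ^ 3 + cubicRem f κ) / 8 - (disp f u / 2 - (u ^ 3 + cubicRem f u) / 8)
        = (disp f κ - disp f u) / 2 - (κ ^ 3 - u ^ 3) / 8 - (cubicRem f κ - cubicRem f u) / 8 := by
      ring
    rw [e4]
    have b1 := abs_sub ((disp f κ - disp f u) / 2 - (κ ^ 3 - u ^ 3) / 8)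
      ((cubicRem f κ - cubicRem f u) / 8)
    have b2 := abs_sub ((disp f κ - disp f u) / 2) ((κ ^ 3 - u ^ 3) / 8)
    rw [abs_div _ (8 : ℝ), abs_of_pos (by norm_num : (0 : ℝ) < 8)] at b1
    rw [abs_div _ (8 : ℝ), abs_div _ (2 : ℝ), abs_of_pos (by norm_num : (0 : ℝ) < 8),
      abs_of_pos (by norm_num : (0 : ℝ) < 2)] at b2
    linarith
  have hqr : coherence f r ≤ r := by
    rw [h.coherence_eq hr hr2]
    have := (h.velocity_near hr.le hr2).2.1
    rw [div_le_iff₀ (by linarith)]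
    nlinarith
  have fu := h.f_bounds hu0.le hu2
  have fr := h.f_bounds hr.le hr2
  have fκ := h.f_bounds hκ.le hκ2
  have q1 := h.coherence_pos hu0
  have q2 := h.coherence_pos hκ
  have q3 := h.coherence_pos hr
  have q4 := h.coherence_le_one hu0
  have q5 := h.coherence_le_one hκ
  have t1 : 0 ≤ f r * coherence f r := mul_nonneg (by linarith) q3.le
  have t2 : f r * coherence f r ≤ 2 * r := mul_le_mul fr.2 hqr q3.le (by norm_num)
  have t3 : 0 ≤ coherence f u * coherence f κ * coherence f r * (f u + f κ + f r) :=
    mul_nonneg (by positivity) (by linarith)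
  have t4 : coherence f u * coherence f κ * coherence f r * (f u + f κ + f r) ≤ 1 * 1 * r * 6 := by
    have : 0 ≤ f u + f κ + f r := by linarith
    gcongr
    linarith
  have hd' := abs_le.1 hdq
  unfold vertexSum
  rw [abs_le]
  constructor <;> linarith

/-- The integrand is bounded near the origin, also off the energy shell: the squared vertex is of
order `r / (κ u)`, the numerator of the thermal factor of order `u²`, and its denominator of order
`κ r u`. -/
theorem exists_local_bound (h : IsProfile a c M δ η f f₁ f₂) {b κ : ℝ} (hb : 0 < b) (hκ : 0 < κ)
    (hκη : κ ≤ η) : ∃ K, 0 ≤ K ∧ ∀ r, 0 < r → r ≤ δ → ∀ u ∈ Set.Ioo |r - κ| (r + κ),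
      r * u * vertexSq f u κ r * thermalRadial f b κ r u ≤ K := by
  have hη := h.η_le
  have hδ := h.δ_le
  have hδ0 := h.δ_pos
  refine ⟨(Real.exp b * (2 * b)) ^ 2 * (b * (3 / 4 * κ))⁻¹ * (b * (3 / 4))⁻¹ * (b * (3 / 4))⁻¹
    * (1200 / κ), by positivity, ?_⟩
  intro r hr hrδ u hu
  have hs : r + κ ≤ 2 * δ := by linarith
  have hu0 : 0 < u := (abs_nonneg _).trans_lt hu.1
  have hu2 : u ≤ 2 * δ := hu.2.le.trans hs
  have hκ2 : κ ≤ 2 * δ := by linarith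
  have hr2 : r ≤ 2 * δ := by linarith
  have hB := h.abs_vertexSum_le hκ hr hs hu
  have vert : vertexSq f u κ r ≤ 1200 * r / (κ * u) := by
    have vel := fun x (hx : 0 < x) (hx2 : x ≤ 2 * δ) => (h.velocity_near hx.le hx2).2
    have ou := vel u hu0 hu2
    have or' := vel r hr hr2
    have oκ := vel κ hκ hκ2
    have hBsq : vertexSum f u κ r ^ 2 ≤ (12 * r) ^ 2 := by
      rw [← sq_abs]; exact pow_le_pow_left₀ (abs_nonneg _) hB 2
    have e : vertexSq f u κ r = vertexSum f u κ r ^ 2 *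
        (2 * (velocity f u * velocity f κ * velocity f r)) / (κ * u * r) := by
      have n1 := h.velocity_pos u
      have n2 := h.velocity_pos κ
      have n3 := h.velocity_pos r
      unfold vertexSq
      rw [h.coherence_eq hu0 hu2, h.coherence_eq hκ hκ2, h.coherence_eq hr hr2]
      field_simp
      norm_num
    have g3 : velocity f u * velocity f κ * velocity f r ≤ 5 / 4 * (5 / 4) * (5 / 4) := by
      have : 0 ≤ velocity f u := by linarith
      have : 0 ≤ velocity f κ := by linarith
      have : 0 ≤ velocity f r := by linarith
      gcongr <;> linarith
    rw [e, div_le_div_iff₀ (by positivity) (by positivity)]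
    have g4 : 0 ≤ velocity f u * velocity f κ * velocity f r :=
      mul_nonneg (mul_nonneg (by linarith) (by linarith)) (by linarith)
    have : vertexSum f u κ r ^ 2 * (2 * (velocity f u * velocity f κ * velocity f r))
        ≤ (12 * r) ^ 2 * (2 * (5 / 4 * (5 / 4) * (5 / 4))) := by gcongr
    calc _ ≤ (12 * r) ^ 2 * (2 * (5 / 4 * (5 / 4) * (5 / 4))) * (κ * u) := by gcongr
      _ ≤ _ := by
        have : 0 ≤ r ^ 2 * (κ * u) := by positivity
        nlinarith
  have therm : thermalRadial f b κ r u ≤ (Real.exp b * (2 * b)) ^ 2 * (b * (3 / 4 * κ))⁻¹ *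
      (b * (3 / 4))⁻¹ * (b * (3 / 4))⁻¹ * (u / r) := by
    have dκ := h.disp_bounds hκ.le hκ2
    have dr := h.disp_bounds hr.le hr2
    have du := h.disp_bounds hu0.le hu2
    have hnum : |Real.exp (b / 2 * (disp f κ + disp f u)) - Real.exp (b / 2 * disp f r)|
        ≤ Real.exp b * (2 * b) * u := by
      refine (abs_exp_sub_exp_le (B := b) ?_ ?_).trans ?_
      · nlinarith
      · nlinarith
      · rw [← mul_sub, abs_mul, abs_of_pos (by positivity : 0 < b / 2)]
        have e1 := (h.disp_abs_sub_bounds hr.le hr2 hκ.le hκ2).2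
        have e2 : |κ - r| ≤ u := by rw [abs_sub_comm]; exact hu.1.le
        have e3 : |disp f κ + disp f u - disp f r| ≤ 4 * u := by
          rw [show disp f κ + disp f u - disp f r = (disp f κ - disp f r) + disp f u by ring]
          refine (abs_add_le _ _).trans ?_
          rw [abs_of_pos (h.disp_pos hu0)]
          linarith
        calc Real.exp b * (b / 2 * |disp f κ + disp f u - disp f r|)
            ≤ Real.exp b * (b / 2 * (4 * u)) := by gcongr
          _ = _ := by ring
    have hnum2 : (Real.exp (b / 2 * (disp f κ + disp f u)) - Real.exp (b / 2 * disp f r)) ^ 2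
        ≤ (Real.exp b * (2 * b) * u) ^ 2 := by
      rw [← sq_abs]; exact pow_le_pow_left₀ (abs_nonneg _) hnum 2
    have den : ∀ x, 0 < x → 3 / 4 * x ≤ disp f x → 0 ≤ (Real.exp (b * disp f x) - 1)⁻¹ ∧
        (Real.exp (b * disp f x) - 1)⁻¹ ≤ (b * (3 / 4 * x))⁻¹ := by
      intro x hx hxd
      have hp : 0 < b * disp f x := mul_pos hb (h.disp_pos hx)
      refine ⟨inv_nonneg.2 ?_, (inv_exp_sub_one_le hp).trans ?_⟩
      · have := Real.add_one_le_exp (b * disp f x)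
        linarith
      · apply inv_anti₀ (by positivity)
        gcongr
    obtain ⟨p1, p2⟩ := den κ hκ dκ.1
    obtain ⟨p3, p4⟩ := den r hr dr.1
    obtain ⟨p5, p6⟩ := den u hu0 du.1
    unfold thermalRadial
    rw [div_eq_mul_inv, mul_inv, mul_inv]
    calc _ ≤ (Real.exp b * (2 * b) * u) ^ 2 * ((b * (3 / 4 * κ))⁻¹ * (b * (3 / 4 * r))⁻¹
          * (b * (3 / 4 * u))⁻¹) := by gcongr
      _ = _ := by field_simp
  have tn := h.thermalRadial_nonneg hb hu0 hκ hr
  have vn := h.vertexSq_nonneg hu0 hκ hr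
  calc r * u * vertexSq f u κ r * thermalRadial f b κ r u
      ≤ r * u * (1200 * r / (κ * u)) * ((Real.exp b * (2 * b)) ^ 2 * (b * (3 / 4 * κ))⁻¹ *
      (b * (3 / 4))⁻¹ * (b * (3 / 4))⁻¹ * (u / r)) := by gcongr
    _ = (Real.exp b * (2 * b)) ^ 2 * (b * (3 / 4 * κ))⁻¹ * (b * (3 / 4))⁻¹ * (b * (3 / 4))⁻¹
      * (1200 / κ) * (r * u) := by field_simp
    _ ≤ (Real.exp b * (2 * b)) ^ 2 * (b * (3 / 4 * κ))⁻¹ * (b * (3 / 4))⁻¹ * (b * (3 / 4))⁻¹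
      * (1200 / κ) * 1 := by
        gcongr
        nlinarith
    _ = _ := mul_one _

/-! ### Bounds away from the origin -/

/-- Away from the origin the inverse of the coherence factor grows at most quadratically. -/
theorem inv_coherence_le (h : IsProfile a c M δ η f f₁ f₂) {x R : ℝ} (hx : δ / 2 ≤ x)
    (hxR : x ≤ 2 * R) (hR : 1 ≤ R) : (coherence f x)⁻¹ ≤ (2 + 2 * M) * (2 / (c * δ)) * R ^ 2 := by
  have hδ := h.δ_pos
  have hc := h.c_pos
  have hx0 : 0 < x := by linarith
  have hM := h.one_le_M
  rw [h.inv_coherence hx0, div_eq_mul_inv]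
  have h1 := h.le_disp hx0.le
  have hb := h.bound x
  have hfb := (abs_le.1 hb).2
  have hnum : x ^ 2 / 2 + f x + |f x| ≤ (2 + 2 * M) * R ^ 2 := by
    have : x ^ 2 ≤ (2 * R) ^ 2 := pow_le_pow_left₀ hx0.le hxR 2
    have : 1 ≤ R ^ 2 := one_le_pow₀ hR
    nlinarith
  have hden : (disp f x)⁻¹ ≤ 2 / (c * δ) := by
    rw [show 2 / (c * δ) = (c * (δ / 2))⁻¹ by field_simp]
    apply inv_anti₀ (by positivity)
    exact le_trans (by gcongr) h1
  have : 0 ≤ (disp f x)⁻¹ := (inv_pos.2 (h.disp_pos hx0)).le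
  calc _ ≤ (2 + 2 * M) * R ^ 2 * (2 / (c * δ)) := by gcongr
    _ = _ := by ring

theorem inv_coherence_small (h : IsProfile a c M δ η f f₁ f₂) {κ : ℝ} (hκ : 0 < κ)
    (hκ2 : κ ≤ 2 * δ) : (coherence f κ)⁻¹ ≤ 3 / κ ∧ coherence f κ ≤ κ := by
  have h1 := (h.velocity_near hκ.le hκ2).2
  have h2 := h.velocity_pos κ
  rw [h.coherence_eq hκ hκ2, inv_div]
  constructor
  · gcongr; linarith
  · rw [div_le_iff₀ (by linarith)]; nlinarith

/-- The range of `|k - p|` when `|p|` is bounded below. -/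
theorem range_bounds (h : IsProfile a c M δ η f f₁ f₂) {κ r u : ℝ} (hκη : κ ≤ η)
    (hr : δ ≤ r) (hu : u ∈ Set.Icc (r - κ) (r + κ)) :
    δ / 2 ≤ u ∧ r / 2 ≤ u ∧ u ≤ 2 * (1 + r) ∧ r + u ≤ 3 * (1 + r) := by
  have h1 := h.η_le
  have h2 := h.δ_pos
  refine ⟨by linarith [hu.1], by linarith [hu.1], by linarith [hu.2], by linarith [hu.2]⟩

/-- Away from the origin the integrand decays exponentially, also off the energy shell, since the
energies at both large momenta are at least `c r / 2`. The constant may depend on the temperature and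
on `κ`: the bound serves only for dominated convergence. -/
theorem exists_crude_bound (h : IsProfile a c M δ η f f₁ f₂) {b κ : ℝ} (hb : 0 < b) (hκ : 0 < κ)
    (hκη : κ ≤ η) : ∃ K, 0 ≤ K ∧ ∀ r, δ ≤ r → ∀ u ∈ Set.Icc (r - κ) (r + κ),
      r * u * vertexSq f u κ r * thermalRadial f b κ r u
        ≤ K * ((1 + r) ^ 6 * Real.exp (-(b * c / 2 * r))) := by
  have hη := h.η_le
  have hδ0 := h.δ_pos
  have hc := h.c_pos
  have hM := h.one_le_M
  have hκ2 : κ ≤ 2 * δ := by linarith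
  set q := (2 + 2 * M) * (2 / (c * δ)) with hq
  have hq0 : 0 ≤ q := by positivity
  set A := b * disp f κ with hA
  have hA0 : 0 < A := mul_pos hb (h.disp_pos hκ)
  have hA1 : 0 < Real.exp A - 1 := by linarith [Real.add_one_le_exp A]
  -- A lower bound for both large energies, in units of the temperature; it keeps the Bose factors
  -- bounded.
  set Z₀ := b * c / 2 * δ with hZ₀
  have hZ0 : 0 < Z₀ := by positivity
  have hZ1 : 0 < 1 - Real.exp (-Z₀) := by
    have : Real.exp (-Z₀) < 1 := Real.exp_lt_one_iff.2 (by linarith)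
    linarith
  refine ⟨2 * ((6 * M) ^ 2 * (q * q * (3 / κ))) *
    ((Real.exp A + 1) * (Real.exp A - 1)⁻¹ * (1 - Real.exp (-Z₀))⁻¹ * (1 - Real.exp (-Z₀))⁻¹),
    by positivity, ?_⟩
  intro r hr u hu
  obtain ⟨u1, u2, u3, -⟩ := h.range_bounds hκη hr hu
  have hr0 : 0 < r := by linarith
  have hu0 : 0 < u := by linarith
  set R := 1 + r with hR
  have hR1 : 1 ≤ R := by linarith
  have vert : vertexSq f u κ r ≤ (6 * M) ^ 2 * (q * q * (3 / κ)) * R ^ 4 := by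
    have q1 := h.coherence_pos hu0
    have q2 := h.coherence_pos hκ
    have q3 := h.coherence_pos hr0
    have q4 := h.coherence_le_one hu0
    have q5 := h.coherence_le_one hκ
    have q6 := h.coherence_le_one hr0
    have i1 := h.inv_coherence_le u1 u3 hR1
    have i2 := (h.inv_coherence_small hκ hκ2).1
    have i3 := h.inv_coherence_le (x := r) (by linarith) (by linarith) hR1
    have hfq : ∀ x y, |f x| ≤ M → 0 < y → y ≤ 1 → |f x * y| ≤ M := by
      intro x y hx hy hy1
      rw [abs_mul, abs_of_pos hy]
      have := abs_nonneg (f x)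
      nlinarith
    have hB : |vertexSum f u κ r| ≤ 6 * M := by
      have t1 := hfq κ _ (h.bound κ) q2 q5
      have t2 := hfq r _ (h.bound r) q3 q6
      have t3 := hfq u _ (h.bound u) q1 q4
      have t4 : |coherence f u * coherence f κ * coherence f r * (f u + f κ + f r)| ≤ 3 * M := by
        rw [abs_mul, abs_of_pos (by positivity)]
        have s1 := abs_add_three (f u) (f κ) (f r)
        have s2 : coherence f u * coherence f κ * coherence f r ≤ 1 := by
          calc _ ≤ (1 : ℝ) * 1 * 1 := by gcongr
            _ = 1 := by norm_num
        have s3 := h.bound u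
        have s4 := h.bound κ
        have s5 := h.bound r
        calc _ ≤ 1 * (3 * M) := by
              gcongr
              linarith
          _ = _ := one_mul _
      unfold vertexSum
      rw [abs_le] at *
      constructor <;> linarith
    unfold vertexSq
    rw [div_eq_mul_inv, mul_inv, mul_inv, mul_inv]
    have hBsq : vertexSum f u κ r ^ 2 ≤ (6 * M) ^ 2 := by
      rw [← sq_abs]; exact pow_le_pow_left₀ (abs_nonneg _) hB 2
    have p1 := (inv_pos.2 q1).le
    have p2 := (inv_pos.2 q2).le
    have p3 := (inv_pos.2 q3).le
    calc _ ≤ (6 * M) ^ 2 * (1 * ((q * R ^ 2) * (3 / κ) * (q * R ^ 2))) := by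
          gcongr
          norm_num
      _ = _ := by ring
  have therm : thermalRadial f b κ r u ≤ ((Real.exp A + 1) * (Real.exp A - 1)⁻¹ *
      (1 - Real.exp (-Z₀))⁻¹ * (1 - Real.exp (-Z₀))⁻¹) * Real.exp (-(b * c / 2 * r)) := by
    set Z := b * c / 2 * r with hZ
    have hZZ : Z₀ ≤ Z := by rw [hZ, hZ₀]; gcongr
    set X := b * disp f r with hX
    set Y := b * disp f u with hY
    have hXZ : Z ≤ X := by
      have := h.le_disp hr0.le
      rw [hX, hZ, show b * c / 2 * r = b * (c * r / 2) by ring]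
      gcongr
      have : 0 < c * r := by positivity
      linarith
    have hYZ : Z ≤ Y := by
      have := h.le_disp hu0.le
      rw [hY, hZ, show b * c / 2 * r = b * (c * (r / 2)) by ring]
      gcongr
      exact le_trans (by gcongr) this
    have inv1 : ∀ W, Z ≤ W → 0 < Real.exp W - 1 ∧
        (Real.exp W - 1)⁻¹ ≤ (1 - Real.exp (-Z₀))⁻¹ * Real.exp (-Z) ∧
        Real.exp W * (Real.exp W - 1)⁻¹ ≤ (1 - Real.exp (-Z₀))⁻¹ := by
      intro W hW
      have e1 : Real.exp W - 1 = Real.exp W * (1 - Real.exp (-W)) := by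
        rw [mul_sub, ← Real.exp_add]; simp
      have e2 : 1 - Real.exp (-Z₀) ≤ 1 - Real.exp (-W) := by
        have : Real.exp (-W) ≤ Real.exp (-Z₀) := Real.exp_le_exp.2 (by linarith)
        linarith
      have e3 : 0 < 1 - Real.exp (-W) := by linarith
      have e4 : (1 - Real.exp (-W))⁻¹ ≤ (1 - Real.exp (-Z₀))⁻¹ := inv_anti₀ hZ1 e2
      refine ⟨by rw [e1]; positivity, ?_, ?_⟩
      · rw [e1, mul_inv, ← Real.exp_neg, mul_comm]
        gcongr
      · rw [e1, mul_inv, ← mul_assoc, mul_inv_cancel₀ (Real.exp_pos W).ne', one_mul]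
        exact e4
    obtain ⟨x1, x2, x3⟩ := inv1 X hXZ
    obtain ⟨y1, y2, y3⟩ := inv1 Y hYZ
    have hnum : (Real.exp (b / 2 * (disp f κ + disp f u)) - Real.exp (b / 2 * disp f r)) ^ 2
        ≤ Real.exp A * Real.exp Y + Real.exp X := by
      have e1 : Real.exp (b / 2 * (disp f κ + disp f u)) ^ 2 = Real.exp A * Real.exp Y := by
        rw [← Real.exp_nat_mul, ← Real.exp_add]; congr 1; rw [hA, hY]; push_cast; ring
      have e2 : Real.exp (b / 2 * disp f r) ^ 2 = Real.exp X := by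
        rw [← Real.exp_nat_mul]; congr 1; rw [hX]; push_cast; ring
      rw [← e1, ← e2]
      have := mul_pos (Real.exp_pos (b / 2 * (disp f κ + disp f u))) (Real.exp_pos (b / 2 * disp f r))
      nlinarith
    unfold thermalRadial
    rw [← hA, ← hX, ← hY, div_eq_mul_inv, mul_inv, mul_inv]
    have ix := (inv_pos.2 x1).le
    have iy := (inv_pos.2 y1).le
    have iA := (inv_pos.2 hA1).le
    have iZ := (inv_pos.2 hZ1).le
    calc _ ≤ (Real.exp A * Real.exp Y + Real.exp X) *
          ((Real.exp A - 1)⁻¹ * (Real.exp X - 1)⁻¹ * (Real.exp Y - 1)⁻¹) := by gcongr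
      _ = Real.exp A * (Real.exp A - 1)⁻¹ * ((Real.exp Y * (Real.exp Y - 1)⁻¹) * (Real.exp X - 1)⁻¹)
          + (Real.exp A - 1)⁻¹ * ((Real.exp X * (Real.exp X - 1)⁻¹) * (Real.exp Y - 1)⁻¹) := by ring
      _ ≤ Real.exp A * (Real.exp A - 1)⁻¹ * ((1 - Real.exp (-Z₀))⁻¹ *
            ((1 - Real.exp (-Z₀))⁻¹ * Real.exp (-Z)))
          + (Real.exp A - 1)⁻¹ * ((1 - Real.exp (-Z₀))⁻¹ *
            ((1 - Real.exp (-Z₀))⁻¹ * Real.exp (-Z))) := by gcongr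
      _ = _ := by ring
  have tn := h.thermalRadial_nonneg hb hu0 hκ hr0
  have vn := h.vertexSq_nonneg hu0 hκ hr0
  have iA := (inv_pos.2 hA1).le
  have iZ := (inv_pos.2 hZ1).le
  calc r * u * vertexSq f u κ r * thermalRadial f b κ r u
      ≤ R * (2 * R) * ((6 * M) ^ 2 * (q * q * (3 / κ)) * R ^ 4) *
        (((Real.exp A + 1) * (Real.exp A - 1)⁻¹ *
      (1 - Real.exp (-Z₀))⁻¹ * (1 - Real.exp (-Z₀))⁻¹) * Real.exp (-(b * c / 2 * r))) := by
        gcongr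
        linarith
    _ = _ := by ring

/-- Away from the origin, the energy balance forces the profile at the two large momenta to be
close to each other: the profile itself has no modulus of continuity at infinity, but the dispersion
relation determines it. -/
theorem abs_sub_le_onShell (h : IsProfile a c M δ η f f₁ f₂) {κ r u : ℝ} (hκ : 0 < κ) (hκη : κ ≤ η)
    (hr : δ ≤ r) (hu : u ∈ Set.Icc (r - κ) (r + κ)) (he : disp f u = disp f r + disp f κ) :
    |f u - f r| ≤ ((32 * (M + 2) + 12 * (M + 2) ^ 2) / δ ^ 2 + 1) * (κ * (1 + r) ^ 3) := by
  obtain ⟨u1, u2, u3, u4⟩ := h.range_bounds hκη hr hu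
  have hδ0 := h.δ_pos
  have hη := h.η_le
  have hM := h.one_le_M
  have hr0 : 0 < r := by linarith
  have hu0 : 0 < u := by linarith
  set R := 1 + r with hR
  have hR1 : 1 ≤ R := by linarith
  have vel : ∀ x, 0 < x → x ≤ 2 * R → velocity f x ≤ (M + 2) * R := by
    intro x hx hxR
    unfold velocity
    rw [Real.sqrt_le_iff]
    refine ⟨by positivity, ?_⟩
    have b1 := (abs_le.1 (h.bound x)).2
    have b2 : x ^ 2 ≤ (2 * R) ^ 2 := pow_le_pow_left₀ hx.le hxR 2
    have b3 : 1 ≤ R ^ 2 := one_le_pow₀ hR1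
    have b4 : M ≤ M * R ^ 2 := le_mul_of_one_le_right (by linarith) b3
    have b5 : 0 ≤ M ^ 2 * R ^ 2 := by positivity
    rw [mul_pow] at b2 ⊢
    nlinarith
  have vu := vel u hu0 u3
  have vr := vel r hr0 (by linarith)
  have vu0 := h.velocity_pos u
  have vr0 := h.velocity_pos r
  have dκ := h.disp_bounds hκ.le (by linarith)
  have e1 : (f u - f r) * u ^ 2 = disp f κ * (disp f u + disp f r)
      + (velocity f r ^ 2 + u ^ 2 / 4) * (r - u) * (r + u) := by
    have s1 : disp f u ^ 2 = u ^ 2 * (f u + u ^ 2 / 4) := by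
      unfold disp; rw [mul_pow, h.velocity_sq]
    have s2 : disp f r ^ 2 = r ^ 2 * velocity f r ^ 2 := by unfold disp; ring
    have s3 := h.velocity_sq r
    have s4 : disp f κ = disp f u - disp f r := by linarith
    rw [s4]
    rw [s3] at s2 ⊢
    linear_combination (-1 : ℝ) * s1 + s2
  have hru : |r - u| ≤ κ := by
    rw [abs_le]; constructor <;> linarith [hu.1, hu.2]
  have du : disp f u ≤ 2 * R * ((M + 2) * R) := mul_le_mul u3 vu vu0.le (by linarith)
  have dr : disp f r ≤ 2 * R * ((M + 2) * R) := mul_le_mul (by linarith) vr vr0.le (by linarith)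
  have du0 := h.disp_pos hu0
  have dr0 := h.disp_pos hr0
  have dκ0 := h.disp_pos hκ
  have b1 : |disp f κ * (disp f u + disp f r)| ≤ 8 * (M + 2) * (κ * R ^ 3) := by
    rw [abs_of_nonneg (by positivity)]
    calc disp f κ * (disp f u + disp f r) ≤ 2 * κ * (2 * R * ((M + 2) * R) + 2 * R * ((M + 2) * R)) := by
          gcongr; linarith
      _ = 8 * (M + 2) * (κ * R ^ 2) := by ring
      _ ≤ _ := by
        gcongr
        norm_num
  have b2 : |velocity f r ^ 2 + u ^ 2 / 4| ≤ (M + 2) ^ 2 * R ^ 2 := by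
    rw [abs_of_nonneg (by positivity), h.velocity_sq]
    have p1 := (abs_le.1 (h.bound r)).2
    have p2 : u ^ 2 ≤ (2 * R) ^ 2 := pow_le_pow_left₀ hu0.le u3 2
    have p3 : 1 ≤ R ^ 2 := one_le_pow₀ hR1
    have p4 : r ^ 2 ≤ R ^ 2 := pow_le_pow_left₀ hr0.le (by linarith) 2
    have p5 : M ≤ M * R ^ 2 := le_mul_of_one_le_right (by linarith) p3
    have p6 : 0 ≤ M ^ 2 * R ^ 2 := by positivity
    rw [mul_pow] at p2
    nlinarith
  have b3 : |(velocity f r ^ 2 + u ^ 2 / 4) * (r - u) * (r + u)| ≤ 3 * (M + 2) ^ 2 * (κ * R ^ 3) := by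
    rw [abs_mul, abs_mul, abs_of_pos (by linarith : 0 < r + u)]
    calc _ ≤ (M + 2) ^ 2 * R ^ 2 * κ * (3 * R) := by gcongr
      _ = _ := by ring
  have b4 : |f u - f r| * u ^ 2 ≤ (8 * (M + 2) + 3 * (M + 2) ^ 2) * (κ * R ^ 3) := by
    rw [← abs_of_nonneg (sq_nonneg u), ← abs_mul, e1]
    refine (abs_add_le _ _).trans ?_
    linarith
  have b5 : |f u - f r| * (δ / 2) ^ 2 ≤ |f u - f r| * u ^ 2 := by gcongr
  have b6 : |f u - f r| ≤ (32 * (M + 2) + 12 * (M + 2) ^ 2) / δ ^ 2 * (κ * R ^ 3) := by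
    rw [div_mul_eq_mul_div, le_div_iff₀ (by positivity)]
    nlinarith
  have : 0 ≤ κ * R ^ 3 := by positivity
  linarith

theorem abs_energy_sub_le (h : IsProfile a c M δ η f f₁ f₂) {x R : ℝ} (hx : 0 ≤ x)
    (hxR : x ≤ 2 * R) (hR : 1 ≤ R) : |(x ^ 2 / 2 + f x - |f x|)| ≤ (2 + 2 * M) * R ^ 2 := by
  have p2 : x ^ 2 ≤ (2 * R) ^ 2 := pow_le_pow_left₀ hx hxR 2
  have p3 : 1 ≤ R ^ 2 := one_le_pow₀ hR
  have p4 := abs_le.1 (h.bound x)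
  have p5 := abs_nonneg (f x)
  have p6 := h.bound x
  have hM := h.one_le_M
  have p7 : M ≤ M * R ^ 2 := le_mul_of_one_le_right (by linarith) p3
  rw [mul_pow] at p2
  rw [abs_le]
  constructor <;> linarith [sq_nonneg x]

/-- On the energy shell and away from the origin, the terms of the two large momenta in the vertex
sum cancel up to an error proportional to the small momentum. -/
theorem abs_mul_coherence_sub_le (h : IsProfile a c M δ η f f₁ f₂) {C₂ κ r u : ℝ} (hC₂0 : 0 ≤ C₂)
    (hκ : 0 < κ) (hκη : κ ≤ η) (hr : δ ≤ r) (hu : u ∈ Set.Icc (r - κ) (r + κ))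
    (he : disp f u = disp f r + disp f κ) (hf : |f u - f r| ≤ C₂ * (κ * (1 + r) ^ 3)) :
    |f r * coherence f r - f u * coherence f u| ≤
      ((C₂ * (2 + 2 * M) + M * (2 + 2 * C₂)) * (2 / (c * δ))
        + M * (2 + 2 * M) * 2 * (4 / (c * δ) ^ 2)) * (κ * (1 + r) ^ 5) := by
  obtain ⟨u1, u2, u3, u4⟩ := h.range_bounds hκη hr hu
  have hη := h.η_le
  have hM := h.one_le_M
  have hc := h.c_pos
  have hδ0 := h.δ_pos
  have hr0 : 0 < r := by linarith
  have hu0 : 0 < u := by linarith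
  have hκ2 : κ ≤ 2 * δ := by linarith
  set C₃ := C₂ * (2 + 2 * M) + M * (2 + 2 * C₂) with hC₃
  have hC₃0 : 0 ≤ C₃ := by positivity
  set R := 1 + r with hR
  have hR1 : 1 ≤ R := by linarith
  have hR0 : 0 ≤ R := by linarith
  have R35 : R ^ 3 ≤ R ^ 5 := pow_le_pow_right₀ hR1 (by norm_num)
  have R15 : R ≤ R ^ 5 := le_self_pow₀ hR1 (by norm_num)
  have R25 : R ^ 2 ≤ R ^ 5 := pow_le_pow_right₀ hR1 (by norm_num)
  set nu := f u * (u ^ 2 / 2 + f u - |f u|) with hnu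
  set nr := f r * (r ^ 2 / 2 + f r - |f r|) with hnr
  have bu := h.bound u
  have br := h.bound r
  have hru : |u - r| ≤ κ := by
    rw [abs_le]; constructor <;> linarith [hu.1, hu.2]
  have m1 := h.abs_energy_sub_le hu0.le u3 hR1
  have m2 : |(u ^ 2 - r ^ 2) / 2 + (f u - f r) - (|f u| - |f r|)|
      ≤ (2 + 2 * C₂) * (κ * R ^ 5) := by
    have p1 : |(u ^ 2 - r ^ 2) / 2| ≤ 2 * (κ * R ^ 5) := by
      rw [show (u ^ 2 - r ^ 2) / 2 = (u - r) * ((r + u) / 2) by ring, abs_mul,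
        abs_of_pos (by linarith : 0 < (r + u) / 2)]
      calc |u - r| * ((r + u) / 2) ≤ κ * (2 * R ^ 5) := by
            gcongr
            linarith
        _ = _ := by ring
    have p2 : |f u - f r| ≤ C₂ * (κ * R ^ 5) := hf.trans (by gcongr)
    have p3 : |(|f u| - |f r|)| ≤ C₂ * (κ * R ^ 5) := (abs_abs_sub_abs_le_abs_sub _ _).trans p2
    have p4 := abs_sub ((u ^ 2 - r ^ 2) / 2 + (f u - f r)) (|f u| - |f r|)
    have p5 := abs_add_le ((u ^ 2 - r ^ 2) / 2) (f u - f r)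
    linarith
  have m3 : |nu - nr| ≤ C₃ * (κ * R ^ 5) := by
    have e : nu - nr = (f u - f r) * (u ^ 2 / 2 + f u - |f u|)
        + f r * ((u ^ 2 - r ^ 2) / 2 + (f u - f r) - (|f u| - |f r|)) := by
      rw [hnu, hnr]; ring
    rw [e]
    refine (abs_add_le _ _).trans ?_
    rw [abs_mul, abs_mul]
    calc _ ≤ C₂ * (κ * R ^ 3) * ((2 + 2 * M) * R ^ 2) + M * ((2 + 2 * C₂) * (κ * R ^ 5)) := by
          gcongr
      _ = _ := by rw [hC₃]; ring
  have m4 : |nr| ≤ M * (2 + 2 * M) * R ^ 5 := by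
    rw [hnr, abs_mul]
    calc _ ≤ M * ((2 + 2 * M) * R ^ 2) := by
          gcongr
          exact h.abs_energy_sub_le hr0.le (by linarith) hR1
      _ ≤ M * ((2 + 2 * M) * R ^ 5) := by gcongr
      _ = _ := by ring
  have du0 := h.disp_pos hu0
  have dr0 := h.disp_pos hr0
  have dκ := h.disp_bounds hκ.le hκ2
  have iu : (disp f u)⁻¹ ≤ 2 / (c * δ) := by
    rw [show 2 / (c * δ) = (c * (δ / 2))⁻¹ by field_simp]
    exact inv_anti₀ (by positivity) (le_trans (by gcongr) (h.le_disp hu0.le))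
  have ir : (disp f r)⁻¹ ≤ 2 / (c * δ) := by
    rw [show 2 / (c * δ) = (c * (δ / 2))⁻¹ by field_simp]
    refine inv_anti₀ (by positivity) (le_trans ?_ (h.le_disp hr0.le))
    gcongr
    linarith
  have e : f r * coherence f r - f u * coherence f u
      = nr * (disp f κ) * ((disp f u)⁻¹ * (disp f r)⁻¹) - (nu - nr) * (disp f u)⁻¹ := by
    unfold coherence
    have : disp f κ = disp f u - disp f r := by linarith
    rw [this, hnu, hnr]
    field_simp
    ring
  rw [e]
  refine (abs_sub _ _).trans ?_
  rw [abs_mul, abs_mul, abs_mul (nu - nr), abs_of_pos (h.disp_pos hκ),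
    abs_of_pos (inv_pos.2 du0), abs_of_pos (mul_pos (inv_pos.2 du0) (inv_pos.2 dr0))]
  have dκ3 : disp f κ ≤ 2 * κ := by linarith
  have dκ4 := (h.disp_pos hκ).le
  have iu0 := (inv_pos.2 du0).le
  have ir0 := (inv_pos.2 dr0).le
  calc _ ≤ M * (2 + 2 * M) * R ^ 5 * (2 * κ) * (2 / (c * δ) * (2 / (c * δ)))
        + C₃ * (κ * R ^ 5) * (2 / (c * δ)) := by
        gcongr
    _ = _ := by ring

/-- The integrand on the energy shell, away from the origin, is at most linear in the small momentum
`κ`. The power `17` is made of `2` from the measure, `14` from the squared vertex and `1` from the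
Jacobian. -/
theorem exists_onShell_bound {a c M δ η : ℝ} (hc : 0 < c) (hδ0 : 0 < δ) (hM : 1 ≤ M) :
    ∃ C, 0 ≤ C ∧ ∀ (f f₁ f₂ : ℝ → ℝ), IsProfile a c M δ η f f₁ f₂ →
    ∀ b κ r u : ℝ, 0 < b → 0 < κ → κ ≤ η → δ ≤ r → u ∈ Set.Icc (r - κ) (r + κ) →
    disp f u = disp f r + disp f κ → c / (1 + u) ≤ |dispDeriv f f₁ u| →
    r * u * vertexSq f u κ r * thermalRadial f b κ r u / |dispDeriv f f₁ u|
      ≤ C * κ * ((1 + r) ^ 17 * thermalWeight (b * disp f κ) (b * disp f r)) := by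
  set C₂ := (32 * (M + 2) + 12 * (M + 2) ^ 2) / δ ^ 2 + 1 with hC₂
  set C₃ := C₂ * (2 + 2 * M) + M * (2 + 2 * C₂) with hC₃
  set C₄ := C₃ * (2 / (c * δ)) + M * (2 + 2 * M) * 2 * (4 / (c * δ) ^ 2) with hC₄
  set C₅ := C₄ + 4 * M with hC₅
  set q := (2 + 2 * M) * (2 / (c * δ)) with hq
  have hC₂0 : 0 ≤ C₂ := by positivity
  have hC₃0 : 0 ≤ C₃ := by positivity
  have hC₄0 : 0 ≤ C₄ := by positivity
  have hC₅0 : 0 ≤ C₅ := by positivity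
  have hq0 : 0 ≤ q := by positivity
  refine ⟨9 * C₅ ^ 2 * q ^ 2 / c, by positivity, ?_⟩
  intro f f₁ f₂ h b κ r u hb hκ hκη hr hu he hdisp
  obtain ⟨u1, u2, u3, u4⟩ := h.range_bounds hκη hr hu
  have hη := h.η_le
  have hr0 : 0 < r := by linarith
  have hu0 : 0 < u := by linarith
  have hκ2 : κ ≤ 2 * δ := by linarith
  have hf := h.abs_sub_le_onShell hκ hκη hr hu he
  rw [← hC₂] at hf
  rw [h.thermalRadial_onShell hb hκ hr0 he]
  have hS := thermalWeight_nonneg (mul_pos hb (h.disp_pos hκ)).le (mul_pos hb (h.disp_pos hr0))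
  set S := thermalWeight (b * disp f κ) (b * disp f r) with hSdef
  set R := 1 + r with hR
  have hR1 : 1 ≤ R := by linarith
  have hR0 : 0 ≤ R := by linarith
  have q1 := h.coherence_pos hu0
  have q2 := h.coherence_pos hκ
  have q3 := h.coherence_pos hr0
  have q4 := h.coherence_le_one hu0
  have q6 := h.coherence_le_one hr0
  have i1 := h.inv_coherence_le u1 u3 hR1
  obtain ⟨i2, q5⟩ := h.inv_coherence_small hκ hκ2
  have i3 := h.inv_coherence_le (x := r) (by linarith) (by linarith) hR1
  have R05 : 1 ≤ R ^ 5 := one_le_pow₀ hR1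
  -- The difference of the two terms with large momenta.
  have hdiff : |f r * coherence f r - f u * coherence f u| ≤ C₄ * (κ * R ^ 5) := by
    exact h.abs_mul_coherence_sub_le hC₂0 hκ hκη hr hu he hf
  have hB : |vertexSum f u κ r| ≤ C₅ * (κ * R ^ 5) := by
    have t1 : |f κ * coherence f κ| ≤ M * (κ * R ^ 5) := by
      rw [abs_mul, abs_of_pos q2]
      have := h.bound κ
      calc _ ≤ M * (κ * 1) := by
            gcongr
            linarith
        _ ≤ _ := by gcongr
    have t4 : |coherence f u * coherence f κ * coherence f r * (f u + f κ + f r)|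
        ≤ 3 * M * (κ * R ^ 5) := by
      rw [abs_mul, abs_of_pos (by positivity)]
      have s1 := abs_add_three (f u) (f κ) (f r)
      have s3 := h.bound u
      have s4 := h.bound κ
      have s5 := h.bound r
      calc _ ≤ 1 * κ * 1 * (3 * M) := by
            gcongr
            linarith
        _ = 3 * M * (κ * 1) := by ring
        _ ≤ _ := by gcongr
    have e : vertexSum f u κ r = f κ * coherence f κ + (f r * coherence f r - f u * coherence f u)
        + coherence f u * coherence f κ * coherence f r * (f u + f κ + f r) := by
      unfold vertexSum; ring
    rw [e, hC₅]
    refine (abs_add_three _ _ _).trans ?_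
    linarith
  have vert : vertexSq f u κ r ≤ C₅ ^ 2 * q ^ 2 * κ * R ^ 14 := by
    unfold vertexSq
    rw [div_eq_mul_inv, mul_inv, mul_inv, mul_inv]
    have hBsq : vertexSum f u κ r ^ 2 ≤ (C₅ * (κ * R ^ 5)) ^ 2 := by
      rw [← sq_abs]; exact pow_le_pow_left₀ (abs_nonneg _) hB 2
    have p1 := (inv_pos.2 q1).le
    have p2 := (inv_pos.2 q2).le
    have p3 := (inv_pos.2 q3).le
    calc _ ≤ (C₅ * (κ * R ^ 5)) ^ 2 * (1 / 3 * ((q * R ^ 2) * (3 / κ) * (q * R ^ 2))) := by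
          gcongr
          norm_num
      _ = _ := by field_simp
  have hd0 : 0 < c / (1 + u) := by positivity
  have hdinv : |dispDeriv f f₁ u|⁻¹ ≤ 3 * R / c := by
    refine (inv_anti₀ hd0 hdisp).trans ?_
    rw [inv_div]
    gcongr
    linarith
  have vn := h.vertexSq_nonneg hu0 hκ hr0
  have hi0 : 0 ≤ |dispDeriv f f₁ u|⁻¹ := by positivity
  rw [div_eq_mul_inv]
  calc _ ≤ R * (2 * R) * (C₅ ^ 2 * q ^ 2 * κ * R ^ 14) * (1 / 2 * S) * (3 * R / c) := by
        gcongr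
        linarith
    _ = 3 * C₅ ^ 2 * q ^ 2 / c * κ * (R ^ 17 * S) := by ring
    _ ≤ _ := by
      gcongr
      norm_num

end IsProfile

/-! ### The integral over the length of `k - p` -/

/-- The integrand in bipolar coordinates, without the energy balance. -/
noncomputable def radialIntegrand (f : ℝ → ℝ) (b κ r u : ℝ) : ℝ :=
  r * u * vertexSq f u κ r * thermalRadial f b κ r u

/-- The inner integral, over `u = |k - p|`, at fixed `r = |p|`. -/
noncomputable def innerIntegral (f : ℝ → ℝ) (b κ ε r : ℝ) : ℝ :=
  ∫ u in Set.Ioo |r - κ| (r + κ),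
    radialIntegrand f b κ r u * approxDelta ε (disp f u - (disp f r + disp f κ))

/-- The density which the inner integral approaches for small momenta. It is a multiple of
`w² (w + κ)² thermalWeight · dw`, where `w` is the energy at momentum `r`. -/
noncomputable def modelDensity (f f₁ : ℝ → ℝ) (b κ r : ℝ) : ℝ :=
  9 / 16 * κ * (disp f r ^ 2 * (disp f r + κ) ^ 2 *
    thermalWeight (b * disp f κ) (b * disp f r)) * dispDeriv f f₁ r

namespace IsProfile

variable {a c M δ η : ℝ} {f f₁ f₂ : ℝ → ℝ}

theorem measurable_coherence (h : IsProfile a c M δ η f f₁ f₂) : Measurable (coherence f) := by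
  have h1 := h.continuous.measurable
  have h2 := h.continuous_disp.measurable
  unfold coherence
  fun_prop

theorem measurable_radialIntegrand (h : IsProfile a c M δ η f f₁ f₂) (b κ : ℝ) :
    Measurable (Function.uncurry (radialIntegrand f b κ)) := by
  have h1 := h.continuous.measurable
  have h2 := h.continuous_disp.measurable
  have h3 := h.measurable_coherence
  unfold Function.uncurry radialIntegrand vertexSq vertexSum thermalRadial
  fun_prop

theorem radialIntegrand_nonneg (h : IsProfile a c M δ η f f₁ f₂) {b κ r u : ℝ} (hb : 0 < b)
    (hκ : 0 < κ) (hr : 0 < r) (hu : 0 < u) : 0 ≤ radialIntegrand f b κ r u := by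
  have := h.vertexSq_nonneg hu hκ hr
  have := h.thermalRadial_nonneg hb hu hκ hr
  unfold radialIntegrand
  positivity

theorem continuousAt_radialIntegrand (h : IsProfile a c M δ η f f₁ f₂) {b κ r u : ℝ} (hb : 0 < b)
    (hκ : 0 < κ) (hr : 0 < r) (hu : 0 < u) : ContinuousAt (radialIntegrand f b κ r) u := by
  have c1 : ContinuousAt f u := h.continuous.continuousAt
  have c2 : ContinuousAt (disp f) u := h.continuous_disp.continuousAt
  have d0 := (h.disp_pos hu).ne'
  have c3 : ContinuousAt (coherence f) u := by
    unfold coherence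
    exact ContinuousAt.div (by fun_prop) c2 d0
  have q1 := h.coherence_pos hu
  have q2 := h.coherence_pos hκ
  have q3 := h.coherence_pos hr
  have ex : ∀ x, 0 < x → 0 < Real.exp (b * disp f x) - 1 := fun x hx => by
    have := mul_pos hb (h.disp_pos hx)
    have := Real.add_one_le_exp (b * disp f x)
    linarith
  have e1 := ex u hu
  have e2 := ex κ hκ
  have e3 := ex r hr
  have c4 : ContinuousAt (fun u => vertexSq f u κ r) u := by
    unfold vertexSq vertexSum
    exact ContinuousAt.div (by fun_prop) (by fun_prop) (by positivity)
  have c5 : ContinuousAt (fun u => thermalRadial f b κ r u) u := by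
    unfold thermalRadial
    exact ContinuousAt.div (by fun_prop) (by fun_prop) (by positivity)
  unfold radialIntegrand
  fun_prop

/-- The limit of the inner integral at small momenta. -/
theorem exists_inner_limit_small (M : ℝ) (hM : 1 ≤ M) : ∃ C, 0 ≤ C ∧
    ∀ (a c δ η : ℝ) (f f₁ f₂ : ℝ → ℝ), IsProfile a c M δ η f f₁ f₂ →
    ∀ b κ r : ℝ, 0 < b → 0 < κ → κ ≤ η → 0 < r → r < δ →
    ∃ L, Tendsto (fun ε => innerIntegral f b κ ε r) (𝓝[>] 0) (𝓝 L) ∧ 0 ≤ L ∧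
      |L - modelDensity f f₁ b κ r| ≤ C * (r + κ) ^ 2 * modelDensity f f₁ b κ r := by
  obtain ⟨C, hC, H⟩ := jacobian_onShell M hM
  refine ⟨C, hC, ?_⟩
  intro a c δ η f f₁ f₂ h b κ r hb hκ hκη hr hrδ
  have hη := h.η_le
  have hδ0 := h.δ_pos
  have hs : r + κ ≤ 2 * δ := by linarith
  obtain ⟨u, hu, he⟩ := h.exists_onShell hκ hr hs
  have hu0 : 0 < u := (abs_nonneg _).trans_lt hu.1
  have hu2 : u ≤ 2 * δ := hu.2.le.trans hs
  obtain ⟨K, hK0, hK⟩ := h.exists_local_bound hb hκ hκη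
  have pos : ∀ v ∈ Set.Ioo |r - κ| (r + κ), 0 < v := fun v hv => (abs_nonneg _).trans_lt hv.1
  have dd := (h.dispDeriv_near hu0.le hu2).2.1
  have ddr := (h.dispDeriv_near hr.le (by linarith)).2.1
  have hlim := tendsto_integral_approxDelta_interior (Φ := radialIntegrand f b κ r) (K := K)
    (by norm_num : (0 : ℝ) < 1 / 2) hu he
    (fun v hv => by
      rw [← he]
      exact (h.disp_abs_sub_bounds hu0.le hu2 (pos v hv).le (hv.2.le.trans hs)).1)
    (h.hasDerivAt_disp u) (by linarith) h.continuous_disp.measurable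
    ((h.measurable_radialIntegrand b κ).comp (by fun_prop : Measurable fun v : ℝ => (r, v)))
    (fun v hv => by
      rw [abs_of_nonneg (h.radialIntegrand_nonneg hb hκ hr (pos v hv))]
      exact hK r hr hrδ.le v hv)
    (h.continuousAt_radialIntegrand hb hκ hr hu0)
  refine ⟨_, hlim, div_nonneg (h.radialIntegrand_nonneg hb hκ hr hu0) (abs_nonneg _), ?_⟩
  have hJ := H a c δ η f f₁ f₂ h κ r u hκ hr hs hu he
  have hS := thermalWeight_nonneg (mul_pos hb (h.disp_pos hκ)).le (mul_pos hb (h.disp_pos hr))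
  have hd := h.disp_pos hr
  have hm : 0 ≤ modelDensity f f₁ b κ r := by
    unfold modelDensity
    positivity
  have e : radialIntegrand f b κ r u / |dispDeriv f f₁ u| - modelDensity f f₁ b κ r
      = (vertexSq f u κ r * (r * u) / (9 / 8 * κ * (disp f r ^ 2 * (disp f r + κ) ^ 2) *
        (dispDeriv f f₁ u * dispDeriv f f₁ r)) - 1) * modelDensity f f₁ b κ r := by
    have n1 : dispDeriv f f₁ u ≠ 0 := by linarith
    have n2 : dispDeriv f f₁ r ≠ 0 := by linarith
    unfold radialIntegrand modelDensity
    rw [h.thermalRadial_onShell hb hκ hr he, abs_of_pos (by linarith : 0 < dispDeriv f f₁ u)]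
    field_simp
    ring
  rw [e, abs_mul, abs_of_nonneg hm]
  gcongr

/-- The dichotomy in terms of the energy balance: either it is violated by a definite amount, or the
group velocity is bounded away from zero and of constant sign. -/
theorem dichotomy_sign (h : IsProfile a c M δ η f f₁ f₂) {r κ : ℝ} (hr : δ ≤ r) (hκ : 0 < κ)
    (hκη : κ ≤ η) :
    (∀ u ∈ Set.Icc (r - κ) (r + κ), κ / 4 ≤ |disp f u - (disp f r + disp f κ)|) ∨
    ((∀ u ∈ Set.Icc (r - κ) (r + κ), c / (2 * (1 + r)) ≤ dispDeriv f f₁ u) ∨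
      (∀ u ∈ Set.Icc (r - κ) (r + κ), dispDeriv f f₁ u ≤ -(c / (2 * (1 + r))))) ∧
      (∀ u ∈ Set.Icc (r - κ) (r + κ), c / (1 + u) ≤ |dispDeriv f f₁ u|) := by
  have hη := h.η_le
  have hc := h.c_pos
  have hδ0 := h.δ_pos
  have hle : ∀ u ∈ Set.Icc (r - κ) (r + κ), c / (2 * (1 + r)) ≤ c / (1 + u) := fun u hu => by
    have := hu.1
    have := hu.2
    apply div_le_div_of_nonneg_left hc.le <;> linarith
  rcases h.dichotomy r κ hr hκ hκη with h1 | h1 | h1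
  · left
    intro u hu
    have h2 := abs_le.1 (h1 u hu)
    have h3 := (h.disp_bounds hκ.le (by linarith)).1
    rw [abs_of_nonpos (by linarith)]
    linarith
  · exact Or.inr ⟨Or.inl fun u hu => (hle u hu).trans (h1 u hu),
      fun u hu => (h1 u hu).trans (le_abs_self _)⟩
  · exact Or.inr ⟨Or.inr fun u hu => (h1 u hu).trans (neg_le_neg (hle u hu)),
      fun u hu => by have := h1 u hu; have := neg_le_abs (dispDeriv f f₁ u); linarith⟩

/-- The limit of the inner integral away from the origin. -/
theorem exists_inner_limit_large {a c M δ η : ℝ} (hc : 0 < c) (hδ0 : 0 < δ) (hM : 1 ≤ M) :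
    ∃ C, 0 ≤ C ∧ ∀ (f f₁ f₂ : ℝ → ℝ), IsProfile a c M δ η f f₁ f₂ →
    ∀ b κ r : ℝ, 0 < b → 0 < κ → κ ≤ η → δ ≤ r →
    ∃ L, Tendsto (fun ε => innerIntegral f b κ ε r) (𝓝[>] 0) (𝓝 L) ∧ 0 ≤ L ∧
      L ≤ C * κ * ((1 + r) ^ 17 * thermalWeight (b * disp f κ) (b * disp f r)) := by
  obtain ⟨C, hC, H⟩ := exists_onShell_bound (a := a) (η := η) hc hδ0 hM
  refine ⟨C, hC, ?_⟩
  intro f f₁ f₂ h b κ r hb hκ hκη hr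
  have hη := h.η_le
  have hr0 : 0 < r := by linarith
  obtain ⟨K, hK0, hK⟩ := h.exists_crude_bound hb hκ hκη
  have hpos : ∀ u ∈ Set.Icc (r - κ) (r + κ), 0 < u := fun u hu => by linarith [hu.1]
  have hS := thermalWeight_nonneg (mul_pos hb (h.disp_pos hκ)).le (mul_pos hb (h.disp_pos hr0))
  have hI : ∀ ε, innerIntegral f b κ ε r = ∫ u in Set.Ioo (r - κ) (r + κ),
      radialIntegrand f b κ r u * approxDelta ε (disp f u - (disp f r + disp f κ)) := by
    intro ε
    unfold innerIntegral
    rw [abs_of_nonneg (by linarith)]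
  simp_rw [hI]
  have hnn : ∀ u ∈ Set.Icc (r - κ) (r + κ), 0 ≤ radialIntegrand f b κ r u := fun u hu =>
    h.radialIntegrand_nonneg hb hκ hr0 (hpos u hu)
  rcases h.dichotomy_sign hr hκ hκη with h1 | ⟨h1, h2⟩
  · refine ⟨0, tendsto_integral_approxDelta_zero
      (K := K * ((1 + r) ^ 6 * Real.exp (-(b * c / 2 * r)))) h.continuous_disp.continuousOn (fun u hu he => ?_)
      (fun u hu => ?_), le_rfl, by positivity⟩
    · have := h1 u hu
      rw [he, sub_self, abs_zero] at this
      linarith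
    · rw [abs_of_nonneg (hnn u hu)]
      exact hK r hr u hu
  · obtain ⟨L, hL, hL0, hLB⟩ := exists_limit_approxDelta (Φ := radialIntegrand f b κ r)
      (e := disp f r + disp f κ) (by linarith : r - κ < r + κ)
      (by positivity : 0 < c / (2 * (1 + r))) (fun u _ => h.hasDerivAt_disp u) h1
      h.continuous_disp.measurable
      ((h.measurable_radialIntegrand b κ).comp (by fun_prop : Measurable fun v : ℝ => (r, v)))
      hnn (hK r hr) (fun u hu => h.continuousAt_radialIntegrand hb hκ hr0 (hpos u hu))
    exact ⟨L, hL, hL0, hLB _ (by positivity) fun u hu he =>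
      H f f₁ f₂ h b κ r u hb hκ hκη hr hu he (h2 u hu)⟩

theorem innerIntegral_nonneg (h : IsProfile a c M δ η f f₁ f₂) {b κ ε r : ℝ} (hb : 0 < b)
    (hκ : 0 < κ) (hε : 0 < ε) (hr : 0 < r) : 0 ≤ innerIntegral f b κ ε r :=
  setIntegral_nonneg measurableSet_Ioo fun _ hu => mul_nonneg
    (h.radialIntegrand_nonneg hb hκ hr ((abs_nonneg _).trans_lt hu.1)) (approxDelta_nonneg hε _)

/-- A bound of the inner integral at small momenta, uniform in the width of the delta. -/
theorem exists_inner_bound_small (h : IsProfile a c M δ η f f₁ f₂) {b κ : ℝ} (hb : 0 < b)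
    (hκ : 0 < κ) (hκη : κ ≤ η) : ∃ K, 0 ≤ K ∧ ∀ ε r, 0 < ε → 0 < r → r < δ →
      innerIntegral f b κ ε r ≤ K := by
  obtain ⟨K, hK0, hK⟩ := h.exists_local_bound hb hκ hκη
  have hη := h.η_le
  have hδ0 := h.δ_pos
  refine ⟨K / (1 / 2), by positivity, fun ε r hε hr hrδ => ?_⟩
  have hs : r + κ ≤ 2 * δ := by linarith
  obtain ⟨u, hu, he⟩ := h.exists_onShell hκ hr hs
  have hu0 : 0 < u := (abs_nonneg _).trans_lt hu.1
  have pos : ∀ v ∈ Set.Ioo |r - κ| (r + κ), 0 < v := fun v hv => (abs_nonneg _).trans_lt hv.1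
  exact integral_approxDelta_le measurableSet_Ioo hε (by norm_num) hK0
    (fun v hv => by
      rw [← he]
      exact (h.disp_abs_sub_bounds hu0.le (hu.2.le.trans hs) (pos v hv).le (hv.2.le.trans hs)).1)
    (fun v hv => h.radialIntegrand_nonneg hb hκ hr (pos v hv)) (hK r hr hrδ.le)

/-- A bound of the inner integral away from the origin, uniform in the width of the delta. -/
theorem exists_inner_bound_large (h : IsProfile a c M δ η f f₁ f₂) {b κ : ℝ} (hb : 0 < b)
    (hκ : 0 < κ) (hκη : κ ≤ η) : ∃ K, 0 ≤ K ∧ ∀ ε r, 0 < ε → δ ≤ r →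
      innerIntegral f b κ ε r ≤ K * ((1 + r) ^ 7 * Real.exp (-(b * c / 2 * r))) := by
  obtain ⟨K, hK0, hK⟩ := h.exists_crude_bound hb hκ hκη
  have hη := h.η_le
  have hδ0 := h.δ_pos
  have hc := h.c_pos
  have hpi := Real.pi_pos
  set D := 1 / Real.pi * (1 / (2 * (κ / 4))) * (2 * κ) with hD
  have hD0 : 0 ≤ D := by positivity
  refine ⟨K * D + K * (2 / c), by positivity, fun ε r hε hr => ?_⟩
  have hr0 : 0 < r := by linarith
  set E := Real.exp (-(b * c / 2 * r)) with hE
  have hE0 : 0 < E := Real.exp_pos _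
  set R := 1 + r with hR
  have hR1 : 1 ≤ R := by linarith
  have hR67 : R ^ 6 ≤ R ^ 7 := pow_le_pow_right₀ hR1 (by norm_num)
  have hpos : ∀ u ∈ Set.Icc (r - κ) (r + κ), 0 < u := fun u hu => by linarith [hu.1]
  have hnn : ∀ u ∈ Set.Icc (r - κ) (r + κ), 0 ≤ radialIntegrand f b κ r u := fun u hu =>
    h.radialIntegrand_nonneg hb hκ hr0 (hpos u hu)
  unfold innerIntegral
  rw [abs_of_nonneg (by linarith)]
  rcases h.dichotomy_sign hr hκ hκη with h1 | ⟨h1, -⟩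
  · have hb1 : ‖∫ u in Set.Ioo (r - κ) (r + κ),
        radialIntegrand f b κ r u * approxDelta ε (disp f u - (disp f r + disp f κ))‖
        ≤ K * (R ^ 6 * E) * (1 / Real.pi * (1 / (2 * (κ / 4)))) *
          (volume : Measure ℝ).real (Set.Ioo (r - κ) (r + κ)) := by
      refine norm_setIntegral_le_of_norm_le_const (by simp) fun u hu => ?_
      have hu' := Set.Ioo_subset_Icc_self hu
      rw [norm_mul, Real.norm_of_nonneg (hnn u hu'), Real.norm_of_nonneg (approxDelta_nonneg hε _)]
      exact mul_le_mul (hK r hr u hu') (approxDelta_le_inv hε (by positivity) (h1 u hu'))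
        (approxDelta_nonneg hε _) (by positivity)
    rw [Real.volume_real_Ioo_of_le (by linarith), show r + κ - (r - κ) = 2 * κ by ring] at hb1
    refine (Real.le_norm_self _).trans (hb1.trans ?_)
    calc _ = K * D * (R ^ 6 * E) := by rw [hD]; ring
      _ ≤ K * D * (R ^ 7 * E) := by gcongr
      _ ≤ _ := by
        gcongr
        have : 0 ≤ K * (2 / c) := by positivity
        linarith
  · obtain ⟨x₀, hx₀, h2, -⟩ := exists_nearest_solution (by linarith : r - κ ≤ r + κ)
      (by positivity : 0 < c / (2 * (1 + r))) (fun u _ => h.hasDerivAt_disp u) h1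
      (disp f r + disp f κ)
    refine (integral_approxDelta_le (K := K * (R ^ 6 * E)) measurableSet_Ioo hε
      (by positivity : 0 < c / (2 * (1 + r))) (by positivity)
      (fun u hu => h2 u (Set.Ioo_subset_Icc_self hu))
      (fun u hu => hnn u (Set.Ioo_subset_Icc_self hu))
      (fun u hu => hK r hr u (Set.Ioo_subset_Icc_self hu))).trans ?_
    calc K * (R ^ 6 * E) / (c / (2 * (1 + r))) = K * (2 / c) * (R ^ 7 * E) := by
          rw [← hR]; field_simp
      _ ≤ _ := by
        gcongr
        have : 0 ≤ K * D := by positivity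
        linarith

/-- The inner integral converges, at every width of the approximate delta. -/
theorem integrable_inner (h : IsProfile a c M δ η f f₁ f₂) {b κ ε r : ℝ} (hb : 0 < b)
    (hκ : 0 < κ) (hκη : κ ≤ η) (hε : 0 < ε) (hr : 0 < r) :
    IntegrableOn (fun u => radialIntegrand f b κ r u
      * approxDelta ε (disp f u - (disp f r + disp f κ))) (Set.Ioo |r - κ| (r + κ)) := by
  have hpi := Real.pi_pos
  have hη := h.η_le
  obtain ⟨K, hK⟩ : ∃ K, ∀ u ∈ Set.Ioo |r - κ| (r + κ), radialIntegrand f b κ r u ≤ K := by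
    rcases le_or_gt r δ with hrδ | hrδ
    · obtain ⟨K, -, hK⟩ := h.exists_local_bound hb hκ hκη
      exact ⟨K, hK r hr hrδ⟩
    · obtain ⟨K, -, hK⟩ := h.exists_crude_bound hb hκ hκη
      refine ⟨_, fun u hu => hK r hrδ.le u ⟨(le_abs_self _).trans hu.1.le, hu.2.le⟩⟩
  have hm : Measurable fun u => radialIntegrand f b κ r u
      * approxDelta ε (disp f u - (disp f r + disp f κ)) := by
    refine Measurable.mul ((h.measurable_radialIntegrand b κ).comp
      (by fun_prop : Measurable fun v : ℝ => (r, v))) ?_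
    have := h.continuous_disp.measurable
    exact (measurable_approxDelta ε).comp (by fun_prop)
  refine Measure.integrableOn_of_bounded (M := K * (1 / Real.pi * (1 / ε))) (by simp)
    hm.aestronglyMeasurable ?_
  filter_upwards [ae_restrict_mem measurableSet_Ioo] with u hu
  have hu0 : 0 < u := (abs_nonneg _).trans_lt hu.1
  have hn := h.radialIntegrand_nonneg hb hκ hr hu0
  rw [norm_mul, Real.norm_of_nonneg hn, Real.norm_of_nonneg (approxDelta_nonneg hε _)]
  refine mul_le_mul (hK u hu) ?_ (approxDelta_nonneg hε _) (hn.trans (hK u hu))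
  refine mul_le_mul_of_nonneg_left ?_ (by positivity)
  rw [div_le_div_iff₀ (by positivity) hε]
  nlinarith [sq_nonneg (disp f u - (disp f r + disp f κ))]

end IsProfile

/-! ### The leading term -/

/-- The moments of the thermal weight in terms of the energy `y`, at inverse temperature `m`. -/
theorem scaled_moment {n : ℕ} (hn : 1 ≤ n) {θ m : ℝ} (hθ : 0 ≤ θ) (hm : 0 < m) :
    IntegrableOn (fun y => y ^ n * thermalWeight θ (m * y)) (Set.Ioi 0) ∧
    ∫ y in Set.Ioi (0 : ℝ), y ^ n * thermalWeight θ (m * y) = 1 / m ^ (n + 1) * G n θ := by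
  have e : (fun y => y ^ n * thermalWeight θ (m * y))
      = fun y => 1 / m ^ n * GIntegrand n θ (m * y) := by
    funext y
    rw [GIntegrand_eq, mul_pow]
    field_simp
  rw [e]
  constructor
  · refine Integrable.const_mul ?_ _
    rw [← IntegrableOn, integrableOn_Ioi_comp_mul_left_iff (GIntegrand n θ) 0 hm, mul_zero]
    exact (integrableOn_and_hasSum_G hn hθ).1
  · rw [integral_const_mul, integral_comp_mul_left_Ioi (GIntegrand n θ) 0 hm, mul_zero, ← G,
      smul_eq_mul, pow_succ]
    field_simp

/-- The density of the leading term as a function of the energy `y` of the quasiparticle of momentum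
`p`; the moments of the thermal weight make its integral a combination of `𝒢_4`, `𝒢_3`, `𝒢_2`. -/
noncomputable def energyDensity (b κ θ y : ℝ) : ℝ :=
  y ^ 2 * (y + κ) ^ 2 * thermalWeight θ (b * y)

/-- The integral of `energyDensity`, in closed form. -/
noncomputable def energyMass (b κ θ : ℝ) : ℝ :=
  1 / b ^ 5 * (G 4 θ + 2 * (b * κ) * G 3 θ + (b * κ) ^ 2 * G 2 θ)

theorem energyDensity_nonneg {b κ θ y : ℝ} (hb : 0 < b) (hθ : 0 ≤ θ) (hy : 0 < y) :
    0 ≤ energyDensity b κ θ y := by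
  have := thermalWeight_nonneg hθ (mul_pos hb hy)
  unfold energyDensity
  positivity

theorem energyMass_nonneg {b κ θ : ℝ} (hb : 0 < b) (hκ : 0 < κ) (hθ : 0 ≤ θ) :
    0 ≤ energyMass b κ θ := by
  have h2 := G_nonneg (n := 2) hθ
  have h3 := G_nonneg (n := 3) hθ
  have h4 := G_nonneg (n := 4) hθ
  unfold energyMass
  positivity

theorem G_four_le_energyMass {b κ θ : ℝ} (hb : 0 < b) (hκ : 0 < κ) (hθ : 0 ≤ θ) :
    1 / b ^ 5 * G 4 θ ≤ energyMass b κ θ := by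
  have h2 := G_nonneg (n := 2) hθ
  have h3 := G_nonneg (n := 3) hθ
  unfold energyMass
  gcongr
  have : 0 ≤ 2 * (b * κ) * G 3 θ := by positivity
  have : 0 ≤ (b * κ) ^ 2 * G 2 θ := by positivity
  linarith

/-- The moments of `energyDensity`, by expanding `(y + κ)²`. -/
theorem moment_energyDensity (n : ℕ) {b κ θ : ℝ} (hb : 0 < b) (hθ : 0 ≤ θ) :
    IntegrableOn (fun y => y ^ n * energyDensity b κ θ y) (Set.Ioi 0) ∧
    ∫ y in Set.Ioi (0 : ℝ), y ^ n * energyDensity b κ θ y = 1 / b ^ (n + 5) *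
      (G (n + 4) θ + 2 * (b * κ) * G (n + 3) θ + (b * κ) ^ 2 * G (n + 2) θ) := by
  obtain ⟨i4, e4⟩ := scaled_moment (by omega : 1 ≤ n + 4) hθ hb
  obtain ⟨i3, e3⟩ := scaled_moment (by omega : 1 ≤ n + 3) hθ hb
  obtain ⟨i2, e2⟩ := scaled_moment (by omega : 1 ≤ n + 2) hθ hb
  have e : (fun y => y ^ n * energyDensity b κ θ y)
      = fun y => y ^ (n + 4) * thermalWeight θ (b * y)
        + 2 * κ * (y ^ (n + 3) * thermalWeight θ (b * y))
        + κ ^ 2 * (y ^ (n + 2) * thermalWeight θ (b * y)) := by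
    funext y
    unfold energyDensity
    ring
  rw [e]
  have i43 : IntegrableOn (fun y => y ^ (n + 4) * thermalWeight θ (b * y)
        + 2 * κ * (y ^ (n + 3) * thermalWeight θ (b * y))) (Set.Ioi 0) := i4.add (i3.const_mul _)
  refine ⟨i43.add (i2.const_mul _), ?_⟩
  rw [integral_add i43 (i2.const_mul _), integral_add i4 (i3.const_mul _), integral_const_mul, integral_const_mul, e4, e3, e2]
  field_simp
  ring

/-- The moment of order zero. -/
theorem integrableOn_energyDensity {b κ θ : ℝ} (hb : 0 < b) (hθ : 0 ≤ θ) :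
    IntegrableOn (energyDensity b κ θ) (Set.Ioi 0) ∧
    ∫ y in Set.Ioi (0 : ℝ), energyDensity b κ θ y = energyMass b κ θ := by
  simpa [energyMass] using moment_energyDensity 0 (κ := κ) hb hθ

/-- The second moment is smaller than the mass by two powers of the temperature. The constant is
`6!`, from `G_le_G` with `m = 6`. -/
theorem second_moment_energyDensity_le {b κ θ : ℝ} (hb : 0 < b) (hκ : 0 < κ) (hθ : 0 ≤ θ) :
    ∫ y in Set.Ioi (0 : ℝ), y ^ 2 * energyDensity b κ θ y ≤ 720 * (1 / b ^ 2 * energyMass b κ θ) := by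
  rw [(moment_energyDensity 2 hb hθ).2]
  have h6 : G 6 θ ≤ 720 * G 4 θ := G_le_G (by norm_num) (by norm_num) hθ
  have h5 : G 5 θ ≤ 720 * G 3 θ := (G_le_G (by norm_num) (by norm_num) hθ).trans
    (mul_le_mul_of_nonneg_right (by norm_num [Nat.factorial]) (G_nonneg hθ))
  have h4 : G 4 θ ≤ 720 * G 2 θ := (G_le_G (by norm_num) (by norm_num) hθ).trans
    (mul_le_mul_of_nonneg_right (by norm_num [Nat.factorial]) (G_nonneg hθ))
  calc _ ≤ 1 / b ^ 7 * (720 * G 4 θ + 2 * (b * κ) * (720 * G 3 θ)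
        + (b * κ) ^ 2 * (720 * G 2 θ)) := by
        gcongr
    _ = _ := by
        unfold energyMass
        field_simp

/-- Half of the exponential decay absorbs the polynomial growth; `5040` is `7!`. -/
theorem one_add_pow_seven_mul_exp_le {α r : ℝ} (hα : 0 < α) (hr : 0 ≤ r) :
    (1 + r) ^ 7 * Real.exp (-(α * r)) ≤
      5040 * (2 / α) ^ 7 * Real.exp (α / 2) * Real.exp (-(α / 2 * r)) := by
  have h := Real.pow_div_factorial_le_exp (α / 2 * (1 + r)) (by positivity) 7
  have e1 : Real.exp (α / 2 * (1 + r)) = Real.exp (α / 2) * Real.exp (α / 2 * r) := by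
    rw [← Real.exp_add]; ring_nf
  have e2 : Real.exp (-(α / 2 * r)) = Real.exp (α / 2 * r) * Real.exp (-(α * r)) := by
    rw [← Real.exp_add]; ring_nf
  rw [e1, mul_pow, div_le_iff₀ (by positivity)] at h
  have h' : (1 + r) ^ 7 ≤ 5040 * (2 / α) ^ 7 * Real.exp (α / 2) * Real.exp (α / 2 * r) := by
    calc (1 + r) ^ 7 = (2 / α) ^ 7 * ((α / 2) ^ 7 * (1 + r) ^ 7) := by
          rw [← mul_assoc, ← mul_pow]
          field_simp
      _ ≤ (2 / α) ^ 7 * (Real.exp (α / 2) * Real.exp (α / 2 * r) * (Nat.factorial 7 : ℝ)) := by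
          gcongr
      _ = _ := by
          norm_num [Nat.factorial]
          ring
  rw [e2, ← mul_assoc]
  gcongr

namespace IsProfile

variable {a c M δ η : ℝ} {f f₁ f₂ : ℝ → ℝ}

theorem image_disp (h : IsProfile a c M δ η f f₁ f₂) :
    disp f '' Set.Ioo 0 δ = Set.Ioo 0 (disp f δ) := by
  have hδ0 := h.δ_pos
  ext y
  constructor
  · rintro ⟨x, hx, rfl⟩
    refine ⟨h.disp_pos hx.1, ?_⟩
    have := (h.disp_sub_bounds hx.1.le hx.2.le (by linarith)).1
    linarith [hx.2]
  · intro hy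
    rw [← disp_zero (f := f)] at hy
    exact intermediate_value_Ioo hδ0.le h.continuous_disp.continuousOn hy

theorem injOn_disp (h : IsProfile a c M δ η f f₁ f₂) : Set.InjOn (disp f) (Set.Ioo 0 δ) := by
  intro x hx y hy hxy
  have hδ0 := h.δ_pos
  have := (h.disp_abs_sub_bounds hx.1.le (by linarith [hx.2]) hy.1.le (by linarith [hy.2])).1
  rw [hxy, sub_self, abs_zero] at this
  have h0 := abs_nonneg (x - y)
  rw [abs_sub_comm] at h0
  have : |y - x| = 0 := by
    have := abs_sub_comm x y
    linarith
  exact (sub_eq_zero.1 (abs_eq_zero.1 this)).symm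

/-- The substitution `y = disp f r` in an integral over small momenta. -/
theorem integral_comp_disp (h : IsProfile a c M δ η f f₁ f₂) {g : ℝ → ℝ}
    (hg : IntegrableOn g (Set.Ioi 0)) :
    IntegrableOn (fun r => g (disp f r) * dispDeriv f f₁ r) (Set.Ioo 0 δ) ∧
    ∫ r in Set.Ioo 0 δ, g (disp f r) * dispDeriv f f₁ r = ∫ y in Set.Ioo 0 (disp f δ), g y := by
  have hδ0 := h.δ_pos
  have hd : ∀ x ∈ Set.Ioo 0 δ, HasDerivWithinAt (disp f) (dispDeriv f f₁ x) (Set.Ioo 0 δ) x :=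
    fun x _ => (h.hasDerivAt_disp x).hasDerivWithinAt
  have e : Set.EqOn (fun r => |dispDeriv f f₁ r| • g (disp f r))
      (fun r => g (disp f r) * dispDeriv f f₁ r) (Set.Ioo 0 δ) := by
    intro r hr
    have := (h.dispDeriv_near hr.1.le (by linarith [hr.2])).2.1
    simp only [smul_eq_mul]
    rw [abs_of_pos (by linarith), mul_comm]
  constructor
  · have := (integrableOn_image_iff_integrableOn_abs_deriv_smul measurableSet_Ioo hd h.injOn_disp
      g).1 (by
        rw [h.image_disp]
        exact hg.mono_set fun y hy => hy.1)
    exact this.congr_fun e measurableSet_Ioo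
  · rw [← h.image_disp, integral_image_eq_integral_abs_deriv_smul measurableSet_Ioo hd h.injOn_disp]
    exact (setIntegral_congr_fun measurableSet_Ioo e).symm

/-- The integral of the model density: the substitution `y = w(r)` turns it into the integral of
`energyDensity` over energies below `w(δ)`, and the missing part as well as the weight `(r + κ)²`
cost a second moment, that is, a factor `1/b²` or `κ²`. -/
theorem model_estimate (h : IsProfile a c M δ η f f₁ f₂) {b κ : ℝ} (hb : 0 < b) (hκ : 0 < κ) :
    IntegrableOn (modelDensity f f₁ b κ) (Set.Ioo 0 δ) ∧
    |(∫ r in Set.Ioo 0 δ, modelDensity f f₁ b κ r)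
        - 9 / 16 * κ * energyMass b κ (b * disp f κ)| ≤
      1440 / δ ^ 2 * (1 / b ^ 2) * (9 / 16 * κ * energyMass b κ (b * disp f κ)) ∧
    IntegrableOn (fun r => (r + κ) ^ 2 * modelDensity f f₁ b κ r) (Set.Ioo 0 δ) ∧
    ∫ r in Set.Ioo 0 δ, (r + κ) ^ 2 * modelDensity f f₁ b κ r ≤
      2880 * (1 / b ^ 2 + κ ^ 2) * (9 / 16 * κ * energyMass b κ (b * disp f κ)) := by
  have hδ0 := h.δ_pos
  have hθ : 0 ≤ b * disp f κ := (mul_pos hb (h.disp_pos hκ)).le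
  set θ := b * disp f κ with hθe
  set m := energyMass b κ θ with hm
  have hm0 : 0 ≤ m := energyMass_nonneg hb hκ hθ
  have hW := (h.disp_bounds hδ0.le (by linarith)).1
  have hWp := h.disp_pos hδ0
  set W := disp f δ with hWe
  obtain ⟨ig, eg⟩ := integrableOn_energyDensity (κ := κ) hb hθ
  have ig2 := (moment_energyDensity 2 (κ := κ) hb hθ).1
  have eg2 := second_moment_energyDensity_le hb hκ hθ
  rw [← hm] at eg eg2
  have hmod : modelDensity f f₁ b κ = fun r =>
      9 / 16 * κ * (energyDensity b κ θ (disp f r) * dispDeriv f f₁ r) := by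
    funext r
    unfold modelDensity energyDensity
    ring
  obtain ⟨ic, ec⟩ := h.integral_comp_disp ig
  have imod : IntegrableOn (modelDensity f f₁ b κ) (Set.Ioo 0 δ) := by
    rw [hmod]
    exact ic.const_mul _
  have sub1 : Set.Ioo 0 W ⊆ Set.Ioi 0 := fun y hy => hy.1
  have sub2 : Set.Ici W ⊆ Set.Ioi 0 := fun y hy => hWp.trans_le hy
  have gnn : ∀ y ∈ Set.Ioi (0 : ℝ), 0 ≤ energyDensity b κ θ y := fun y hy =>
    energyDensity_nonneg hb hθ hy
  have nn1 : 0 ≤ᵐ[volume.restrict (Set.Ioi 0)] energyDensity b κ θ := by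
    filter_upwards [ae_restrict_mem measurableSet_Ioi] with y hy using gnn y hy
  have nn2 : 0 ≤ᵐ[volume.restrict (Set.Ioi 0)] fun y => y ^ 2 * energyDensity b κ θ y := by
    filter_upwards [ae_restrict_mem measurableSet_Ioi] with y hy
    exact mul_nonneg (sq_nonneg y) (gnn y hy)
  refine ⟨imod, ?_, ?_⟩
  · have split : ∫ y in Set.Ioi 0, energyDensity b κ θ y
        = (∫ y in Set.Ioo 0 W, energyDensity b κ θ y) + ∫ y in Set.Ici W, energyDensity b κ θ y := by
      rw [← Set.Ioo_union_Ici_eq_Ioi hWp, setIntegral_union _ measurableSet_Ici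
        (ig.mono_set sub1) (ig.mono_set sub2)]
      exact Set.disjoint_left.2 fun y hy hy' => not_le.2 hy.2 hy'
    have t0 : 0 ≤ ∫ y in Set.Ici W, energyDensity b κ θ y :=
      setIntegral_nonneg measurableSet_Ici fun y hy => gnn y (sub2 hy)
    have t1 : ∫ y in Set.Ici W, energyDensity b κ θ y ≤
        1 / W ^ 2 * ∫ y in Set.Ici W, y ^ 2 * energyDensity b κ θ y := by
      rw [← integral_const_mul]
      refine setIntegral_mono_on (ig.mono_set sub2) ((ig2.mono_set sub2).const_mul _)
        measurableSet_Ici fun y hy => ?_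
      have h1 := gnn y (sub2 hy)
      have h2 : W ^ 2 ≤ y ^ 2 := pow_le_pow_left₀ hWp.le hy 2
      have h3 : 1 ≤ 1 / W ^ 2 * y ^ 2 := by
        rw [one_div, ← div_eq_inv_mul, le_div_iff₀ (by positivity)]
        linarith
      calc energyDensity b κ θ y = 1 * energyDensity b κ θ y := (one_mul _).symm
        _ ≤ 1 / W ^ 2 * y ^ 2 * energyDensity b κ θ y := by gcongr
        _ = _ := by ring
    have t2 : ∫ y in Set.Ici W, y ^ 2 * energyDensity b κ θ y ≤ 720 * (1 / b ^ 2 * m) :=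
      (setIntegral_mono_set ig2 nn2 sub2.eventuallyLE).trans eg2
    have t3 : 1 / W ^ 2 ≤ 2 / δ ^ 2 := by
      rw [div_le_div_iff₀ (by positivity) (by positivity)]
      nlinarith
    have t4 : ∫ y in Set.Ici W, energyDensity b κ θ y ≤ 2 / δ ^ 2 * (720 * (1 / b ^ 2 * m)) := by
      refine t1.trans (mul_le_mul t3 t2 ?_ (by positivity))
      exact setIntegral_nonneg measurableSet_Ici fun y hy =>
        mul_nonneg (sq_nonneg y) (gnn y (sub2 hy))
    rw [hmod, integral_const_mul, ec, show (∫ y in Set.Ioo 0 W, energyDensity b κ θ y)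
      = m - ∫ y in Set.Ici W, energyDensity b κ θ y by linarith, ← mul_sub, abs_mul,
      abs_of_pos (by positivity), sub_sub_cancel_left, abs_neg, abs_of_nonneg t0]
    calc _ ≤ 9 / 16 * κ * (2 / δ ^ 2 * (720 * (1 / b ^ 2 * m))) := by gcongr
      _ = _ := by ring
  · have ih : IntegrableOn (fun y => (4 * y ^ 2 + 2 * κ ^ 2) * energyDensity b κ θ y)
        (Set.Ioi 0) := by
      have := (ig2.const_mul 4).add (ig.const_mul (2 * κ ^ 2))
      refine this.congr (Eventually.of_forall fun y => ?_)
      simp only [Pi.add_apply]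
      ring
    obtain ⟨ie, ee⟩ := h.integral_comp_disp ih
    have hle : ∀ r ∈ Set.Ioo 0 δ, (r + κ) ^ 2 * modelDensity f f₁ b κ r ≤
        9 / 16 * κ * ((4 * disp f r ^ 2 + 2 * κ ^ 2) * energyDensity b κ θ (disp f r)
          * dispDeriv f f₁ r) := by
      intro r hr
      have h1 := (h.disp_bounds hr.1.le (by linarith [hr.2])).1
      have h2 := (h.dispDeriv_near hr.1.le (by linarith [hr.2])).2.1
      have h3 := gnn _ (h.disp_pos hr.1)
      have h4 : (r + κ) ^ 2 ≤ 4 * disp f r ^ 2 + 2 * κ ^ 2 := by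
        have : r ^ 2 * (9 / 16) ≤ disp f r ^ 2 := by nlinarith [hr.1]
        nlinarith [sq_nonneg (r - κ)]
      rw [hmod]
      have : 0 ≤ energyDensity b κ θ (disp f r) * dispDeriv f f₁ r := by
        have : 0 ≤ dispDeriv f f₁ r := by linarith
        positivity
      calc _ ≤ (4 * disp f r ^ 2 + 2 * κ ^ 2) *
            (9 / 16 * κ * (energyDensity b κ θ (disp f r) * dispDeriv f f₁ r)) := by gcongr
        _ = _ := by ring
    have hnn : ∀ r ∈ Set.Ioo 0 δ, 0 ≤ modelDensity f f₁ b κ r := by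
      intro r hr
      have h2 := (h.dispDeriv_near hr.1.le (by linarith [hr.2])).2.1
      have h3 := gnn _ (h.disp_pos hr.1)
      have : 0 ≤ dispDeriv f f₁ r := by linarith
      rw [hmod]
      positivity
    have il : IntegrableOn (fun r => (r + κ) ^ 2 * modelDensity f f₁ b κ r) (Set.Ioo 0 δ) := by
      refine Integrable.mono' (ie.const_mul (9 / 16 * κ)) ?_ ?_
      · exact (by fun_prop : Continuous fun r : ℝ => (r + κ) ^ 2).aestronglyMeasurable.mul
          imod.aestronglyMeasurable
      · filter_upwards [ae_restrict_mem measurableSet_Ioo] with r hr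
        rw [Real.norm_of_nonneg (mul_nonneg (sq_nonneg _) (hnn r hr))]
        exact hle r hr
    refine ⟨il, ?_⟩
    refine (setIntegral_mono_on il (ie.const_mul (9 / 16 * κ)) measurableSet_Ioo hle).trans ?_
    rw [integral_const_mul, ee]
    have nn3 : 0 ≤ᵐ[volume.restrict (Set.Ioi 0)]
        fun y => (4 * y ^ 2 + 2 * κ ^ 2) * energyDensity b κ θ y := by
      filter_upwards [ae_restrict_mem measurableSet_Ioi] with y hy
      have := gnn y hy
      positivity
    have e1 : ∫ y in Set.Ioi (0 : ℝ), (4 * y ^ 2 + 2 * κ ^ 2) * energyDensity b κ θ y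
        = 4 * (∫ y in Set.Ioi (0 : ℝ), y ^ 2 * energyDensity b κ θ y) + 2 * κ ^ 2 * m := by
      rw [← eg, ← integral_const_mul, ← integral_const_mul,
        ← integral_add (ig2.const_mul 4) (ig.const_mul (2 * κ ^ 2))]
      congr 1
      funext y
      ring
    have e2 : ∫ y in Set.Ioo 0 W, (4 * y ^ 2 + 2 * κ ^ 2) * energyDensity b κ θ y
        ≤ 4 * (720 * (1 / b ^ 2 * m)) + 2 * κ ^ 2 * m := by
      refine (setIntegral_mono_set ih nn3 sub1.eventuallyLE).trans ?_
      rw [e1]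
      gcongr
    calc _ ≤ 9 / 16 * κ * (4 * (720 * (1 / b ^ 2 * m)) + 2 * κ ^ 2 * m) := by gcongr
      _ ≤ 9 / 16 * κ * (4 * (720 * (1 / b ^ 2 * m)) + 2880 * κ ^ 2 * m) := by
        gcongr
        norm_num
      _ = _ := by ring

/-! ### The integral over both lengths -/

/-- Measurability in `r`, although the domain of integration depends on `r`. -/
theorem measurable_inner (h : IsProfile a c M δ η f f₁ f₂) (b κ ε : ℝ) :
    Measurable fun r => ∫⁻ u in Set.Ioo |r - κ| (r + κ), ENNReal.ofReal (radialIntegrand f b κ r u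
      * approxDelta ε (disp f u - (disp f r + disp f κ))) := by
  have h1 := h.measurable_radialIntegrand b κ
  have h2 := h.continuous_disp.measurable
  have h3 : Measurable (Function.uncurry fun r u => ENNReal.ofReal (radialIntegrand f b κ r u
      * approxDelta ε (disp f u - (disp f r + disp f κ)))) :=
    (h1.mul ((measurable_approxDelta ε).comp (by fun_prop))).ennreal_ofReal
  have hS : MeasurableSet {x : ℝ × ℝ | x.2 ∈ Set.Ioo |x.1 - κ| (x.1 + κ)} := by
    have s1 : MeasurableSet {x : ℝ × ℝ | |x.1 - κ| < x.2} :=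
      measurableSet_lt (by fun_prop) (by fun_prop)
    have s2 : MeasurableSet {x : ℝ × ℝ | x.2 < x.1 + κ} :=
      measurableSet_lt (by fun_prop) (by fun_prop)
    exact s1.inter s2
  convert! (h3.indicator hS).lintegral_prod_right' (ν := volume) using 2 with r
  rw [← lintegral_indicator measurableSet_Ioo]
  rfl

/-- The inner integral as a lower integral. -/
theorem lintegral_inner (h : IsProfile a c M δ η f f₁ f₂) {b κ ε r : ℝ} (hb : 0 < b)
    (hκ : 0 < κ) (hκη : κ ≤ η) (hε : 0 < ε) (hr : 0 < r) :
    ∫⁻ u in Set.Ioo |r - κ| (r + κ), ENNReal.ofReal (radialIntegrand f b κ r u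
      * approxDelta ε (disp f u - (disp f r + disp f κ))) =
      ENNReal.ofReal (innerIntegral f b κ ε r) := by
  refine (ofReal_integral_eq_lintegral_ofReal (h.integrable_inner hb hκ hκη hε hr) ?_).symm
  filter_upwards [ae_restrict_mem measurableSet_Ioo] with u hu
  exact mul_nonneg (h.radialIntegrand_nonneg hb hκ hr ((abs_nonneg _).trans_lt hu.1))
    (approxDelta_nonneg hε _)

theorem aestronglyMeasurable_innerIntegral (h : IsProfile a c M δ η f f₁ f₂) {b κ ε : ℝ}
    (hb : 0 < b) (hκ : 0 < κ) (hκη : κ ≤ η) (hε : 0 < ε) :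
    AEStronglyMeasurable (innerIntegral f b κ ε) (volume.restrict (Set.Ioi 0)) := by
  refine (h.measurable_inner b κ ε).ennreal_toReal.aestronglyMeasurable.congr ?_
  filter_upwards [ae_restrict_mem measurableSet_Ioi] with r hr
  rw [h.lintegral_inner hb hκ hκη hε hr, ENNReal.toReal_ofReal (h.innerIntegral_nonneg hb hκ hε hr)]

/-- An integrable bound of the inner integral, uniform in the width of the delta. -/
theorem exists_inner_bound (h : IsProfile a c M δ η f f₁ f₂) {b κ : ℝ} (hb : 0 < b)
    (hκ : 0 < κ) (hκη : κ ≤ η) : ∃ g : ℝ → ℝ, IntegrableOn g (Set.Ioi 0) ∧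
      ∀ ε r, 0 < ε → 0 < r → innerIntegral f b κ ε r ≤ g r := by
  obtain ⟨K₁, hK₁, H₁⟩ := h.exists_inner_bound_small hb hκ hκη
  obtain ⟨K₂, hK₂, H₂⟩ := h.exists_inner_bound_large hb hκ hκη
  have hα : 0 < b * c / 2 := by have := h.c_pos; positivity
  set α := b * c / 2 with hαe
  refine ⟨fun r => (K₁ * Real.exp (α / 2 * δ) + K₂ * (5040 * (2 / α) ^ 7 * Real.exp (α / 2)))
    * Real.exp (-(α / 2) * r), (exp_neg_integrableOn_Ioi 0 (by positivity)).const_mul _,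
    fun ε r hε hr => ?_⟩
  have e2 : Real.exp (-(α / 2) * r) = Real.exp (-(α / 2 * r)) := by rw [neg_mul]
  simp only [e2]
  rcases lt_or_ge r δ with hrδ | hrδ
  · have e1 : 1 ≤ Real.exp (α / 2 * δ) * Real.exp (-(α / 2 * r)) := by
      rw [← Real.exp_add]
      refine Real.one_le_exp ?_
      nlinarith
    calc innerIntegral f b κ ε r ≤ K₁ * 1 := by rw [mul_one]; exact H₁ ε r hε hr hrδ
      _ ≤ K₁ * (Real.exp (α / 2 * δ) * Real.exp (-(α / 2 * r))) := by gcongr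
      _ ≤ _ := by
        rw [← mul_assoc]
        gcongr
        have : 0 ≤ K₂ * (5040 * (2 / α) ^ 7 * Real.exp (α / 2)) := by positivity
        linarith
  · calc innerIntegral f b κ ε r ≤ K₂ * ((1 + r) ^ 7 * Real.exp (-(α * r))) := H₂ ε r hε hrδ
      _ ≤ K₂ * (5040 * (2 / α) ^ 7 * Real.exp (α / 2) * Real.exp (-(α / 2 * r))) := by
        exact mul_le_mul_of_nonneg_left (one_add_pow_seven_mul_exp_le hα hr.le) hK₂
      _ ≤ _ := by
        rw [← mul_assoc]
        gcongr
        have : 0 ≤ K₁ * Real.exp (α / 2 * δ) := by positivity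
        linarith

end IsProfile

/-- The damping integral in bipolar coordinates, without its prefactor. -/
noncomputable def coreIntegral (f : ℝ → ℝ) (b κ ε : ℝ) : ℝ≥0∞ :=
  ∫⁻ r in Set.Ioi 0, ∫⁻ u in Set.Ioo |r - κ| (r + κ), ENNReal.ofReal (radialIntegrand f b κ r u
      * approxDelta ε (disp f u - (disp f r + disp f κ)))

/-- The contribution of the momenta away from the origin is of higher order in the temperature. -/
theorem IsProfile.tail_estimate {a c M δ η : ℝ} {f f₁ f₂ : ℝ → ℝ}
    (h : IsProfile a c M δ η f f₁ f₂) {b κ C : ℝ} (hb : 1 < b) (hκ : 0 < κ) (hC : 0 ≤ C)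
    {L : ℝ → ℝ} (hL0 : ∀ r, δ ≤ r → 0 ≤ L r) (hL : ∀ r, δ ≤ r →
      L r ≤ C * κ * ((1 + r) ^ 17 * thermalWeight (b * disp f κ) (b * disp f r))) :
    ∫ r in Set.Ici δ, L r ≤ C * (2 * (Nat.factorial 17 : ℝ) * ((1 + δ) / δ) ^ 17 / c ^ 18) *
      (1 / b ^ 2) * (9 / 16 * κ * energyMass b κ (b * disp f κ)) := by
  have hδ0 := h.δ_pos
  have hc := h.c_pos
  have hb0 : 0 < b := by linarith
  have hθ : 0 ≤ b * disp f κ := (mul_pos hb0 (h.disp_pos hκ)).le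
  set θ := b * disp f κ with hθe
  obtain ⟨i17, e17⟩ := scaled_moment (n := 17) (by norm_num) hθ (mul_pos hb0 hc)
  have sub : Set.Ici δ ⊆ Set.Ioi 0 := fun y hy => hδ0.trans_le hy
  have snn : ∀ r ∈ Set.Ioi (0 : ℝ), 0 ≤ r ^ 17 * thermalWeight θ (b * c * r) := fun r hr => by
    have hr' : (0 : ℝ) < r := hr
    have := thermalWeight_nonneg hθ (by positivity : 0 < b * c * r)
    positivity
  have hle : ∀ r ∈ Set.Ici δ, L r ≤
      C * κ * ((1 + δ) / δ) ^ 17 * (r ^ 17 * thermalWeight θ (b * c * r)) := by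
    intro r hr
    have hr' : 0 < r := sub hr
    have h1 : 1 + r ≤ (1 + δ) / δ * r := by
      rw [div_mul_eq_mul_div, le_div_iff₀ hδ0]
      have : δ ≤ r := hr
      nlinarith
    have h2 : thermalWeight θ (b * disp f r) ≤ thermalWeight θ (b * c * r) := by
      refine thermalWeight_antitone hθ (by positivity) ?_
      rw [mul_assoc]
      exact mul_le_mul_of_nonneg_left (h.le_disp hr'.le) hb0.le
    have h3 := thermalWeight_nonneg hθ (mul_pos hb0 (h.disp_pos hr'))
    calc L r ≤ C * κ * ((1 + r) ^ 17 * thermalWeight θ (b * disp f r)) := hL r hr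
      _ ≤ C * κ * (((1 + δ) / δ * r) ^ 17 * thermalWeight θ (b * c * r)) := by gcongr
      _ = _ := by rw [mul_pow]; ring
  have hint : ∫ r in Set.Ici δ, L r ≤ ∫ r in Set.Ici δ,
      C * κ * ((1 + δ) / δ) ^ 17 * (r ^ 17 * thermalWeight θ (b * c * r)) := by
    refine integral_mono_of_nonneg ?_ ((i17.mono_set sub).const_mul _) ?_
    · filter_upwards [ae_restrict_mem measurableSet_Ici] with r hr using hL0 r hr
    · filter_upwards [ae_restrict_mem measurableSet_Ici] with r hr using hle r hr
  refine hint.trans ?_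
  rw [integral_const_mul]
  have hmono : ∫ r in Set.Ici δ, r ^ 17 * thermalWeight θ (b * c * r) ≤
      1 / (b * c) ^ 18 * G 17 θ := by
    rw [← e17]
    refine setIntegral_mono_set i17 ?_ sub.eventuallyLE
    filter_upwards [ae_restrict_mem measurableSet_Ioi] with r hr using snn r hr
  -- The eighteen inverse powers of `b` exceed the five of the leading term, and the higher moment
  -- is bounded by the one in the leading term, uniformly in the ratio of momentum and temperature.
  have hG : G 17 θ ≤ (Nat.factorial 17 : ℝ) * G 4 θ := G_le_G (by norm_num) (by norm_num) hθ
  have hG4 := G_four_le_energyMass hb0 hκ hθ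
  have hG40 := G_nonneg (n := 4) hθ
  have hG400 : 0 ≤ 1 / b ^ 5 * G 4 θ := by positivity
  have hm := energyMass_nonneg hb0 hκ hθ
  have hb13 : 1 / b ^ 13 ≤ 1 / b ^ 2 :=
    one_div_le_one_div_of_le (by positivity) (pow_le_pow_right₀ hb.le (by norm_num))
  set N := (Nat.factorial 17 : ℝ) with hN
  have hN0 : 0 ≤ N := by positivity
  calc _ ≤ C * κ * ((1 + δ) / δ) ^ 17 * (1 / (b * c) ^ 18 * (N * G 4 θ)) := by
        gcongr
        exact hmono.trans (by gcongr)
    _ = C * κ * ((1 + δ) / δ) ^ 17 * (N / c ^ 18) * (1 / b ^ 13) * (1 / b ^ 5 * G 4 θ) := by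
        field_simp
    _ ≤ C * κ * ((1 + δ) / δ) ^ 17 * (N / c ^ 18) * (1 / b ^ 2) * energyMass b κ θ := by
        gcongr
    _ = C * (1 * N * ((1 + δ) / δ) ^ 17 / c ^ 18) * (1 / b ^ 2) * (κ * energyMass b κ θ) := by
        ring
    _ ≤ C * (1 * N * ((1 + δ) / δ) ^ 17 / c ^ 18) * (1 / b ^ 2) *
          (2 * (9 / 16 * κ * energyMass b κ θ)) := by
        refine mul_le_mul_of_nonneg_left ?_ (by positivity)
        have : 0 ≤ κ * energyMass b κ θ := by positivity
        linarith
    _ = _ := by ring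

/-- The asymptotics of the damping integral, uniformly over profiles with given constants. -/
theorem exists_core_estimate {a c M δ η : ℝ} (hc : 0 < c) (hδ0 : 0 < δ) (hM : 1 ≤ M) :
    ∃ C, 0 ≤ C ∧ ∀ (f f₁ f₂ : ℝ → ℝ), IsProfile a c M δ η f f₁ f₂ →
    ∀ b κ : ℝ, 1 < b → 0 < κ → κ ≤ η →
      (∀ ε, 0 < ε → coreIntegral f b κ ε ≠ ⊤) ∧
      ∃ Λ, Tendsto (fun ε => (coreIntegral f b κ ε).toReal) (𝓝[>] 0) (𝓝 Λ) ∧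
        |Λ - 9 / 16 * κ * energyMass b κ (b * disp f κ)| ≤
          C * (1 / b ^ 2 + κ ^ 2) * (9 / 16 * κ * energyMass b κ (b * disp f κ)) := by
  obtain ⟨C₁, hC₁, H₁⟩ := IsProfile.exists_inner_limit_small M hM
  obtain ⟨C₂, hC₂, H₂⟩ := IsProfile.exists_inner_limit_large (a := a) (η := η) hc hδ0 hM
  set N := 2 * (Nat.factorial 17 : ℝ) * ((1 + δ) / δ) ^ 17 / c ^ 18 with hN
  have hN0 : 0 ≤ N := by positivity
  refine ⟨C₁ * 2880 + 1440 / δ ^ 2 + C₂ * N, by positivity, ?_⟩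
  intro f f₁ f₂ h b κ hb hκ hκη
  have hb0 : 0 < b := by linarith
  obtain ⟨g, hg, hgb⟩ := h.exists_inner_bound hb0 hκ hκη
  have hθ : 0 ≤ b * disp f κ := (mul_pos hb0 (h.disp_pos hκ)).le
  have hlead : 0 ≤ 9 / 16 * κ * energyMass b κ (b * disp f κ) := by
    have := energyMass_nonneg hb0 hκ hθ
    positivity
  set lead := 9 / 16 * κ * energyMass b κ (b * disp f κ) with hleade
  have hcore : ∀ ε, 0 < ε → coreIntegral f b κ ε
      = ∫⁻ r in Set.Ioi 0, ENNReal.ofReal (innerIntegral f b κ ε r) := fun ε hε =>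
    setLIntegral_congr_fun measurableSet_Ioi fun r hr => h.lintegral_inner hb0 hκ hκη hε hr
  have hii : ∀ ε, 0 < ε → IntegrableOn (innerIntegral f b κ ε) (Set.Ioi 0) := by
    intro ε hε
    refine Integrable.mono' hg (h.aestronglyMeasurable_innerIntegral hb0 hκ hκη hε) ?_
    filter_upwards [ae_restrict_mem measurableSet_Ioi] with r hr
    rw [Real.norm_of_nonneg (h.innerIntegral_nonneg hb0 hκ hε hr)]
    exact hgb ε r hε hr
  have hcore2 : ∀ ε, 0 < ε → coreIntegral f b κ ε
      = ENNReal.ofReal (∫ r in Set.Ioi 0, innerIntegral f b κ ε r) := by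
    intro ε hε
    rw [hcore ε hε, ofReal_integral_eq_lintegral_ofReal (hii ε hε)]
    filter_upwards [ae_restrict_mem measurableSet_Ioi] with r hr
      using h.innerIntegral_nonneg hb0 hκ hε hr
  have hcore3 : ∀ ε, 0 < ε → (coreIntegral f b κ ε).toReal
      = ∫ r in Set.Ioi 0, innerIntegral f b κ ε r := by
    intro ε hε
    rw [hcore2 ε hε, ENNReal.toReal_ofReal]
    exact setIntegral_nonneg measurableSet_Ioi fun r hr => h.innerIntegral_nonneg hb0 hκ hε hr
  refine ⟨fun ε hε => by rw [hcore2 ε hε]; exact ENNReal.ofReal_ne_top, ?_⟩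
  have hex : ∀ r : ℝ, ∃ L, 0 < r →
      Tendsto (fun ε => innerIntegral f b κ ε r) (𝓝[>] 0) (𝓝 L) ∧ 0 ≤ L ∧
      (r < δ → |L - modelDensity f f₁ b κ r| ≤ C₁ * (r + κ) ^ 2 * modelDensity f f₁ b κ r) ∧
      (δ ≤ r → L ≤ C₂ * κ * ((1 + r) ^ 17 * thermalWeight (b * disp f κ) (b * disp f r))) := by
    intro r
    rcases le_or_gt r 0 with hr | hr
    · exact ⟨0, fun hr' => absurd hr' (not_lt.2 hr)⟩
    rcases lt_or_ge r δ with hrδ | hrδ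
    · obtain ⟨L, a1, a2, a3⟩ := H₁ a c δ η f f₁ f₂ h b κ r hb0 hκ hκη hr hrδ
      exact ⟨L, fun _ => ⟨a1, a2, fun _ => a3, fun h' => absurd hrδ (not_lt.2 h')⟩⟩
    · obtain ⟨L, a1, a2, a3⟩ := H₂ f f₁ f₂ h b κ r hb0 hκ hκη hrδ
      exact ⟨L, fun _ => ⟨a1, a2, fun h' => absurd h' (not_lt.2 hrδ), fun _ => a3⟩⟩
  choose L hL using hex
  have hev : ∀ᶠ ε : ℝ in 𝓝[>] 0, 0 < ε := self_mem_nhdsWithin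
  have hdom : Tendsto (fun ε => ∫ r in Set.Ioi 0, innerIntegral f b κ ε r) (𝓝[>] 0)
      (𝓝 (∫ r in Set.Ioi 0, L r)) := by
    refine tendsto_integral_filter_of_dominated_convergence g ?_ ?_ hg ?_
    · filter_upwards [hev] with ε hε using h.aestronglyMeasurable_innerIntegral hb0 hκ hκη hε
    · filter_upwards [hev] with ε hε
      filter_upwards [ae_restrict_mem measurableSet_Ioi] with r hr
      rw [Real.norm_of_nonneg (h.innerIntegral_nonneg hb0 hκ hε hr)]
      exact hgb ε r hε hr
    · filter_upwards [ae_restrict_mem measurableSet_Ioi] with r hr using (hL r hr).1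
  refine ⟨∫ r in Set.Ioi 0, L r, hdom.congr' ?_, ?_⟩
  · filter_upwards [hev] with ε hε using (hcore3 ε hε).symm
  -- The pointwise limit `L` is measurable, as it is also a limit along a sequence of widths.
  have hLm : AEStronglyMeasurable L (volume.restrict (Set.Ioi 0)) := by
    have hseq : Tendsto (fun n : ℕ => (1 : ℝ) / (n + 1)) atTop (𝓝[>] 0) :=
      tendsto_nhdsWithin_iff.2 ⟨tendsto_one_div_add_atTop_nhds_zero_nat,
        Eventually.of_forall fun n => by
          have : (0 : ℝ) < 1 / (n + 1) := by positivity
          exact this⟩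
    refine aestronglyMeasurable_of_tendsto_ae atTop
      (f := fun n : ℕ => innerIntegral f b κ (1 / (n + 1)))
      (fun n => h.aestronglyMeasurable_innerIntegral hb0 hκ hκη (by positivity)) ?_
    filter_upwards [ae_restrict_mem measurableSet_Ioi] with r hr using (hL r hr).1.comp hseq
  have hLi : IntegrableOn L (Set.Ioi 0) := by
    refine Integrable.mono' hg hLm ?_
    filter_upwards [ae_restrict_mem measurableSet_Ioi] with r hr
    rw [Real.norm_of_nonneg (hL r hr).2.1]
    refine le_of_tendsto (hL r hr).1 ?_
    filter_upwards [hev] with ε hε using hgb ε r hε hr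
  have sub1 : Set.Ioo 0 δ ⊆ Set.Ioi 0 := fun y hy => hy.1
  have sub2 : Set.Ici δ ⊆ Set.Ioi 0 := fun y hy => hδ0.trans_le hy
  have split : ∫ r in Set.Ioi 0, L r = (∫ r in Set.Ioo 0 δ, L r) + ∫ r in Set.Ici δ, L r := by
    rw [← Set.Ioo_union_Ici_eq_Ioi hδ0, setIntegral_union _ measurableSet_Ici
      (hLi.mono_set sub1) (hLi.mono_set sub2)]
    exact Set.disjoint_left.2 fun y hy hy' => not_le.2 hy.2 hy'
  have htail := h.tail_estimate hb hκ hC₂ (L := L) (fun r hr => (hL r (sub2 hr)).2.1)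
    (fun r hr => (hL r (sub2 hr)).2.2.2 hr)
  have htail0 : 0 ≤ ∫ r in Set.Ici δ, L r :=
    setIntegral_nonneg measurableSet_Ici fun r hr => (hL r (sub2 hr)).2.1
  obtain ⟨im, em, im2, em2⟩ := h.model_estimate hb0 hκ
  rw [← hN, ← hleade] at htail
  rw [← hleade] at em em2
  have hdiff : |(∫ r in Set.Ioo 0 δ, L r) - ∫ r in Set.Ioo 0 δ, modelDensity f f₁ b κ r|
      ≤ C₁ * (2880 * (1 / b ^ 2 + κ ^ 2) * lead) := by
    rw [← integral_sub (hLi.mono_set sub1) im]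
    have hn := norm_integral_le_of_norm_le (f := fun r => L r - modelDensity f f₁ b κ r)
      (im2.const_mul C₁) ?_
    · refine (Real.norm_eq_abs _ ▸ hn).trans ?_
      rw [integral_const_mul]
      gcongr
    · filter_upwards [ae_restrict_mem measurableSet_Ioo] with r hr
      rw [← mul_assoc]
      exact (hL r hr.1).2.2.1 hr.2
  have hκb : 1 / b ^ 2 ≤ 1 / b ^ 2 + κ ^ 2 := by linarith [sq_nonneg κ]
  have em' : |(∫ r in Set.Ioo 0 δ, modelDensity f f₁ b κ r) - lead|
      ≤ 1440 / δ ^ 2 * (1 / b ^ 2 + κ ^ 2) * lead := em.trans (by gcongr)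
  have htail' : ∫ r in Set.Ici δ, L r ≤ C₂ * N * (1 / b ^ 2 + κ ^ 2) * lead :=
    htail.trans (by gcongr)
  rw [split]
  rw [abs_le] at hdiff em' ⊢
  constructor <;> nlinarith

/-! ### Uniform constants for the rescaled profiles -/

/-- The profile `φ` in units in which the chemical potential is one; `s` is `√ν`. -/
def rescaled (φ : ℝ → ℝ) (s r : ℝ) : ℝ := φ (s * r)

theorem hasDerivAt_rescaled {φ : ℝ → ℝ} {d s r : ℝ} (hφ : HasDerivAt φ d (s * r)) :
    HasDerivAt (rescaled φ s) (s * d) r :=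
  (hφ.comp r ((hasDerivAt_id r).const_mul s)).congr_deriv (by ring)

/-- A positive continuous function of the form `φ(x) + x²/(4V)` with bounded `φ` is bounded below
by a positive constant. -/
theorem exists_sq_le_add_sq {φ : ℝ → ℝ} {V M : ℝ} (hV : 0 < V) (hφ : Continuous φ)
    (hM : ∀ x, |φ x| ≤ M) (hpos : ∀ x, 0 < φ x + x ^ 2 / (4 * V)) :
    ∃ c, 0 < c ∧ ∀ x, c ^ 2 ≤ φ x + x ^ 2 / (4 * V) := by
  have hM0 : 0 ≤ M := (abs_nonneg _).trans (hM 0)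
  -- Beyond `R` the quadratic term alone exceeds `M + 1`.
  set R := Real.sqrt (4 * V * (M + 1)) with hR
  have hR2 : R ^ 2 = 4 * V * (M + 1) := Real.sq_sqrt (by positivity)
  have hR0 : 0 ≤ R := Real.sqrt_nonneg _
  obtain ⟨x₀, -, h₀⟩ := isCompact_Icc.exists_isMinOn (Set.nonempty_Icc.2 (by linarith : -R ≤ R))
    (by fun_prop : ContinuousOn (fun x => φ x + x ^ 2 / (4 * V)) (Set.Icc (-R) R))
  have hp := hpos x₀
  set m := φ x₀ + x₀ ^ 2 / (4 * V) with hm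
  have hc0 : 0 < min 1 m := lt_min one_pos hp
  have hc1 : min 1 m ^ 2 ≤ min 1 m := by nlinarith [min_le_left 1 m]
  refine ⟨min 1 m, hc0, fun x => hc1.trans ?_⟩
  by_cases hx : x ∈ Set.Icc (-R) R
  · exact (min_le_right _ _).trans (h₀ hx)
  · refine (min_le_left _ _).trans ?_
    have h1 : R ^ 2 ≤ x ^ 2 := by
      rw [sq_le_sq, abs_of_nonneg hR0]
      by_contra! hcon
      exact hx (abs_le.1 hcon.le)
    have h2 : M + 1 ≤ x ^ 2 / (4 * V) := by
      rw [le_div_iff₀ (by positivity)]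
      linarith
    linarith [(abs_le.1 (hM x)).1]

/-- Away from the origin, the rescaled dispersion relation either varies little on a short interval
or has a derivative bounded away from zero, uniformly in the scale. On bounded sets this is uniform
continuity; at large momenta it is the assumption on the lower limit. -/
theorem exists_dichotomy {φ : ℝ → ℝ} {V M c₁ c₂ X δ : ℝ} (hV : 0 < V) (hφ : ContDiff ℝ 1 φ)
    (hM1 : 1 ≤ M) (hM : ∀ x, |φ x| ≤ M) (hc₁ : 0 < c₁)
    (hlow : ∀ x, c₁ ^ 2 ≤ φ x + x ^ 2 / (4 * V)) (hc₂ : 0 < c₂)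
    (hX : ∀ x, X ≤ x → c₂ ≤ x ^ 2 / (2 * V) + φ x + x * deriv φ x / 2) (hδ : 0 < δ) :
    ∃ c, 0 < c ∧ ∃ η, 0 < η ∧ η ≤ δ / 2 ∧ ∀ s, 0 < s → s ^ 2 ≤ V → ∀ r κ, δ ≤ r → 0 < κ → κ ≤ η →
    (∀ u ∈ Set.Icc (r - κ) (r + κ),
      |disp (rescaled φ s) u - disp (rescaled φ s) r| ≤ κ / 2) ∨
    (∀ u ∈ Set.Icc (r - κ) (r + κ),
      c / (1 + u) ≤ dispDeriv (rescaled φ s) (fun r => s * deriv φ (s * r)) u) ∨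
    (∀ u ∈ Set.Icc (r - κ) (r + κ),
      dispDeriv (rescaled φ s) (fun r => s * deriv φ (s * r)) u ≤ -(c / (1 + u))) := by
  have hφc : Continuous φ := hφ.continuous
  have hφ1 : Continuous (deriv φ) := hφ.continuous_deriv le_rfl
  have hφd : ∀ x, HasDerivAt φ (deriv φ x) x := fun x =>
    (hφ.differentiable (by norm_num) x).hasDerivAt
  have hpos : ∀ s r, s ^ 2 ≤ V → c₁ ^ 2 ≤ rescaled φ s r + r ^ 2 / 4 := by
    intro s r hs
    refine (hlow (s * r)).trans ?_
    unfold rescaled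
    gcongr φ (s * r) + ?_
    rw [div_le_div_iff₀ (by positivity) (by norm_num), mul_pow]
    nlinarith [mul_le_mul_of_nonneg_right hs (sq_nonneg r)]
  have hvel : ∀ s u, s ^ 2 ≤ V → 0 < velocity (rescaled φ s) u := fun s u hs =>
    Real.sqrt_pos.2 ((pow_pos hc₁ 2).trans_le (hpos s u hs))
  obtain ⟨Ψ, hΨ⟩ : ∃ Ψ, ∀ x ∈ Set.Icc 0 X, |φ x + x * deriv φ x / 2| ≤ Ψ := by
    obtain ⟨Ψ, hΨ⟩ := (isCompact_Icc (a := (0 : ℝ)) (b := X)).exists_bound_of_continuousOn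
      (by fun_prop : ContinuousOn (fun x => φ x + x * deriv φ x / 2) (Set.Icc 0 X))
    exact ⟨Ψ, hΨ⟩
  -- Beyond `R` the numerator of the group velocity is bounded below by a positive constant, for every
  -- scale `s`: if `s u ≥ X` this is the hypothesis `hX`, since `u²/2 ≥ (s u)²/(2V)`; otherwise the
  -- other terms are bounded by `Ψ` and `u²/2` exceeds it.
  set R := Real.sqrt (2 * (|Ψ| + 1)) with hR
  have hR2 : R ^ 2 = 2 * (|Ψ| + 1) := Real.sq_sqrt (by positivity)
  have hR0 : 0 ≤ R := Real.sqrt_nonneg _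
  have hfar : ∀ s u, 0 < s → s ^ 2 ≤ V → R ≤ u →
      min c₂ 1 / M / (1 + u) ≤ dispDeriv (rescaled φ s) (fun r => s * deriv φ (s * r)) u := by
    intro s u hs hsV hu
    have hu0 : 0 ≤ u := hR0.trans hu
    have hsu : 0 ≤ s * u := by positivity
    have hnum : min c₂ 1 ≤ u ^ 2 / 2 + rescaled φ s u + u * (s * deriv φ (s * u)) / 2 := by
      unfold rescaled
      rcases le_or_gt X (s * u) with hx | hx
      · refine (min_le_left _ _).trans ((hX _ hx).trans ?_)
        have : (s * u) ^ 2 / (2 * V) ≤ u ^ 2 / 2 := by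
          rw [div_le_div_iff₀ (by positivity) (by norm_num), mul_pow]
          nlinarith [mul_le_mul_of_nonneg_right hsV (sq_nonneg u)]
        nlinarith
      · refine (min_le_right _ _).trans ?_
        have h1 := (abs_le.1 (hΨ _ ⟨hsu, hx.le⟩)).1
        have h2 : R ^ 2 ≤ u ^ 2 := pow_le_pow_left₀ hR0 hu 2
        have h3 := le_abs_self Ψ
        nlinarith
    have hv := hvel s u hsV
    have hv2 : velocity (rescaled φ s) u ≤ M * (1 + u) := by
      refine Real.sqrt_le_iff.2 ⟨by positivity, ?_⟩
      have h1 := (abs_le.1 (hM (s * u))).2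
      have h2 : M ≤ M ^ 2 := by nlinarith
      have h3 : u ^ 2 ≤ M ^ 2 * u ^ 2 := by nlinarith [sq_nonneg u]
      have h4 : 0 ≤ M ^ 2 * u := by positivity
      unfold rescaled
      nlinarith
    have hm : 0 < min c₂ 1 := lt_min hc₂ one_pos
    unfold dispDeriv
    rw [div_div]
    exact div_le_div₀ (hm.le.trans hnum) hnum hv hv2
  set K : Set (ℝ × ℝ) := Set.Icc 0 (Real.sqrt V) ×ˢ Set.Icc 0 (R + 2) with hK
  have hKc : IsCompact K := isCompact_Icc.prod isCompact_Icc
  have hsK : ∀ s, 0 ≤ s → s ≤ Real.sqrt V → s ^ 2 ≤ V := fun s hs hsV => by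
    have := pow_le_pow_left₀ hs hsV 2
    rwa [Real.sq_sqrt hV.le] at this
  have hcont : ContinuousOn (fun p : ℝ × ℝ => dispDeriv (rescaled φ p.1)
      (fun r => p.1 * deriv φ (p.1 * r)) p.2) K := by
    unfold dispDeriv velocity rescaled
    refine ContinuousOn.div (by fun_prop) (by fun_prop) fun p hp => ?_
    exact (hvel p.1 p.2 (hsK _ hp.1.1 hp.1.2)).ne'
  obtain ⟨η₀, hη₀, hunif⟩ := Metric.uniformContinuousOn_iff.1
    (hKc.uniformContinuousOn_of_continuous hcont) (1 / 8) (by norm_num)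
  refine ⟨min (min c₂ 1 / M) (1 / 8), by positivity, min (min (δ / 2) 1) (η₀ / 2), by positivity,
    (min_le_left _ _).trans (min_le_left _ _), fun s hs hsV r κ hr hκ hκη => ?_⟩
  have k1 : κ ≤ δ / 2 := hκη.trans ((min_le_left _ _).trans (min_le_left _ _))
  have k2 : κ ≤ 1 := hκη.trans ((min_le_left _ _).trans (min_le_right _ _))
  have k3 : κ ≤ η₀ / 2 := hκη.trans (min_le_right _ _)
  have hu0 : ∀ u ∈ Set.Icc (r - κ) (r + κ), 0 ≤ u := fun u hu => by linarith [hu.1]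
  rcases le_or_gt (R + 1) r with hrR | hrR
  · refine Or.inr (Or.inl fun u hu => ?_)
    have := hu0 u hu
    refine le_trans ?_ (hfar s u hs hsV (by linarith [hu.1]))
    gcongr
    exact min_le_left _ _
  set F := fun u => dispDeriv (rescaled φ s) (fun r => s * deriv φ (s * r)) u with hF
  have hsV' : s ≤ Real.sqrt V := Real.le_sqrt_of_sq_le hsV
  have hmem : ∀ u ∈ Set.Icc (r - κ) (r + κ), (s, u) ∈ K := fun u hu =>
    ⟨⟨hs.le, hsV'⟩, ⟨hu0 u hu, by linarith [hu.2]⟩⟩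
  have hrm : r ∈ Set.Icc (r - κ) (r + κ) := ⟨by linarith, by linarith⟩
  have hclose : ∀ u ∈ Set.Icc (r - κ) (r + κ), |F u - F r| < 1 / 8 := by
    intro u hu
    have h1 : |u - r| ≤ κ := abs_le.2 ⟨by linarith [hu.1], by linarith [hu.2]⟩
    have h2 : dist ((s, u) : ℝ × ℝ) (s, r) < η₀ := by
      rw [Prod.dist_eq, dist_self, max_eq_right dist_nonneg, Real.dist_eq]
      linarith
    have h3 := hunif (s, u) (hmem u hu) (s, r) (hmem r hrm) h2
    rwa [Real.dist_eq] at h3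
  have hcu : ∀ u ∈ Set.Icc (r - κ) (r + κ), min (min c₂ 1 / M) (1 / 8) / (1 + u) ≤ 1 / 8 := by
    intro u hu
    have := hu0 u hu
    have h1 := min_le_right (min c₂ 1 / M) (1 / 8)
    rw [div_le_iff₀ (by positivity)]
    nlinarith
  -- The group velocity changes by less than `1/8` on the interval, so it is at most `1/2` throughout
  -- or at least `1/8`, according to its size at the midpoint.
  rcases le_or_gt |F r| (1 / 4) with hFr | hFr
  · refine Or.inl fun u hu => ?_
    have hb : ∀ x ∈ Set.Icc (r - κ) (r + κ), ‖F x‖ ≤ 1 / 2 := by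
      intro x hx
      have h1 := hclose x hx
      have h2 := abs_sub_abs_le_abs_sub (F x) (F r)
      rw [Real.norm_eq_abs]
      linarith
    have hd : ∀ x ∈ Set.Icc (r - κ) (r + κ),
        HasDerivWithinAt (disp (rescaled φ s)) (F x) (Set.Icc (r - κ) (r + κ)) x := fun x _ =>
      (hasDerivAt_disp_of_pos (f₁ := fun r => s * deriv φ (s * r))
        (hasDerivAt_rescaled (hφd (s * x)))
        ((pow_pos hc₁ 2).trans_le (hpos s x hsV))).hasDerivWithinAt
    have := Convex.norm_image_sub_le_of_norm_hasDerivWithin_le hd hb (convex_Icc _ _) hrm hu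
    rw [Real.norm_eq_abs, Real.norm_eq_abs] at this
    have h3 : |u - r| ≤ κ := abs_le.2 ⟨by linarith [hu.1], by linarith [hu.2]⟩
    linarith
  · rcases le_or_gt 0 (F r) with h0 | h0
    · refine Or.inr (Or.inl fun u hu => (hcu u hu).trans ?_)
      rw [abs_of_nonneg h0] at hFr
      have := (abs_lt.1 (hclose u hu)).1
      change 1 / 8 ≤ F u
      linarith
    · refine Or.inr (Or.inr fun u hu => ?_)
      rw [abs_of_neg h0] at hFr
      have := (abs_lt.1 (hclose u hu)).2
      have := hcu u hu
      change F u ≤ _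
      linarith

/-- The rescalings `r ↦ φ(√ν r)` of a profile are admissible with constants uniform in `ν ≤ V`. -/
theorem exists_isProfile {φ : ℝ → ℝ} {V M₀ c₂ X : ℝ} (hV : 0 < V) (hφ : ContDiff ℝ 1 φ)
    (h2 : ContDiffAt ℝ 2 φ 0) (h0 : φ 0 = 1) (heven : ∀ x, φ (-x) = φ x)
    (hM : ∀ x, |φ x| ≤ M₀) (hpos : ∀ x, 0 < φ x + x ^ 2 / (4 * V))
    (hconv : -(1 / 2) < V * deriv (deriv φ) 0) (hc₂ : 0 < c₂)
    (hX : ∀ x, X ≤ x → c₂ ≤ x ^ 2 / (2 * V) + φ x + x * deriv φ x / 2) :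
    ∃ a c M δ η, 0 < c ∧ 0 < δ ∧ 1 ≤ M ∧ 0 < η ∧ ∀ s, 0 < s → s ^ 2 ≤ V →
      IsProfile a c M δ η (rescaled φ s) (fun r => s * deriv φ (s * r))
        (fun r => s ^ 2 * deriv (deriv φ) (s * r)) := by
  have hφ1 : Continuous (deriv φ) := hφ.continuous_deriv le_rfl
  have hφd : ∀ x, HasDerivAt φ (deriv φ x) x := fun x =>
    (hφ.differentiable (by norm_num) x).hasDerivAt
  obtain ⟨c₁, hc₁, hlow⟩ := exists_sq_le_add_sq hV hφ.continuous hM hpos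
  set A := deriv (deriv φ) 0 with hA
  -- Half of the margin in the convexity hypothesis at `ν = V`; the other half allows for the variation
  -- of the second derivative near the origin.
  set a := min (1 / 4) ((1 / 2 + V * A) / 2) with ha
  have ha0 : 0 < a := lt_min (by norm_num) (by linarith)
  have ha4 : a ≤ 1 / 4 := min_le_left _ _
  have ha2 : 2 * a ≤ 1 / 2 + V * A := by linarith [min_le_right (1 / 4) ((1 / 2 + V * A) / 2)]
  have hd1 : ContDiffAt ℝ 1 (deriv φ) 0 := h2.derivWithin (by norm_num)
  obtain ⟨ρ, hρ, hρ2⟩ : ∃ ρ > 0, ∀ x, |x| < ρ →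
      DifferentiableAt ℝ (deriv φ) x ∧ |deriv (deriv φ) x - A| < a / V := by
    have e1 : ∀ᶠ x in 𝓝 (0 : ℝ), DifferentiableAt ℝ (deriv φ) x := by
      filter_upwards [hd1.eventually (by norm_num)] with x hx
      exact hx.differentiableAt (by norm_num)
    have c1 : ContDiffAt ℝ 0 (deriv (deriv φ)) 0 := hd1.derivWithin (by norm_num)
    have e2 := Metric.continuousAt_iff'.1 c1.continuousAt (a / V) (by positivity)
    obtain ⟨ρ, hρ, h⟩ := Metric.eventually_nhds_iff.1 (e1.and e2)
    refine ⟨ρ, hρ, fun x hx => ?_⟩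
    have := h (y := x) (by simpa using hx)
    simpa [Real.dist_eq] using this
  have hφ10 : deriv φ 0 = 0 := by
    have h1 : HasDerivAt (fun x => φ (-x)) (-deriv φ 0) 0 := by
      have := (hφd (-0)).scomp (0 : ℝ) (hasDerivAt_neg (0 : ℝ))
      simpa [Function.comp_def] using this
    simp only [heven] at h1
    linarith [h1.unique (hφd 0)]
  set M := max 1 (max M₀ (V * |A| + 1)) with hMe
  have hM1 : 1 ≤ M := le_max_left _ _
  have hM2 : M₀ ≤ M := (le_max_left _ _).trans (le_max_right _ _)
  have hM3 : V * |A| + 1 ≤ M := (le_max_right _ _).trans (le_max_right _ _)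
  have hMb : ∀ x, |φ x| ≤ M := fun x => (hM x).trans hM2
  -- The first bound keeps `s r` in the ball of radius `ρ` for `r ≤ 2δ`, the second is the field
  -- `small`.
  set δ := min (ρ / (4 * Real.sqrt V)) (Real.sqrt a / (4 * (M + 2))) with hδe
  have hsV0 := Real.sqrt_pos.2 hV
  have hsa0 := Real.sqrt_pos.2 ha0
  have hδ : 0 < δ := lt_min (by positivity) (by positivity)
  have hδ1 : 4 * Real.sqrt V * δ ≤ ρ := by
    have := min_le_left (ρ / (4 * Real.sqrt V)) (Real.sqrt a / (4 * (M + 2)))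
    rw [← hδe, le_div_iff₀ (by positivity)] at this
    linarith
  have hδ2 : 4 * (M + 2) * δ ≤ Real.sqrt a := by
    have := min_le_right (ρ / (4 * Real.sqrt V)) (Real.sqrt a / (4 * (M + 2)))
    rw [← hδe, le_div_iff₀ (by positivity)] at this
    linarith
  obtain ⟨c₃, hc₃, η, hη, hηδ, hdich⟩ := exists_dichotomy hV hφ hM1 hMb hc₁ hlow hc₂ hX hδ
  refine ⟨a, min c₁ c₃, M, δ, η, lt_min hc₁ hc₃, hδ, hM1, hη, fun s hs hsV => ?_⟩
  have hsV' : s ≤ Real.sqrt V := Real.le_sqrt_of_sq_le hsV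
  have hnear : ∀ r, 0 ≤ r → r ≤ 2 * δ → |s * r| < ρ := by
    intro r hr hr2
    rw [abs_of_nonneg (by positivity)]
    have : s * r ≤ Real.sqrt V * (2 * δ) := by gcongr
    nlinarith [mul_pos hsV0 hδ]
  have hf2 : ∀ r, 0 ≤ r → r ≤ 2 * δ → |s ^ 2 * deriv (deriv φ) (s * r) - s ^ 2 * A| ≤ a := by
    intro r hr hr2
    have := (hρ2 _ (hnear r hr hr2)).2.le
    rw [← mul_sub, abs_mul, abs_of_nonneg (sq_nonneg s)]
    calc _ ≤ V * (a / V) := by gcongr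
      _ = a := by field_simp
  have hcc : ∀ u : ℝ, 0 ≤ u → min c₁ c₃ / (1 + u) ≤ c₃ / (1 + u) := fun u hu => by
    gcongr
    exact min_le_right _ _
  refine
    { a_pos := ha0
      a_le := by linarith
      c_pos := lt_min hc₁ hc₃
      one_le_M := hM1
      δ_pos := hδ
      η_le := hηδ
      small := ?_
      hasDerivAt := fun r => hasDerivAt_rescaled (hφd (s * r))
      continuous_deriv := by fun_prop
      hasDerivAt_deriv := fun r hr hr2 => ?_
      zero := by simp [rescaled, h0]
      deriv_zero := by simp [hφ10]
      bound := fun r => hMb _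
      lower := fun r => ?_
      deriv2_lower := fun r hr hr2 => ?_
      deriv2_bound := fun r hr hr2 => ?_
      dichotomy := fun r κ hr hκ hκη => ?_ }
  · have h1 := pow_le_pow_left₀ (by positivity) hδ2 2
    rw [Real.sq_sqrt ha0.le] at h1
    nlinarith
  · have h1 := (hρ2 _ (hnear r hr hr2)).1.hasDerivAt
    have h2 := (hasDerivAt_rescaled h1).const_mul s
    exact h2.congr_deriv (by ring)
  · have h1 : min c₁ c₃ ^ 2 ≤ c₁ ^ 2 :=
      pow_le_pow_left₀ (lt_min hc₁ hc₃).le (min_le_left _ _) 2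
    refine h1.trans ((hlow (s * r)).trans ?_)
    unfold rescaled
    gcongr φ (s * r) + ?_
    rw [div_le_div_iff₀ (by positivity) (by norm_num), mul_pow]
    nlinarith [mul_le_mul_of_nonneg_right hsV (sq_nonneg r)]
  · have h1 := (abs_le.1 (hf2 r hr hr2)).1
    have h2 : -(1 / 2) + 2 * a ≤ s ^ 2 * A := by
      rcases le_or_gt 0 A with hA0 | hA0
      · have : 0 ≤ s ^ 2 * A := by positivity
        linarith
      · have : V * A ≤ s ^ 2 * A := mul_le_mul_of_nonpos_right hsV hA0.le
        linarith
    linarith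
  · have h1 := hf2 r hr hr2
    have h2 := abs_sub_abs_le_abs_sub (s ^ 2 * deriv (deriv φ) (s * r)) (s ^ 2 * A)
    have h3 : |s ^ 2 * A| ≤ V * |A| := by
      rw [abs_mul, abs_of_nonneg (sq_nonneg s)]
      gcongr
    linarith
  · have hη2 : κ ≤ δ / 2 := hκη.trans hηδ
    rcases hdich s hs hsV r κ hr hκ hκη with h | h | h
    · exact Or.inl h
    · exact Or.inr (Or.inl fun u hu => (hcc u (by linarith [hu.1])).trans (h u hu))
    · exact Or.inr (Or.inr fun u hu =>
        (h u hu).trans (neg_le_neg (hcc u (by linarith [hu.1]))))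

/-! ### The profile of a potential -/

/-- The Fourier transform inherits the rotation invariance of the potential. -/
theorem fourierTransform_isometry {v : Space → ℝ} (R : Space ≃ₗᵢ[ℝ] Space)
    (hv : (fun x => v (R x)) =ᵐ[volume] v) (p : Space) :
    fourierTransform v (R p) = fourierTransform v p := by
  unfold fourierTransform
  rw [← R.measurePreserving.integral_comp R.toHomeomorph.measurableEmbedding]
  refine integral_congr_ae ?_
  filter_upwards [hv] with x hx
  simp only [hx, LinearIsometryEquiv.inner_map_map]

theorem abs_vHat_le (v : Space → ℝ) (p : Space) : |vHat v p| ≤ ∫ x, |v x| := by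
  refine (Complex.abs_re_le_norm _).trans ((norm_integral_le_integral_norm _).trans (le_of_eq ?_))
  congr 1
  funext x
  rw [norm_mul, Complex.norm_real, Real.norm_eq_abs, Complex.norm_exp]
  simp

/-- The normalized interaction profile `v̂(r)/v̂(0)`. -/
noncomputable def profile (v : Space → ℝ) (r : ℝ) : ℝ := vHatRadial v r / vHat v 0

namespace PotentialAssumptions

variable {v : Space → ℝ} {V : ℝ}

theorem vHat_eq_radial (hv : PotentialAssumptions v V) (p : Space) :
    vHat v p = vHatRadial v ‖p‖ := by
  obtain ⟨R, hR⟩ := exists_isometry_axis p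
  unfold vHatRadial vHat
  rw [← fourierTransform_isometry R (hv.rotationInvariant R) (‖p‖ • _), hR]

/-- The hypotheses on the potential at `ν = V` make all the rescaled profiles with `ν ≤ V`
admissible, with common constants. -/
theorem exists_isProfile (hv : PotentialAssumptions v V) (hV : 0 < V) :
    ∃ a c M δ η, 0 < c ∧ 0 < δ ∧ 1 ≤ M ∧ 0 < η ∧ ∀ s, 0 < s → s ^ 2 ≤ V →
      ∃ f₁ f₂, IsProfile a c M δ η (rescaled (profile v) s) f₁ f₂ := by
  have h0 := hv.vHat_zero_pos
  have hn : ∀ r : ℝ, ‖r • (EuclideanSpace.single 0 1 : Space)‖ = |r| := fun r => by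
    rw [norm_smul]; simp
  have hlin : ContDiff ℝ ⊤ fun r : ℝ => r • (EuclideanSpace.single 0 1 : Space) := by fun_prop
  have hrad : ContDiff ℝ 1 (vHatRadial v) := hv.contDiff_one.comp (hlin.of_le (by simp))
  have hrad5 : ContDiffAt ℝ 5 (vHatRadial v) 0 := by
    refine ContDiffAt.comp (0 : ℝ) (g := vHat v) ?_ ((hlin.of_le (by simp)).contDiffAt)
    simpa using hv.contDiffAt_zero
  have hder : deriv (profile v) = fun r => deriv (vHatRadial v) r / vHat v 0 := by
    funext r
    exact deriv_div_const _
  have hder2 : deriv (deriv (profile v)) 0 = deriv (deriv (vHatRadial v)) 0 / vHat v 0 := by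
    rw [hder]
    exact deriv_div_const _
  obtain ⟨c₂, hc₂, hc₂'⟩ := EReal.lt_iff_exists_real_btwn.1 (hv.liminf_stationarity V hV le_rfl)
  obtain ⟨X, hX⟩ := eventually_atTop.1 (eventually_lt_of_lt_liminf hc₂')
  have key := BoseGas.exists_isProfile (φ := profile v) (M₀ := (∫ x, |v x|) / vHat v 0)
    (c₂ := c₂) (X := X) hV (hrad.div_const _) ((hrad5.div_const _).of_le (by norm_num))
    (by simp [profile, vHatRadial, h0.ne'])
    (fun x => by
      have e : ∀ y : ℝ, vHatRadial v y = vHatRadial v |y| := fun y => by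
        rw [← hn y, ← hv.vHat_eq_radial]
        rfl
      unfold profile
      rw [e (-x), e x, abs_neg])
    (fun x => by
      unfold profile vHatRadial
      rw [abs_div, abs_of_pos h0]
      gcongr
      exact abs_vHat_le v _)
    (fun x => by
      have h1 := hv.positivity V hV le_rfl (x • EuclideanSpace.single 0 1)
      rw [hn, sq_abs, neg_mul, neg_lt_iff_pos_add] at h1
      have e : profile v x + x ^ 2 / (4 * V)
          = (vHat v (x • EuclideanSpace.single 0 1) + vHat v 0 * (x ^ 2 / (4 * V))) / vHat v 0 := by
        unfold profile vHatRadial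
        field_simp
      rw [e]
      exact div_pos h1 h0)
    (by
      have := hv.convexity V hV le_rfl
      rw [hder2]
      convert this using 1
      ring)
    (by exact_mod_cast hc₂)
    (fun x hx => by
      have h1 : c₂ < stationarity v V x := by exact_mod_cast hX x hx
      refine h1.le.trans (le_of_eq ?_)
      rw [hder]
      unfold stationarity profile
      field_simp)
  obtain ⟨a, c, M, δ, η, h1, h2, h3, h4, h5⟩ := key
  exact ⟨a, c, M, δ, η, h1, h2, h3, h4, fun s hs hsV => ⟨_, _, h5 s hs hsV⟩⟩

end PotentialAssumptions

/-! ### Reduction to the rescaled problem -/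

/-- The approximate delta scales like the Dirac delta, up to a change of its width. -/
theorem approxDelta_mul {ν : ℝ} (hν : 0 < ν) (ε x : ℝ) :
    approxDelta ε (ν * x) = 1 / ν * approxDelta (ε / ν) x := by
  unfold approxDelta
  have h : (ν * x) ^ 2 + ε ^ 2 = ν ^ 2 * (x ^ 2 + (ε / ν) ^ 2) := by
    field_simp
  rw [h]
  rcases eq_or_ne (x ^ 2 + (ε / ν) ^ 2) 0 with h0 | h0
  · simp [h0]
  · field_simp

/-- The square of `c - s` is the coherence factor, and `c² - s² = 1`. -/
theorem bogoliubov_identities {ω E g : ℝ} (hω : 0 < ω) (hE : 0 < E) (hEg : E ^ 2 = ω ^ 2 + g ^ 2) :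
    0 < Real.sqrt (E + ω) / Real.sqrt (2 * ω) - Real.sqrt (E - ω) / Real.sqrt (2 * ω) ∧
    (Real.sqrt (E + ω) / Real.sqrt (2 * ω) - Real.sqrt (E - ω) / Real.sqrt (2 * ω)) ^ 2
      = (E - |g|) / ω ∧
    (Real.sqrt (E + ω) / Real.sqrt (2 * ω) - Real.sqrt (E - ω) / Real.sqrt (2 * ω)) *
      (Real.sqrt (E + ω) / Real.sqrt (2 * ω) + Real.sqrt (E - ω) / Real.sqrt (2 * ω)) = 1 := by
  have hωE : ω ≤ E := by
    refine le_of_sq_le_sq ?_ hE.le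
    rw [hEg]
    linarith [sq_nonneg g]
  have q1 := Real.sq_sqrt (by linarith : 0 ≤ E + ω)
  have q2 := Real.sq_sqrt (by linarith : 0 ≤ E - ω)
  have q3 := Real.sq_sqrt (by linarith : 0 ≤ 2 * ω)
  have p3 : 0 < Real.sqrt (2 * ω) := Real.sqrt_pos.2 (by linarith)
  have q4 : Real.sqrt (E + ω) * Real.sqrt (E - ω) = |g| := by
    rw [← Real.sqrt_mul (by linarith), ← Real.sqrt_sq_eq_abs]
    congr 1
    linear_combination hEg
  have q5 : Real.sqrt (E - ω) < Real.sqrt (E + ω) :=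
    Real.sqrt_lt_sqrt (by linarith) (by linarith)
  set x := Real.sqrt (E + ω)
  set y := Real.sqrt (E - ω)
  set z := Real.sqrt (2 * ω)
  refine ⟨?_, ?_, ?_⟩
  · rw [← sub_div]
    exact div_pos (by linarith) p3
  · rw [← sub_div, div_pow, q3, div_eq_div_iff (by positivity) hω.ne']
    linear_combination ω * q1 + ω * q2 - 2 * ω * q4
  · rw [← sub_div, ← add_div, div_mul_div_comm, ← sq, q3, div_eq_one_iff_eq (by positivity)]
    linear_combination q1 - q2

/-- The vertex in terms of the differences `c - s`, whose inverses are the sums `c + s`. -/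
theorem vertex_algebra {ck sk cp sp cq sq fk fp fq v₀ Ck Cp Cq ν : ℝ} (hv : 0 < v₀) (hν : 0 < ν)
    (hk0 : 0 < ck - sk) (hk1 : (ck - sk) ^ 2 = Ck) (hk2 : (ck - sk) * (ck + sk) = 1)
    (hp0 : 0 < cp - sp) (hp1 : (cp - sp) ^ 2 = Cp) (hp2 : (cp - sp) * (cp + sp) = 1)
    (hq0 : 0 < cq - sq) (hq1 : (cq - sq) ^ 2 = Cq) (hq2 : (cq - sq) * (cq + sq) = 1) :
    (Real.sqrt (ν / v₀) * (v₀ * fk * (sk - ck) * (cp * sq + cq * sp)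
      + v₀ * fp * (cp - sp) * (ck * cq + sk * sq)
      + v₀ * fq * (cq - sq) * (cp * ck + sp * sk))) ^ 2 = ν * v₀ *
    ((fp * Cp + fq * Cq - fk * Ck + Ck * Cp * Cq * (fk + fp + fq)) ^ 2 / (4 * (Ck * Cp * Cq))) := by
  set x := ck - sk with hx
  set y := cp - sp with hy
  set z := cq - sq with hz
  have ex : ck + sk = 1 / x := by rw [eq_div_iff hk0.ne']; linarith
  have ey : cp + sp = 1 / y := by rw [eq_div_iff hp0.ne']; linarith
  have ez : cq + sq = 1 / z := by rw [eq_div_iff hq0.ne']; linarith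
  have ck' : ck = (1 / x + x) / 2 := by rw [← ex, hx]; ring
  have sk' : sk = (1 / x - x) / 2 := by rw [← ex, hx]; ring
  have cp' : cp = (1 / y + y) / 2 := by rw [← ey, hy]; ring
  have sp' : sp = (1 / y - y) / 2 := by rw [← ey, hy]; ring
  have cq' : cq = (1 / z + z) / 2 := by rw [← ez, hz]; ring
  have sq' : sq = (1 / z - z) / 2 := by rw [← ez, hz]; ring
  have e1 : cp * sq + cq * sp = (1 / (y * z) - y * z) / 2 := by
    rw [cp', cq', sp', sq']; field_simp; ring
  have e2 : ck * cq + sk * sq = (1 / (x * z) + x * z) / 2 := by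
    rw [ck', cq', sk', sq']; field_simp; ring
  have e3 : cp * ck + sp * sk = (1 / (y * x) + y * x) / 2 := by
    rw [cp', ck', sp', sk']; field_simp; ring
  rw [e1, e2, e3, show sk - ck = -x by rw [hx]; ring, mul_pow, Real.sq_sqrt (by positivity),
    ← hk1, ← hp1, ← hq1]
  clear_value x y z
  set B := fp * y ^ 2 + fq * z ^ 2 - fk * x ^ 2 + x ^ 2 * y ^ 2 * z ^ 2 * (fk + fp + fq) with hB
  have e4 : v₀ * fk * -x * ((1 / (y * z) - y * z) / 2) + v₀ * fp * y * ((1 / (x * z) + x * z) / 2)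
      + v₀ * fq * z * ((1 / (y * x) + y * x) / 2) = v₀ * B / (2 * (x * y * z)) := by
    rw [hB]
    field_simp
    ring
  rw [e4]
  clear_value B
  field_simp
  norm_num

/-- The function of `|p|` and `|k - p|` which the integrand becomes in rescaled momenta. -/
noncomputable def bipolarIntegrand (f : ℝ → ℝ) (b κ ε r u : ℝ) : ℝ :=
  vertexSq f u κ r * thermalRadial f b κ r u * approxDelta ε (disp f u - (disp f r + disp f κ))

theorem IsProfile.measurable_bipolarIntegrand {a c M δ η : ℝ} {f f₁ f₂ : ℝ → ℝ}
    (h : IsProfile a c M δ η f f₁ f₂) (b κ ε : ℝ) :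
    Measurable (Function.uncurry (bipolarIntegrand f b κ ε)) := by
  have h1 := h.continuous.measurable
  have h2 := h.continuous_disp.measurable
  have h3 := h.measurable_coherence
  have h4 : Measurable fun p : ℝ × ℝ => vertexSq f p.2 κ p.1 * thermalRadial f b κ p.1 p.2 := by
    unfold vertexSq vertexSum thermalRadial
    fun_prop
  exact h4.mul ((measurable_approxDelta ε).comp (by fun_prop))

namespace PotentialAssumptions

variable {v : Space → ℝ} {V ν : ℝ}

theorem vHat_smul (hv : PotentialAssumptions v V) (P : Space) :
    vHat v (Real.sqrt ν • P) = vHat v 0 * rescaled (profile v) (Real.sqrt ν) ‖P‖ := by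
  have := hv.vHat_zero_pos.ne'
  rw [hv.vHat_eq_radial, norm_smul, Real.norm_of_nonneg (Real.sqrt_nonneg _)]
  unfold rescaled profile
  field_simp

/-- The dispersion relation in units of the chemical potential. -/
theorem omega_smul (hv : PotentialAssumptions v V) (hν : 0 < ν) (P : Space) :
    omega v ν (Real.sqrt ν • P) = ν * disp (rescaled (profile v) (Real.sqrt ν)) ‖P‖ := by
  have h0 := hv.vHat_zero_pos.ne'
  have hs : Real.sqrt ν ^ 2 = ν := Real.sq_sqrt hν.le
  unfold omega disp velocity
  rw [hv.vHat_smul, norm_smul, Real.norm_of_nonneg (Real.sqrt_nonneg _)]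
  set y := rescaled (profile v) (Real.sqrt ν) ‖P‖
  have e : (Real.sqrt ν * ‖P‖) ^ 4 / 4 + ν * (vHat v 0 * y) / vHat v 0 * (Real.sqrt ν * ‖P‖) ^ 2
      = (ν * ‖P‖) ^ 2 * (y + ‖P‖ ^ 2 / 4) := by
    rw [show (Real.sqrt ν * ‖P‖) ^ 4 = (Real.sqrt ν ^ 2) ^ 2 * ‖P‖ ^ 4 by ring, mul_pow, hs]
    field_simp
    ring
  rw [e, Real.sqrt_mul (sq_nonneg _), Real.sqrt_sq (by positivity), mul_assoc]

variable {a c M δ η : ℝ} {f₁ f₂ : ℝ → ℝ}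

/-- The sum and the difference of the Bogoliubov coefficients are inverse to each other, and the
square of the difference is the coherence factor. -/
theorem bogoliubov_smul (hv : PotentialAssumptions v V) (hν : 0 < ν)
    (h : IsProfile a c M δ η (rescaled (profile v) (Real.sqrt ν)) f₁ f₂) {P : Space} (hP : P ≠ 0) :
    0 < cCoeff v ν (Real.sqrt ν • P) - sCoeff v ν (Real.sqrt ν • P) ∧
    (cCoeff v ν (Real.sqrt ν • P) - sCoeff v ν (Real.sqrt ν • P)) ^ 2
      = coherence (rescaled (profile v) (Real.sqrt ν)) ‖P‖ ∧
    (cCoeff v ν (Real.sqrt ν • P) - sCoeff v ν (Real.sqrt ν • P)) *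
      (cCoeff v ν (Real.sqrt ν • P) + sCoeff v ν (Real.sqrt ν • P)) = 1 := by
  have h0 := hv.vHat_zero_pos.ne'
  have hr := norm_pos_iff.2 hP
  set f := rescaled (profile v) (Real.sqrt ν) with hf
  have hw := h.disp_pos hr
  have hE : 0 < ‖P‖ ^ 2 / 2 + f ‖P‖ := by
    have := h.abs_lt_energy hr
    have := abs_nonneg (f ‖P‖)
    linarith
  have hω : 0 < ν * disp f ‖P‖ := by positivity
  have hd := h.disp_sq ‖P‖
  rw [sq_abs] at hd
  have hEs : Real.sqrt ((ν * disp f ‖P‖) ^ 2 + ν ^ 2 * ((vHat v 0 * f ‖P‖) ^ 2 / vHat v 0 ^ 2))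
      = ν * (‖P‖ ^ 2 / 2 + f ‖P‖) := by
    rw [← Real.sqrt_sq (by positivity : 0 ≤ ν * (‖P‖ ^ 2 / 2 + f ‖P‖))]
    congr 1
    have e : (vHat v 0 * f ‖P‖) ^ 2 / vHat v 0 ^ 2 = f ‖P‖ ^ 2 := by field_simp
    rw [e]
    linear_combination ν ^ 2 * hd
  have key := bogoliubov_identities (g := ν * f ‖P‖) hω
    (by positivity : 0 < ν * (‖P‖ ^ 2 / 2 + f ‖P‖)) (by linear_combination -ν ^ 2 * hd)
  unfold cCoeff sCoeff
  rw [hv.omega_smul hν, hv.vHat_smul, ← hf, hEs]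
  refine ⟨key.1, key.2.1.trans ?_, key.2.2⟩
  unfold coherence
  rw [abs_mul, abs_of_pos hν, ← mul_sub, mul_div_mul_left _ _ hν.ne']

/-- The integrand in rescaled momenta depends only on the lengths of the momenta. The excluded
values of `P` are those at which a Bogoliubov coefficient is singular. -/
theorem landauIntegrand_smul (hv : PotentialAssumptions v V) (hν : 0 < ν)
    (h : IsProfile a c M δ η (rescaled (profile v) (Real.sqrt ν)) f₁ f₂) (β ε : ℝ) {K P : Space}
    (hK : K ≠ 0) (hP : P ≠ 0) (hPK : P ≠ K) :
    landauIntegrand v ν β (Real.sqrt ν • K) ε (Real.sqrt ν • P) = vHat v 0 / (2 * Real.pi) ^ 3 *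
      bipolarIntegrand (rescaled (profile v) (Real.sqrt ν)) (β * ν) ‖K‖ (ε / ν) ‖P‖ ‖K - P‖ := by
  have h0 := hv.vHat_zero_pos
  obtain ⟨k1, k2, k3⟩ := hv.bogoliubov_smul hν h (sub_ne_zero.2 hPK)
  obtain ⟨p1, p2, p3⟩ := hv.bogoliubov_smul hν h hK
  obtain ⟨q1, q2, q3⟩ := hv.bogoliubov_smul hν h hP
  set f := rescaled (profile v) (Real.sqrt ν) with hf
  have hvert : vertex v ν (Real.sqrt ν • (P - K)) (Real.sqrt ν • K) (Real.sqrt ν • P) ^ 2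
      = ν * vHat v 0 * vertexSq f ‖P - K‖ ‖K‖ ‖P‖ := by
    unfold vertex
    rw [hv.vHat_smul, hv.vHat_smul, hv.vHat_smul, ← hf,
      vertex_algebra h0 hν k1 k2 k3 p1 p2 p3 q1 q2 q3]
    rfl
  unfold landauIntegrand
  rw [← smul_sub, ← smul_sub, hvert]
  unfold thermalFactor
  rw [← smul_sub, hv.omega_smul hν, hv.omega_smul hν, hv.omega_smul hν, ← hf, norm_sub_rev P K]
  have e1 : ν * disp f ‖K - P‖ - ν * disp f ‖P‖ - ν * disp f ‖K‖
      = ν * (disp f ‖K - P‖ - (disp f ‖P‖ + disp f ‖K‖)) := by ring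
  rw [e1, approxDelta_mul hν]
  unfold bipolarIntegrand thermalRadial
  rw [show β / 2 * (ν * disp f ‖K‖ + ν * disp f ‖K - P‖)
      = β * ν / 2 * (disp f ‖K‖ + disp f ‖K - P‖) by ring,
    show β / 2 * (ν * disp f ‖P‖) = β * ν / 2 * disp f ‖P‖ by ring,
    ← mul_assoc β ν, ← mul_assoc β ν, ← mul_assoc β ν]
  have e2 : ∀ A B T D : ℝ, 1 / A * (ν * vHat v 0 * B) * (1 / ν * D) * T
      = vHat v 0 / A * (B * T * D) := by
    intro A B T D
    field_simp
  exact e2 _ _ _ _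

/-- The damping integral in terms of the rescaled profile. -/
theorem landauIntegral_smul (hv : PotentialAssumptions v V) (hν : 0 < ν)
    (h : IsProfile a c M δ η (rescaled (profile v) (Real.sqrt ν)) f₁ f₂) {β ε : ℝ} (hβ : 0 < β)
    (hε : 0 < ε) {K : Space} (hK : K ≠ 0)
    (hfin : coreIntegral (rescaled (profile v) (Real.sqrt ν)) (β * ν) ‖K‖ (ε / ν) ≠ ⊤) :
    Integrable (landauIntegrand v ν β (Real.sqrt ν • K) ε) ∧
    landauIntegral v ν β (Real.sqrt ν • K) ε =
      ν ^ (3 / 2 : ℝ) * vHat v 0 / (4 * Real.pi * ‖K‖) *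
        (coreIntegral (rescaled (profile v) (Real.sqrt ν)) (β * ν) ‖K‖ (ε / ν)).toReal := by
  have h0 := hv.vHat_zero_pos
  have hpi := Real.pi_pos
  have hκ := norm_pos_iff.2 hK
  have hs : 0 < Real.sqrt ν := Real.sqrt_pos.2 hν
  set f := rescaled (profile v) (Real.sqrt ν) with hf
  set κ := ‖K‖ with hκe
  set g : Space → ℝ := fun P => vHat v 0 / (2 * Real.pi) ^ 3 *
    bipolarIntegrand f (β * ν) κ (ε / ν) ‖P‖ ‖K - P‖ with hg
  have hm := h.measurable_bipolarIntegrand (β * ν) κ (ε / ν)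
  have hgm : Measurable g :=
    (hm.comp (by fun_prop : Measurable fun P : Space => (‖P‖, ‖K - P‖))).const_mul _
  have hne : ∀ᵐ P : Space, P ≠ 0 ∧ P ≠ K := by
    have e1 : ∀ᵐ P : Space, P ≠ 0 := by
      simp [ae_iff]
    have e2 : ∀ᵐ P : Space, P ≠ K := by
      simp [ae_iff]
    exact e1.and e2
  have hae : (fun P => landauIntegrand v ν β (Real.sqrt ν • K) ε (Real.sqrt ν • P)) =ᵐ[volume] g := by
    filter_upwards [hne] with P hP using hv.landauIntegrand_smul hν h β ε hK hP.1 hP.2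
  have hb : 0 < β * ν := by positivity
  have hbn : ∀ r u, 0 < r → 0 < u → 0 ≤ bipolarIntegrand f (β * ν) κ (ε / ν) r u := fun r u hr hu =>
    mul_nonneg (mul_nonneg (h.vertexSq_nonneg hu hκ hr) (h.thermalRadial_nonneg hb hu hκ hr))
      (approxDelta_nonneg (by positivity) _)
  have hgn : 0 ≤ᵐ[volume] g := by
    filter_upwards [hne] with P hP
    have := hbn ‖P‖ ‖K - P‖ (norm_pos_iff.2 hP.1) (norm_pos_iff.2 (sub_ne_zero.2 hP.2.symm))
    simp only [hg, Pi.zero_apply]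
    positivity
  have hl : ∫⁻ P, ENNReal.ofReal (g P) = ENNReal.ofReal (vHat v 0 / (4 * Real.pi ^ 2 * κ)) *
      coreIntegral f (β * ν) κ (ε / ν) := by
    have hF : Measurable (Function.uncurry fun r u => ENNReal.ofReal (vHat v 0 /
        (2 * Real.pi) ^ 3 * bipolarIntegrand f (β * ν) κ (ε / ν) r u)) :=
      (hm.const_mul _).ennreal_ofReal
    have := lintegral_bipolar hK hF
    refine this.trans ?_
    unfold coreIntegral
    rw [← lintegral_const_mul' _ _ ENNReal.ofReal_ne_top]
    refine setLIntegral_congr_fun measurableSet_Ioi fun r hr => ?_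
    rw [← lintegral_const_mul' _ _ ENNReal.ofReal_ne_top]
    refine setLIntegral_congr_fun measurableSet_Ioo fun u hu => ?_
    have hr' : (0 : ℝ) < r := hr
    have hu0 : 0 < u := (abs_nonneg _).trans_lt hu.1
    rw [← ENNReal.ofReal_mul (by positivity), ← ENNReal.ofReal_mul (by positivity)]
    congr 1
    unfold bipolarIntegrand radialIntegrand
    field_simp
    ring
  have hgi : Integrable g := by
    refine ⟨hgm.aestronglyMeasurable, ?_⟩
    rw [hasFiniteIntegral_iff_ofReal hgn, hl]
    exact ENNReal.mul_lt_top ENNReal.ofReal_lt_top hfin.lt_top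
  have hint : ∫ P, g P = vHat v 0 / (4 * Real.pi ^ 2 * κ) *
      (coreIntegral f (β * ν) κ (ε / ν)).toReal := by
    rw [integral_eq_lintegral_of_nonneg_ae hgn hgm.aestronglyMeasurable, hl, ENNReal.toReal_mul,
      ENNReal.toReal_ofReal (by positivity)]
  constructor
  · rw [← integrable_comp_smul_iff volume _ hs.ne']
    exact hgi.congr hae.symm
  · have e := Measure.integral_comp_smul_of_nonneg (volume : Measure Space)
      (landauIntegrand v ν β (Real.sqrt ν • K) ε) (Real.sqrt ν) (hR := hs.le)
    rw [integral_congr_ae hae, hint, finrank_euclideanSpace_fin, smul_eq_mul,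
      eq_inv_mul_iff_mul_eq₀ (by positivity)] at e
    have e3 : Real.sqrt ν ^ 3 = ν ^ (3 / 2 : ℝ) := by
      rw [Real.sqrt_eq_rpow, ← Real.rpow_natCast, ← Real.rpow_mul hν.le]
      norm_num
    unfold landauIntegral
    rw [← e, e3]
    field_simp

end PotentialAssumptions

/-- Small momenta and temperatures, in rescaled variables: the rate exists, and is a multiple of a
rescaled leading term up to relative errors. -/
theorem exists_landau_estimate {v : Space → ℝ} {V : ℝ} (hV : 0 < V)
    (hv : PotentialAssumptions v V) : ∃ C > 0, ∃ η > 0, η ≤ 1 ∧ ∃ M, 1 ≤ M ∧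
    ∀ (ν β : ℝ) (k : Space), 0 < ν → ν ≤ V → 0 < β → k ≠ 0 →
      ‖k‖ / Real.sqrt ν < η → 1 / (β * ν) < η →
        (∀ ε : ℝ, 0 < ε → Integrable (landauIntegrand v ν β k ε)) ∧
        Tendsto (landauIntegral v ν β k) (𝓝[>] 0) (𝓝 (landauDamping v ν β k)) ∧
        |landauDamping v ν β k - landauLeading v ν β k| ≤
          C * (1 / (β * ν) ^ 2 + ‖k‖ ^ 2 / ν) * landauLeading v ν β k ∧
        landauLeading v ν β k = 9 * vHat v 0 * ν ^ (3 / 2 : ℝ) / (64 * Real.pi) *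
          energyMass (β * ν) (‖k‖ / Real.sqrt ν) (β * omega v ν k) ∧
        0 < β * omega v ν k ∧
        |β * omega v ν k - β * ν * (‖k‖ / Real.sqrt ν)| ≤
          M * (‖k‖ / Real.sqrt ν) ^ 2 * (β * ν * (‖k‖ / Real.sqrt ν)) ∧
        3 / 4 * (β * ν * (‖k‖ / Real.sqrt ν)) ≤ β * omega v ν k ∧
        β * omega v ν k ≤ 2 * (β * ν * (‖k‖ / Real.sqrt ν)) := by
  obtain ⟨a, c, M, δ, η, hc, hδ, hM, hη, H⟩ := hv.exists_isProfile hV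
  obtain ⟨C, hC, HC⟩ := exists_core_estimate (a := a) (η := η) hc hδ hM
  refine ⟨C + 1, by linarith, min η 1, lt_min hη one_pos, min_le_right _ _, M + 1, by linarith, ?_⟩
  intro ν β k hν hνV hβ hk hkη hβη
  have hs : 0 < Real.sqrt ν := Real.sqrt_pos.2 hν
  have hs2 : Real.sqrt ν ^ 2 = ν := Real.sq_sqrt hν.le
  have h0 := hv.vHat_zero_pos
  have hpi := Real.pi_pos
  obtain ⟨f₁, f₂, h⟩ := H (Real.sqrt ν) hs (hs2.le.trans hνV)
  obtain ⟨K, rfl⟩ : ∃ K : Space, k = Real.sqrt ν • K :=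
    ⟨(Real.sqrt ν)⁻¹ • k, by rw [smul_inv_smul₀ hs.ne']⟩
  have hK : K ≠ 0 := fun h => hk (by rw [h, smul_zero])
  have hκ := norm_pos_iff.2 hK
  have hnk : ‖Real.sqrt ν • K‖ = Real.sqrt ν * ‖K‖ := by
    rw [norm_smul, Real.norm_of_nonneg hs.le]
  have hnk2 : ‖Real.sqrt ν • K‖ / Real.sqrt ν = ‖K‖ := by
    rw [hnk, mul_div_cancel_left₀ _ hs.ne']
  have hnk3 : ‖Real.sqrt ν • K‖ ^ 2 / ν = ‖K‖ ^ 2 := by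
    rw [hnk, mul_pow, hs2, mul_div_cancel_left₀ _ hν.ne']
  rw [hnk2] at hkη ⊢
  rw [hnk3]
  have hb0 : 0 < β * ν := by positivity
  have hb : 1 < β * ν := by
    have := hβη.trans_le (min_le_right _ _)
    rwa [div_lt_one hb0] at this
  have hκη : ‖K‖ ≤ η := hkη.le.trans (min_le_left _ _)
  obtain ⟨hfin, Λ, hΛ, hΛe⟩ := HC _ f₁ f₂ h (β * ν) ‖K‖ hb hκ hκη
  set f := rescaled (profile v) (Real.sqrt ν) with hf
  have hω : β * omega v ν (Real.sqrt ν • K) = β * ν * disp f ‖K‖ := by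
    rw [hv.omega_smul hν, mul_assoc]
  have hT : ∀ ε : ℝ, 0 < ε → _ := fun ε hε =>
    hv.landauIntegral_smul hν h hβ hε hK (hfin (ε / ν) (by positivity))
  set A := ν ^ (3 / 2 : ℝ) * vHat v 0 / (4 * Real.pi * ‖K‖) with hA
  have hA0 : 0 < A := by positivity
  have hlim : Tendsto (landauIntegral v ν β (Real.sqrt ν • K)) (𝓝[>] 0) (𝓝 (A * Λ)) := by
    have hdiv : Tendsto (fun ε : ℝ => ε / ν) (𝓝[>] 0) (𝓝[>] 0) := by
      refine tendsto_nhdsWithin_iff.2 ⟨?_, ?_⟩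
      · have : Tendsto (fun ε : ℝ => ε / ν) (𝓝 0) (𝓝 (0 / ν)) := tendsto_id.div_const ν
        rw [zero_div] at this
        exact this.mono_left nhdsWithin_le_nhds
      · filter_upwards [self_mem_nhdsWithin] with ε hε
        exact div_pos hε hν
    refine ((hΛ.comp hdiv).const_mul A).congr' ?_
    filter_upwards [self_mem_nhdsWithin] with ε hε
    exact (hT ε hε).2.symm
  have hγ : landauDamping v ν β (Real.sqrt ν • K) = A * Λ := hlim.limUnder_eq
  have hlead' : landauLeading v ν β (Real.sqrt ν • K) = 9 * vHat v 0 * ν ^ (3 / 2 : ℝ) /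
      (64 * Real.pi) * energyMass (β * ν) ‖K‖ (β * omega v ν (Real.sqrt ν • K)) := by
    have e : β * Real.sqrt ν * (Real.sqrt ν * ‖K‖) = β * ν * ‖K‖ := by
      linear_combination β * ‖K‖ * hs2
    unfold landauLeading energyMass
    rw [hnk, e]
    ring
  have hlead : landauLeading v ν β (Real.sqrt ν • K)
      = A * (9 / 16 * ‖K‖ * energyMass (β * ν) ‖K‖ (β * ν * disp f ‖K‖)) := by
    rw [hlead', hω, hA]
    field_simp
    ring
  have hη2 := h.η_le
  obtain ⟨v1, v2, v3⟩ := h.velocity_near hκ.le (by linarith : ‖K‖ ≤ 2 * δ)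
  have hd := h.disp_pos hκ
  refine ⟨fun ε hε => (hT ε hε).1, hγ ▸ hlim, ?_, hlead', ?_, ?_, ?_, ?_⟩
  · rw [hγ, hlead, ← mul_sub, abs_mul, abs_of_pos hA0]
    have hm := energyMass_nonneg hb0 hκ (mul_pos hb0 hd).le
    calc _ ≤ A * (C * (1 / (β * ν) ^ 2 + ‖K‖ ^ 2) *
          (9 / 16 * ‖K‖ * energyMass (β * ν) ‖K‖ (β * ν * disp f ‖K‖))) := by gcongr
      _ ≤ A * ((C + 1) * (1 / (β * ν) ^ 2 + ‖K‖ ^ 2) *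
          (9 / 16 * ‖K‖ * energyMass (β * ν) ‖K‖ (β * ν * disp f ‖K‖))) := by
        gcongr
        linarith
      _ = _ := by ring
  · rw [hω]
    positivity
  · rw [hω, show β * ν * disp f ‖K‖ - β * ν * ‖K‖ = (velocity f ‖K‖ - 1) * (β * ν * ‖K‖) by
      unfold disp; ring, abs_mul, abs_of_pos (by positivity : 0 < β * ν * ‖K‖)]
    gcongr
  · rw [hω]
    unfold disp
    nlinarith [mul_pos hb0 hκ]
  · rw [hω]
    unfold disp
    nlinarith [mul_pos hb0 hκ]

/-! ### Small and large ratios of momentum and temperature -/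

theorem zetaReal_four : zetaReal 4 = Real.pi ^ 4 / 90 := by
  unfold zetaReal
  have h : riemannZeta ((4 : ℕ) : ℂ) = ((Real.pi ^ 4 / 90 : ℝ) : ℂ) := by
    push_cast
    exact riemannZeta_four
  rw [h, Complex.ofReal_re]

/-- At a small ratio `b κ` of momentum and temperature the term of `𝒢_4` dominates, and it is
linear: `2 Γ(5) ζ(4) = 8π⁴/15`. The term of `𝒢_3` and that of `𝒢_2` are smaller by one and two
powers of `b κ`. -/
theorem exists_energyMass_small_ratio {M : ℝ} (hM : 0 ≤ M) : ∃ C, 0 ≤ C ∧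
    ∀ b κ θ : ℝ, 1 < b → 0 < κ → κ ≤ 1 → b * κ ≤ 1 → 0 < θ → θ ≤ 2 * (b * κ) →
      |θ - b * κ| ≤ M * κ ^ 2 * (b * κ) →
      |energyMass b κ θ - 8 * Real.pi ^ 4 / 15 * (κ / b ^ 4)| ≤
        C * (b * κ) * (8 * Real.pi ^ 4 / 15 * (κ / b ^ 4)) := by
  set L := 8 * Real.pi ^ 4 / 15 with hL
  have hL0 : 0 < L := by have := Real.pi_pos; positivity
  have z2 := zetaReal_pos (m := 2) le_rfl
  have z3 := zetaReal_pos (m := 3) (by norm_num)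
  set A := 48 * zetaReal 3 with hA
  set B₃ := 12 * zetaReal 3 with hB₃
  set B₂ := 4 * zetaReal 2 with hB₂
  refine ⟨(4 * A + L * M + 4 * B₃ + 2 * B₂) / L, by positivity, ?_⟩
  intro b κ θ hb hκ hκ1 hτ1 hθ hθ2 hθe
  have hb0 : 0 < b := by linarith
  set τ := b * κ with hτ
  have hτ0 : 0 < τ := by positivity
  -- Since `κ ≤ 1 < b`, the correction of the phase velocity is dominated by `b κ`.
  have hκτ : κ ^ 2 ≤ τ := by nlinarith
  have g4 : |G 4 θ - L * θ| ≤ A * θ ^ 2 := by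
    have h := abs_G_sub_linear_le_sq (n := 4) (by norm_num) hθ.le
    rw [Real.Gamma_nat_eq_factorial, zetaReal_four] at h
    have e : 2 * (Nat.factorial 4 : ℝ) * (Real.pi ^ 4 / 90) = L := by
      rw [hL]
      norm_num [Nat.factorial]
      ring
    rw [e] at h
    refine h.trans (le_of_eq ?_)
    rw [hA]
    norm_num [Nat.factorial]
    ring
  have g3 : G 3 θ ≤ B₃ * θ := by
    have h := G_le_linear (n := 3) (by norm_num) hθ.le
    convert h using 2
    rw [hB₃]
    norm_num [Nat.factorial]
  have g2 : G 2 θ ≤ B₂ * θ := by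
    have h := G_le_linear (n := 2) le_rfl hθ.le
    convert h using 2
    rw [hB₂]
    norm_num [Nat.factorial]
  have n3 := G_nonneg (n := 3) hθ.le
  have n2 := G_nonneg (n := 2) hθ.le
  have hb3 : 0 < B₃ := by positivity
  have hb2 : 0 < B₂ := by positivity
  have e : energyMass b κ θ - L * (κ / b ^ 4) = 1 / b ^ 5 *
      ((G 4 θ - L * θ) + L * (θ - τ) + 2 * τ * G 3 θ + τ ^ 2 * G 2 θ) := by
    unfold energyMass
    rw [hτ]
    field_simp
    ring
  have t1 : |G 4 θ - L * θ| ≤ 4 * A * τ ^ 2 := by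
    refine g4.trans ?_
    calc A * θ ^ 2 ≤ A * (2 * τ) ^ 2 := by gcongr
      _ = _ := by ring
  have t2 : |L * (θ - τ)| ≤ L * M * τ ^ 2 := by
    rw [abs_mul, abs_of_pos hL0]
    calc L * |θ - τ| ≤ L * (M * κ ^ 2 * τ) := by gcongr
      _ ≤ L * (M * τ * τ) := by gcongr
      _ = _ := by ring
  have t3 : |2 * τ * G 3 θ| ≤ 4 * B₃ * τ ^ 2 := by
    rw [abs_of_nonneg (by positivity)]
    calc 2 * τ * G 3 θ ≤ 2 * τ * (B₃ * (2 * τ)) := by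
          gcongr
          exact g3.trans (by gcongr)
      _ = _ := by ring
  have t4 : |τ ^ 2 * G 2 θ| ≤ 2 * B₂ * τ ^ 2 := by
    rw [abs_of_nonneg (by positivity)]
    calc τ ^ 2 * G 2 θ ≤ τ ^ 2 * (B₂ * (2 * 1)) := by
          gcongr
          exact g2.trans (by gcongr; linarith)
      _ = _ := by ring
  rw [e, abs_mul, abs_of_pos (by positivity)]
  have tt : |(G 4 θ - L * θ) + L * (θ - τ) + 2 * τ * G 3 θ + τ ^ 2 * G 2 θ| ≤
      (4 * A + L * M + 4 * B₃ + 2 * B₂) * τ ^ 2 := by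
    refine (abs_add_le _ _).trans ?_
    have := abs_add_three (G 4 θ - L * θ) (L * (θ - τ)) (2 * τ * G 3 θ)
    linarith
  calc _ ≤ 1 / b ^ 5 * ((4 * A + L * M + 4 * B₃ + 2 * B₂) * τ ^ 2) := by gcongr
    _ = _ := by
      rw [hτ]
      field_simp

/-- At a large ratio `b κ` of momentum and temperature the term of `𝒢_2` dominates, and it is close
to its limit `2 Γ(3) ζ(3) = 4 ζ(3)`. -/
theorem exists_energyMass_large_ratio : ∃ C, 0 ≤ C ∧
    ∀ b κ θ : ℝ, 0 < b → 0 < κ → 1 ≤ b * κ → 3 / 4 * (b * κ) ≤ θ →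
      |energyMass b κ θ - 4 * zetaReal 3 * (κ ^ 2 / b ^ 3)| ≤
        C * (1 / (b * κ)) * (4 * zetaReal 3 * (κ ^ 2 / b ^ 3)) := by
  have z3 := zetaReal_pos (m := 3) (by norm_num)
  have z4 := zetaReal_pos (m := 4) (by norm_num)
  have z5 := zetaReal_pos (m := 5) (by norm_num)
  set L := 4 * zetaReal 3 with hL
  have hL0 : 0 < L := by positivity
  set K₃ := 24 * zetaReal 4 with hK₃
  set K₄ := 96 * zetaReal 5 with hK₄
  refine ⟨(K₄ + 2 * K₃ + 2 * L) / L, by positivity, ?_⟩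
  intro b κ θ hb0 hκ hτ1 hθτ
  set τ := b * κ with hτ
  have hτ0 : 0 < τ := by positivity
  have hθ : 0 < θ := by linarith
  have he1 : Real.exp (-θ) ≤ 1 := Real.exp_le_one_iff.2 (by linarith)
  have he2 : Real.exp (-θ) ≤ 2 / τ := by
    rw [Real.exp_neg, ← one_div, div_le_div_iff₀ (Real.exp_pos _) hτ0]
    have := Real.add_one_le_exp θ
    linarith
  have g2 : |G 2 θ - L| ≤ L * (2 / τ) := by
    have h := abs_G_sub_limit_le (n := 2) (by norm_num) hθ.le
    rw [Real.Gamma_nat_eq_factorial] at h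
    norm_num [Nat.factorial] at h
    exact h.trans (by gcongr)
  have g3 : G 3 θ ≤ K₃ := by
    have h := abs_G_sub_limit_le (n := 3) (by norm_num) hθ.le
    rw [Real.Gamma_nat_eq_factorial] at h
    norm_num [Nat.factorial] at h
    have := (abs_le.1 h).2
    nlinarith
  have g4 : G 4 θ ≤ K₄ := by
    have h := abs_G_sub_limit_le (n := 4) (by norm_num) hθ.le
    rw [Real.Gamma_nat_eq_factorial] at h
    norm_num [Nat.factorial] at h
    have := (abs_le.1 h).2
    nlinarith
  have n4 := G_nonneg (n := 4) hθ.le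
  have n3 := G_nonneg (n := 3) hθ.le
  have e : energyMass b κ θ - L * (κ ^ 2 / b ^ 3) = 1 / b ^ 5 *
      (G 4 θ + 2 * τ * G 3 θ + τ ^ 2 * (G 2 θ - L)) := by
    unfold energyMass
    rw [hτ]
    field_simp
    ring
  have t1 : |G 4 θ| ≤ K₄ * τ := by
    rw [abs_of_nonneg n4]
    have : 0 < K₄ := by positivity
    nlinarith
  have t2 : |2 * τ * G 3 θ| ≤ 2 * K₃ * τ := by
    rw [abs_of_nonneg (by positivity)]
    nlinarith
  have t3 : |τ ^ 2 * (G 2 θ - L)| ≤ 2 * L * τ := by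
    rw [abs_mul, abs_of_nonneg (by positivity)]
    calc τ ^ 2 * |G 2 θ - L| ≤ τ ^ 2 * (L * (2 / τ)) := by gcongr
      _ = _ := by field_simp
  have tt := abs_add_three (G 4 θ) (2 * τ * G 3 θ) (τ ^ 2 * (G 2 θ - L))
  rw [e, abs_mul, abs_of_pos (by positivity)]
  calc _ ≤ 1 / b ^ 5 * ((K₄ + 2 * K₃ + 2 * L) * τ) := by
        gcongr
        linarith
    _ = _ := by
      rw [hτ]
      field_simp

theorem abs_sub_le_of_relative_errors {x y z e₁ e₂ : ℝ} (he₁ : 0 ≤ e₁) (h₁ : |x - y| ≤ e₁ * y)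
    (h₂ : |y - z| ≤ e₂ * z) : |x - z| ≤ (e₁ * (1 + e₂) + e₂) * z := by
  have h3 : y ≤ (1 + e₂) * z := by linarith [(abs_le.1 h₂).2]
  have h4 : e₁ * y ≤ e₁ * ((1 + e₂) * z) := mul_le_mul_of_nonneg_left h3 he₁
  have h5 := abs_sub_le x y z
  linarith

end BoseGas

theorem mainTheorem2 (v : BoseGas.Space → ℝ) (V : ℝ) (hV : 0 < V)
    (hv : BoseGas.PotentialAssumptions v V) :
    -- the special functions
    (∀ n : ℕ, 2 ≤ n →
      (∀ θ : ℝ, 0 ≤ θ →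
        MeasureTheory.IntegrableOn (BoseGas.GIntegrand n θ) (Set.Ioi 0) ∧
        BoseGas.G n θ = 2 * Real.Gamma (n + 1) *
          (BoseGas.zetaReal (n + 1) - BoseGas.polylog (n + 1) (Real.exp (-θ)))) ∧
      ContinuousOn (BoseGas.G n) (Set.Ici 0) ∧
      (3 ≤ n → (fun θ : ℝ => BoseGas.G n θ - 2 * Real.Gamma (n + 1) * BoseGas.zetaReal n * θ)
        =O[nhdsWithin (0 : ℝ) (Set.Ioi 0)] (fun θ : ℝ => θ ^ 2)) ∧
      (n = 2 → (fun θ : ℝ => BoseGas.G n θ - 2 * Real.Gamma (n + 1) * BoseGas.zetaReal n * θ)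
        =O[nhdsWithin (0 : ℝ) (Set.Ioi 0)] (fun θ : ℝ => θ ^ 2 * Real.log θ)) ∧
      (fun θ : ℝ => BoseGas.G n θ - 2 * Real.Gamma (n + 1) * BoseGas.zetaReal (n + 1))
        =O[Filter.atTop] (fun θ : ℝ => Real.exp (-θ))) ∧
    -- small momenta and temperatures: the rate is well defined and has the stated expansion
    (∃ C > 0, ∃ η > 0, ∀ (ν β : ℝ) (k : BoseGas.Space), 0 < ν → ν ≤ V → 0 < β → k ≠ 0 →
      ‖k‖ / Real.sqrt ν < η → 1 / (β * ν) < η →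
        (∀ ε : ℝ, 0 < ε → MeasureTheory.Integrable (BoseGas.landauIntegrand v ν β k ε)) ∧
        Filter.Tendsto (BoseGas.landauIntegral v ν β k) (nhdsWithin (0 : ℝ) (Set.Ioi 0))
          (nhds (BoseGas.landauDamping v ν β k)) ∧
        |BoseGas.landauDamping v ν β k - BoseGas.landauLeading v ν β k| ≤
          C * (1 / (β * ν) ^ 2 + ‖k‖ ^ 2 / ν) * BoseGas.landauLeading v ν β k) ∧
    -- in addition, a small momentum/temperature ratio
    (∃ C > 0, ∃ η > 0, ∀ (ν β : ℝ) (k : BoseGas.Space), 0 < ν → ν ≤ V → 0 < β → k ≠ 0 →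
      ‖k‖ / Real.sqrt ν < η → 1 / (β * ν) < η → β * Real.sqrt ν * ‖k‖ < η →
        |BoseGas.landauDamping v ν β k - BoseGas.landauLeadingSmallRatio v ν β k| ≤
          C * (β * Real.sqrt ν * ‖k‖ + 1 / (β * ν) ^ 2) *
            BoseGas.landauLeadingSmallRatio v ν β k) ∧
    -- in addition, a small temperature/momentum ratio
    (∃ C > 0, ∃ η > 0, ∀ (ν β : ℝ) (k : BoseGas.Space), 0 < ν → ν ≤ V → 0 < β → k ≠ 0 →
      ‖k‖ / Real.sqrt ν < η → 1 / (β * ν) < η → 1 / (β * Real.sqrt ν * ‖k‖) < η →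
        |BoseGas.landauDamping v ν β k - BoseGas.landauLeadingLargeRatio v ν β k| ≤
          C * (1 / (β * Real.sqrt ν * ‖k‖) + ‖k‖ ^ 2 / ν) *
            BoseGas.landauLeadingLargeRatio v ν β k) := by
  obtain ⟨C, hC, η, hη, hη1, M, hM, H⟩ := BoseGas.exists_landau_estimate hV hv
  have hv0 := hv.vHat_zero_pos
  have hpi := Real.pi_pos
  have hscale : ∀ (ν β : ℝ) (k : BoseGas.Space), 0 < ν →
      β * Real.sqrt ν * ‖k‖ = β * ν * (‖k‖ / Real.sqrt ν) := by
    intro ν β k hν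
    have hs : 0 < Real.sqrt ν := Real.sqrt_pos.2 hν
    have hs2 : Real.sqrt ν ^ 2 = ν := Real.sq_sqrt hν.le
    field_simp
    rw [hs2]
    ring
  have hsq : ∀ (ν : ℝ) (k : BoseGas.Space), 0 < ν →
      ‖k‖ ^ 2 / ν = (‖k‖ / Real.sqrt ν) ^ 2 := by
    intro ν k hν
    rw [div_pow, Real.sq_sqrt hν.le]
  refine ⟨fun n hn => ⟨fun θ hθ => ⟨(BoseGas.integrableOn_and_hasSum_G (by omega) hθ).1,
    BoseGas.G_eq_zeta_sub_polylog (by omega) hθ⟩, BoseGas.continuousOn_G (by omega),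
    fun h3 => BoseGas.isBigO_G_sq h3, ?_, BoseGas.isBigO_G_atTop (by omega)⟩,
    ⟨C, hC, η, hη, fun ν β k hν hνV hβ hk h1 h2 => ?_⟩, ?_, ?_⟩
  · rintro rfl
    exact BoseGas.isBigO_G_two
  · obtain ⟨a1, a2, a3, -⟩ := H ν β k hν hνV hβ hk h1 h2
    exact ⟨a1, a2, a3⟩
  · obtain ⟨C', hC', HC⟩ := BoseGas.exists_energyMass_small_ratio (M := M) (by linarith)
    refine ⟨C * (1 + C') + C', by positivity, η, hη, fun ν β k hν hνV hβ hk h1 h2 h3 => ?_⟩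
    obtain ⟨-, -, a3, a4, a5, a6, -, a8⟩ := H ν β k hν hνV hβ hk h1 h2
    have hκ : 0 < ‖k‖ / Real.sqrt ν := div_pos (norm_pos_iff.2 hk) (Real.sqrt_pos.2 hν)
    rw [hscale ν β k hν] at h3 ⊢
    rw [hsq ν k hν] at a3
    set κ := ‖k‖ / Real.sqrt ν with hκe
    have hb0 : 0 < β * ν := by positivity
    have hb : 1 < β * ν := by
      have := h2.trans_le hη1
      rwa [div_lt_one hb0] at this
    set b := β * ν with hbe
    have hm := HC b κ (β * BoseGas.omega v ν k) hb hκ (by linarith) (by linarith) a5 a8 a6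
    set A := 9 * BoseGas.vHat v 0 * ν ^ (3 / 2 : ℝ) / (64 * Real.pi) with hA
    have hA0 : 0 < A := by positivity
    have hlead : BoseGas.landauLeadingSmallRatio v ν β k
        = A * (8 * Real.pi ^ 4 / 15 * (κ / b ^ 4)) := by
      unfold BoseGas.landauLeadingSmallRatio
      rw [← hκe, ← hbe, hA]
      field_simp
      norm_num
    have h2' : |BoseGas.landauLeading v ν β k - BoseGas.landauLeadingSmallRatio v ν β k|
        ≤ C' * (b * κ) * BoseGas.landauLeadingSmallRatio v ν β k := by
      rw [a4, hlead, ← mul_sub, abs_mul, abs_of_pos hA0]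
      calc _ ≤ A * (C' * (b * κ) * (8 * Real.pi ^ 4 / 15 * (κ / b ^ 4))) := by gcongr
        _ = _ := by ring
    have hL0 : 0 ≤ BoseGas.landauLeadingSmallRatio v ν β k := by
      rw [hlead]
      positivity
    refine (BoseGas.abs_sub_le_of_relative_errors (by positivity) a3 h2').trans ?_
    refine mul_le_mul_of_nonneg_right ?_ hL0
    have hτ0 : 0 < b * κ := by positivity
    have hτ1 : b * κ ≤ 1 := by linarith
    -- The error `κ²` of the expansion is dominated by `b κ`, since `κ ≤ 1 < b`.
    have hκτ : κ ^ 2 ≤ b * κ := by nlinarith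
    have hb2 : 0 < 1 / b ^ 2 := by positivity
    calc C * (1 / b ^ 2 + κ ^ 2) * (1 + C' * (b * κ)) + C' * (b * κ)
        ≤ C * (1 / b ^ 2 + b * κ) * (1 + C' * 1) + C' * (b * κ + 1 / b ^ 2) := by
          gcongr
          linarith
      _ = _ := by ring
  · obtain ⟨C', hC', HC⟩ := BoseGas.exists_energyMass_large_ratio
    refine ⟨2 * C * (1 + C') + C', by positivity, η, hη, fun ν β k hν hνV hβ hk h1 h2 h3 => ?_⟩
    obtain ⟨-, -, a3, a4, a5, -, a7, -⟩ := H ν β k hν hνV hβ hk h1 h2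
    have hκ : 0 < ‖k‖ / Real.sqrt ν := div_pos (norm_pos_iff.2 hk) (Real.sqrt_pos.2 hν)
    rw [hscale ν β k hν] at h3 ⊢
    rw [hsq ν k hν] at a3 ⊢
    set κ := ‖k‖ / Real.sqrt ν with hκe
    have hb0 : 0 < β * ν := by positivity
    set b := β * ν with hbe
    have hτ0 : 0 < b * κ := by positivity
    have hτ1 : 1 ≤ b * κ := by
      have := h3.trans_le hη1
      rw [div_lt_one hτ0] at this
      exact this.le
    have hm := HC b κ (β * BoseGas.omega v ν k) hb0 hκ hτ1 a7
    have z3 := BoseGas.zetaReal_pos (m := 3) (by norm_num)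
    set A := 9 * BoseGas.vHat v 0 * ν ^ (3 / 2 : ℝ) / (64 * Real.pi) with hA
    have hA0 : 0 < A := by positivity
    have hlead : BoseGas.landauLeadingLargeRatio v ν β k
        = A * (4 * BoseGas.zetaReal 3 * (κ ^ 2 / b ^ 3)) := by
      unfold BoseGas.landauLeadingLargeRatio
      rw [hsq ν k hν, ← hκe, ← hbe, hA]
      field_simp
      norm_num
    have h2' : |BoseGas.landauLeading v ν β k - BoseGas.landauLeadingLargeRatio v ν β k|
        ≤ C' * (1 / (b * κ)) * BoseGas.landauLeadingLargeRatio v ν β k := by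
      rw [a4, hlead, ← mul_sub, abs_mul, abs_of_pos hA0]
      calc _ ≤ A * (C' * (1 / (b * κ)) * (4 * BoseGas.zetaReal 3 * (κ ^ 2 / b ^ 3))) := by gcongr
        _ = _ := by ring
    have hL0 : 0 ≤ BoseGas.landauLeadingLargeRatio v ν β k := by
      rw [hlead]
      positivity
    refine (BoseGas.abs_sub_le_of_relative_errors (by positivity) a3 h2').trans ?_
    refine mul_le_mul_of_nonneg_right ?_ hL0
    have hi : 1 / (b * κ) ≤ 1 := by
      rw [div_le_one hτ0]
      exact hτ1
    -- The error `1/b²` of the expansion is dominated by `κ²`, since `1 ≤ b κ`.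
    have hbκ : 1 / b ^ 2 ≤ κ ^ 2 := by
      rw [div_le_iff₀ (by positivity)]
      nlinarith
    have hτi : 0 < 1 / (b * κ) := by positivity
    calc C * (1 / b ^ 2 + κ ^ 2) * (1 + C' * (1 / (b * κ))) + C' * (1 / (b * κ))
        ≤ C * (κ ^ 2 + κ ^ 2) * (1 + C' * 1) + C' * (1 / (b * κ)) := by gcongr
      _ ≤ C * (κ ^ 2 + κ ^ 2) * (1 + C' * 1) + C' * (1 / (b * κ))
          + (2 * C * (1 + C') * (1 / (b * κ)) + C' * κ ^ 2) := by
        have : 0 ≤ 2 * C * (1 + C') * (1 / (b * κ)) + C' * κ ^ 2 := by positivity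
        linarith
      _ = _ := by ring
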